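/- For a complex number $z$ let $d_z$ be the multiplicative function with $d_z(p^a)=\dfrac{\Gamma(z+a)}{\Gamma(z)\,a!}=\dfrac{z(z+1)\cdots(z+a-1)}{a!}$ for every prime $p$ and integer $a\ge 0$ (the last expression being the definition when $z$ is a pole of $\Gamma$). For a non-principal Dirichlet character $\chi$ mod $q$ put $L(1,\chi)^z=\exp(z\log L(1,\chi))$, where $\log L(\sigma,\chi)$ is defined by continuous variation along the real half-line from $\sigma=+\infty$, where it has the limit $0$, to $\sigma=1$. For $c>0$ let $S=S_c(q)$ be the set of (exceptional) characters $\chi$ mod $q$ for which there is $s\in\mathbb C$ with $L(s,\chi)=0$ and $\operatorname{Re}(s)\ge 1-\dfrac{c}{\log\big(q(|\operatorname{Im}(s)|+2)\big)}$. Theorem 9.2. There is an absolute constant $c_0>0$ such that for every $0<c\le c_0$ there are constants $C$ and $q_0$, depending only on $c$, with the following property. For every prime $q\ge q_0$ and all complex numbers $z_1,z_2$ with $|z_1|,|z_2|\le \dfrac{\log q}{50(\log\log q)^2}$, the series on the right below converges absolutely and $$\left|\frac{1}{\phi(q)}\sum_{\substack{\chi\ (\mathrm{mod}\ q)\\ \chi\ne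 1,\ \chi\notin S}} L(1,\chi)^{z_1}L(1,\overline{\chi})^{z_2}-\sum_{\substack{n\ge 1\\ (n,q)=1}}\frac{d_{z_1}(n)d_{z_2}(n)}{n^2}\right|\le C\exp\left(-\frac{\log q}{2\log\log q}\right).$$ -/

import Mathlib

open Filter Topology

/-- `g` is the logarithm of `L(σ, χ)` on the half-line `σ ≥ 1` obtained by continuous variation
from `σ = +∞`, where it starts with the value `0`. -/
def IsLogBranch {q : ℕ} [NeZero q] (χ : DirichletCharacter ℂ q) (g : ℝ → ℂ) : Prop :=
  ContinuousOn g (Set.Ici 1) ∧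
    (∀ σ : ℝ, 1 ≤ σ → Complex.exp (g σ) = χ.LFunction (σ : ℂ)) ∧
    Tendsto g atTop (𝓝 0)

/-- Two branches agree on the half-line. -/
theorem IsLogBranch.eqOn {q : ℕ} [NeZero q] {χ : DirichletCharacter ℂ q} {g h : ℝ → ℂ}
    (hg : IsLogBranch χ g) (hh : IsLogBranch χ h) : Set.EqOn g h (Set.Ici 1) := by
  obtain ⟨gc, ge, gt⟩ := hg
  obtain ⟨hc, he, ht⟩ := hh
  have hint : ∀ σ : ℝ, 1 ≤ σ → ∃ n : ℤ, g σ = h σ + n * (2 * Real.pi * Complex.I) := fun σ hσ ↦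
    Complex.exp_eq_exp_iff_exists_int.mp ((ge σ hσ).trans (he σ hσ).symm)
  let d : ℝ → ℝ := fun σ ↦ (g σ - h σ).im / (2 * Real.pi)
  have hd : ∀ σ : ℝ, 1 ≤ σ → ∃ n : ℤ, g σ = h σ + n * (2 * Real.pi * Complex.I) ∧ d σ = n := by
    intro σ hσ
    obtain ⟨n, hn⟩ := hint σ hσ
    refine ⟨n, hn, ?_⟩
    have : (g σ - h σ).im = n * (2 * Real.pi) := by
      rw [hn]; simp
    simp only [d, this]
    field_simp
  have dc : ContinuousOn d (Set.Ici 1) :=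
    (Complex.continuous_im.comp_continuousOn (gc.sub hc)).div_const _
  have dt : Tendsto d atTop (𝓝 0) := by
    have h1 := (Complex.continuous_im.tendsto _).comp (gt.sub ht)
    have h2 := h1.div_const (2 * Real.pi)
    simpa [d, Function.comp_def] using h2
  intro σ hσ
  have hσ' : (1 : ℝ) ≤ σ := hσ
  obtain ⟨n, hn, hdn⟩ := hd σ hσ'
  by_cases hn0 : n = 0
  · simpa [hn0] using hn
  exfalso
  have hev : ∀ᶠ τ in atTop, |d τ| < 1 / 2 ∧ σ ≤ τ := by
    refine Filter.Eventually.and ?_ (eventually_ge_atTop σ)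
    have := dt.abs
    rw [abs_zero] at this
    exact this.eventually (gt_mem_nhds (by norm_num))
  obtain ⟨τ, hτ, hστ⟩ := hev.exists
  have hge : 1 ≤ |d σ| := by
    rw [hdn]
    exact_mod_cast Int.one_le_abs hn0
  have hcont : ContinuousOn (fun x ↦ |d x|) (Set.Icc σ τ) :=
    (dc.mono fun x hx ↦ hσ'.trans hx.1).abs
  obtain ⟨x, hx, hx2⟩ := intermediate_value_Icc' hστ hcont
    (show (1 / 2 : ℝ) ∈ Set.Icc |d τ| |d σ| from ⟨hτ.le, by linarith⟩)
  obtain ⟨m, -, hm⟩ := hd x (hσ'.trans hx.1)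
  simp only [hm] at hx2
  have h2 : (2 * |m| : ℤ) = 1 := by
    have : (2 : ℝ) * |(m : ℝ)| = 1 := by linarith
    exact_mod_cast this
  omega

/-- The branch exists for every non-principal character. -/
theorem exists_isLogBranch {q : ℕ} [NeZero q] {χ : DirichletCharacter ℂ q} (hχ : χ ≠ 1) :
    ∃ g : ℝ → ℂ, IsLogBranch χ g := by
  have hdiff : Differentiable ℂ χ.LFunction := DirichletCharacter.differentiable_LFunction hχ
  have hne : ∀ σ : ℝ, 1 ≤ σ → χ.LFunction (σ : ℂ) ≠ 0 := fun σ hσ ↦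
    DirichletCharacter.LFunction_ne_zero_of_one_le_re χ (.inl hχ) (by simpa using hσ)
  have hL : ∀ σ : ℝ, HasDerivAt (fun x : ℝ ↦ χ.LFunction (x : ℂ))
      (deriv χ.LFunction (σ : ℂ)) σ := fun σ ↦
    (hdiff (σ : ℂ)).hasDerivAt.comp_ofReal
  let u : ℝ → ℂ := fun x ↦
    deriv χ.LFunction ((max x 1 : ℝ) : ℂ) / χ.LFunction ((max x 1 : ℝ) : ℂ)
  have hu : Continuous u := by
    have hmax : Continuous fun x : ℝ ↦ ((max x 1 : ℝ) : ℂ) := by fun_prop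
    refine Continuous.div ?_ (hdiff.continuous.comp hmax) fun x ↦ hne _ (le_max_right _ _)
    exact (hdiff.contDiff (n := 1)).continuous_deriv le_rfl |>.comp hmax
  have hu1 : ∀ x : ℝ, 1 ≤ x → u x = deriv χ.LFunction (x : ℂ) / χ.LFunction (x : ℂ) := by
    intro x hx; simp only [u, max_eq_left hx]
  -- the limit of `L(σ, χ)` at infinity
  have hlim : Tendsto (fun x : ℝ ↦ χ.LFunction (x : ℂ)) atTop (𝓝 1) := by
    have h1 : LSeries.abscissaOfAbsConv (fun n : ℕ ↦ χ n) < ⊤ := by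
      refine lt_of_le_of_lt (LSeries.abscissaOfAbsConv_le_of_forall_lt_LSeriesSummable (x := 1)
        fun y hy ↦ ?_) (by exact_mod_cast EReal.coe_lt_top 1)
      exact ZMod.LSeriesSummable_of_one_lt_re χ (by simpa using hy)
    have h2 := LSeries.tendsto_atTop h1
    simp only [Nat.cast_one, map_one] at h2
    refine h2.congr' ?_
    filter_upwards [eventually_gt_atTop 1] with x hx
    exact (DirichletCharacter.LFunction_eq_LSeries χ (by simpa using hx)).symm
  obtain ⟨a, ha1, ha⟩ : ∃ a : ℝ, 1 ≤ a ∧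
      ∀ x, a ≤ x → χ.LFunction (x : ℂ) ∈ Complex.slitPlane := by
    have := hlim.eventually (Complex.isOpen_slitPlane.mem_nhds Complex.one_mem_slitPlane)
    obtain ⟨b, hb⟩ := eventually_atTop.mp this
    exact ⟨max b 1, le_max_right _ _, fun x hx ↦ hb x ((le_max_left _ _).trans hx)⟩
  let g : ℝ → ℂ := fun x ↦ Complex.log (χ.LFunction (a : ℂ)) + ∫ t in a..x, u t
  have hgd : ∀ x, HasDerivAt g (u x) x := fun x ↦
    (intervalIntegral.integral_hasDerivAt_right (hu.intervalIntegrable _ _)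
      (hu.stronglyMeasurableAtFilter _ _) hu.continuousAt).const_add _
  have hgc : Continuous g := continuous_iff_continuousAt.mpr fun x ↦ (hgd x).continuousAt
  have hga : g a = Complex.log (χ.LFunction (a : ℂ)) := by simp [g]
  refine ⟨g, hgc.continuousOn, ?_, ?_⟩
  · -- `L · exp (-g)` is constant
    let F : ℝ → ℂ := fun x ↦ χ.LFunction (x : ℂ) * Complex.exp (-g x)
    have hF : ∀ x, 1 ≤ x → HasDerivAt F 0 x := by
      intro x hx
      have h1 : HasDerivAt F (deriv χ.LFunction (x : ℂ) * Complex.exp (-g x) +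
          χ.LFunction (x : ℂ) * (Complex.exp (-g x) * -u x)) x :=
        (hL x).mul (hgd x).neg.cexp
      have h2 : deriv χ.LFunction (x : ℂ) * Complex.exp (-g x) +
          χ.LFunction (x : ℂ) * (Complex.exp (-g x) * -u x) = 0 := by
        have h3 := hne x hx
        rw [hu1 x hx]
        field_simp
        ring
      rwa [h2] at h1
    have hFc : ∀ x, 1 ≤ x → F x = F 1 := by
      intro x hx
      refine constant_of_has_deriv_right_zero (a := 1) (b := x) ?_ ?_ x ⟨hx, le_rfl⟩
      · exact fun y hy ↦ (hF y hy.1).continuousAt.continuousWithinAt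
      · exact fun y hy ↦ (hF y hy.1).hasDerivWithinAt
    intro x hx
    have h1 : F x = 1 := by
      rw [hFc x hx, ← hFc a ha1]
      simp only [F, hga, Complex.exp_neg, Complex.exp_log (hne a ha1)]
      exact mul_inv_cancel₀ (hne a ha1)
    simp only [F, Complex.exp_neg] at h1
    rw [mul_inv_eq_one₀ (Complex.exp_ne_zero _)] at h1
    exact h1.symm
  · have hlog : Tendsto (fun x : ℝ ↦ Complex.log (χ.LFunction (x : ℂ))) atTop (𝓝 0) := by
      have := (continuousAt_clog Complex.one_mem_slitPlane).tendsto.comp hlim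
      simpa [Function.comp_def] using this
    refine hlog.congr' ?_
    filter_upwards [eventually_ge_atTop a] with x hx
    let G : ℝ → ℂ := fun x ↦ Complex.log (χ.LFunction (x : ℂ)) - g x
    have hG : ∀ y, a ≤ y → HasDerivAt G 0 y := by
      intro y hy
      have h1 : HasDerivAt G (deriv χ.LFunction (y : ℂ) / χ.LFunction (y : ℂ) - u y) y :=
        ((hL y).clog_real (ha y hy)).sub (hgd y)
      rwa [hu1 y (ha1.trans hy), sub_self] at h1
    have hGx : G x = G a := by
      refine constant_of_has_deriv_right_zero (a := a) (b := x) ?_ ?_ x ⟨hx, le_rfl⟩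
      · exact fun y hy ↦ (hG y hy.1).continuousAt.continuousWithinAt
      · exact fun y hy ↦ (hG y hy.1).hasDerivWithinAt
    simp only [G, hga, sub_self] at hGx
    exact sub_eq_zero.mp hGx

open Classical in
/-- `log L(1, χ)`, by continuous variation along the half-line from `+∞` to `1`, for
non-principal `χ` (the value `0` for the principal character is never used). -/
noncomputable def logLOne {q : ℕ} [NeZero q] (χ : DirichletCharacter ℂ q) : ℂ :=
  if h : ∃ g : ℝ → ℂ, IsLogBranch χ g then h.choose 1 else 0

/-- Any branch can be used to compute `log L(1, χ)`. -/
theorem IsLogBranch.logLOne_eq {q : ℕ} [NeZero q] {χ : DirichletCharacter ℂ q} {g : ℝ → ℂ}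
    (hg : IsLogBranch χ g) : logLOne χ = g 1 := by
  have h : ∃ g : ℝ → ℂ, IsLogBranch χ g := ⟨g, hg⟩
  rw [logLOne, dif_pos h]
  exact h.choose_spec.eqOn hg (Set.mem_Ici.mpr le_rfl)

theorem exp_logLOne {q : ℕ} [NeZero q] {χ : DirichletCharacter ℂ q} (hχ : χ ≠ 1) :
    Complex.exp (logLOne χ) = χ.LFunction 1 := by
  obtain ⟨g, hg⟩ := exists_isLogBranch hχ
  rw [hg.logLOne_eq, hg.2.1 1 le_rfl, Complex.ofReal_one]

/-- The complex power `L(1, χ) ^ z`. -/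
noncomputable def LOnePow {q : ℕ} [NeZero q] (χ : DirichletCharacter ℂ q) (z : ℂ) : ℂ :=
  Complex.exp (z * logLOne χ)

/-- The `z`-th divisor function: multiplicative in `n`, with
`d_z(p ^ a) = Γ(z + a) / (Γ(z) a!) = z (z + 1) ⋯ (z + a - 1) / a!`. -/
noncomputable def divisorFn (z : ℂ) (n : ℕ) : ℂ :=
  if n = 0 then 0
  else n.factorization.prod fun _ a ↦ (ascPochhammer ℂ a).eval z / (Nat.factorial a : ℂ)

/-- `χ` mod `q` is exceptional with respect to the constant `c`: `L(s, χ)` has a zero with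
`Re s ≥ 1 - c / log (q (|Im s| + 2))`. -/
def IsExceptional (c : ℝ) {q : ℕ} [NeZero q] (χ : DirichletCharacter ℂ q) : Prop :=
  ∃ s : ℂ, 1 - c / Real.log ((q : ℝ) * (|s.im| + 2)) ≤ s.re ∧ χ.LFunction s = 0

open Classical in
/-- The non-principal, non-exceptional characters mod `q`. -/
noncomputable def goodCharacters (c : ℝ) (q : ℕ) [NeZero q] :
    Finset (DirichletCharacter ℂ q) :=
  Finset.univ.filter fun χ ↦ χ ≠ 1 ∧ ¬ IsExceptional c χ

section

/-! ### The divisor functions -/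

/-! Let χ be non-principal and non-exceptional. Then F(s) = L(s,χ)^{z₁} L(s,χ̄)^{z₂} is holomorphic
on a disc about 2 that reaches past 1 by c/log(4q), and Borel–Carathéodory bounds log F by
(|z₁|+|z₂|) · O(log² q / c) on a slightly smaller disc. Hence F(1) is, with tiny error, the Taylor
polynomial of F at 2 with K ≈ (log q)^5 terms. Differentiating the Dirichlet series Σ b(n) n^{-s}
termwise turns this polynomial into Σ b(n) w_K(n)/n, where w_K(n) = n^{-1} Σ_{j<K} (log n)^j/j! is a
Poisson cutoff: near 1 while log n is well below K, and O(n^{-1/(K+1)}) always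
(`norm_LOnePow_mul_sub_le`, `poissonWeight_le`, `one_sub_poissonWeight_le`).

These model sums make sense for every character, so they can be averaged over the whole group.
Orthogonality leaves pairs u ≡ v mod q. The diagonal u = v yields the main term, because 1 - w_K(n²)
is negligible. Off the diagonal the larger of u, v exceeds q, and the congruence saves a factor: a
recursion over the order of the divisor function (`classTail_succ_le`, `offDiagonal_le`) reduces the
sum to the size of d_k(m)/m at single large integers m < q, which is at most exp(-log q/log log q).
Against this stands the trivial bound ζ(1+1/(K+1))^{2k} ≤ (K+2)^{2k} ≤ exp(log q/(4 log log q)),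
where k is the least integer at least log q/(50 (log log q)²).

The 3-4-1 argument (`exists_zeroFree_region`) shows that an exceptional χ satisfies χ² = 1, and a
prime modulus has at most two such characters. Their model sums, estimated trivially, cost only a
factor 2/φ(q), so nothing about real zeros is needed. -/

theorem divisorFn_zero_right (z : ℂ) : divisorFn z 0 = 0 := by simp [divisorFn]

theorem divisorFn_one_right (z : ℂ) : divisorFn z 1 = 1 := by simp [divisorFn]

theorem divisorFn_mul_of_coprime (z : ℂ) {m n : ℕ} (h : m.Coprime n) :
    divisorFn z (m * n) = divisorFn z m * divisorFn z n := by
  rcases eq_or_ne m 0 with rfl | hm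
  · simp [divisorFn]
  rcases eq_or_ne n 0 with rfl | hn
  · simp [divisorFn]
  simp only [divisorFn, hm, hn, mul_eq_zero, or_self, if_false]
  rw [Nat.factorization_mul_of_coprime h]
  exact Finsupp.prod_add_index_of_disjoint h.disjoint_primeFactors _

theorem divisorFn_prime_pow (z : ℂ) {p : ℕ} (hp : p.Prime) (a : ℕ) :
    divisorFn z (p ^ a) = (ascPochhammer ℂ a).eval z / (a.factorial : ℂ) := by
  rw [divisorFn, if_neg (pow_ne_zero _ hp.ne_zero), hp.factorization_pow,
    Finsupp.prod_single_index (by simp)]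

/-- Factor by factor, |z + a| ≤ k + a. This is how complex exponents are dominated by divisor
functions of integer order, which count factorisations. -/
theorem norm_ascPochhammer_eval_le {z : ℂ} {k : ℕ} (hz : ‖z‖ ≤ k) (a : ℕ) :
    ‖(ascPochhammer ℂ a).eval z‖ ≤ ‖(ascPochhammer ℂ a).eval (k : ℂ)‖ := by
  induction a with
  | zero => simp
  | succ a ih =>
    simp only [ascPochhammer_succ_eval, norm_mul]
    gcongr
    calc ‖z + a‖ ≤ ‖z‖ + ‖(a : ℂ)‖ := norm_add_le _ _
      _ ≤ k + a := by simpa using hz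
      _ = ‖((k + a : ℕ) : ℂ)‖ := by rw [Complex.norm_natCast]; simp
      _ = ‖(k : ℂ) + a‖ := by push_cast; rfl

theorem norm_divisorFn_le_norm_divisorFn_natCast {z : ℂ} {k : ℕ} (hz : ‖z‖ ≤ k) (n : ℕ) :
    ‖divisorFn z n‖ ≤ ‖divisorFn k n‖ := by
  rw [divisorFn, divisorFn]
  split_ifs
  · simp
  rw [Finsupp.prod, Finsupp.prod, norm_prod, norm_prod]
  refine Finset.prod_le_prod (fun _ _ ↦ norm_nonneg _) fun p _ ↦ ?_
  rw [norm_div, norm_div]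
  gcongr
  exact norm_ascPochhammer_eval_le hz _

/-- The number of ordered factorisations of `n` into `k` positive factors. -/
def numFactorizations (k : ℕ) : ArithmeticFunction ℕ := ArithmeticFunction.zeta ^ k

theorem numFactorizations_zero_left (n : ℕ) : numFactorizations 0 n = if n = 1 then 1 else 0 := by
  simp [numFactorizations, ArithmeticFunction.one_apply]

theorem numFactorizations_succ (k n : ℕ) :
    numFactorizations (k + 1) n = ∑ p ∈ n.divisorsAntidiagonal, numFactorizations k p.1 := by
  rw [numFactorizations, pow_succ, ArithmeticFunction.mul_apply]
  refine Finset.sum_congr rfl fun p hp ↦ ?_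
  have := Nat.ne_zero_of_mem_divisorsAntidiagonal hp
  rw [ArithmeticFunction.zeta_apply, if_neg this.2, mul_one]; rfl

theorem isMultiplicative_numFactorizations (k : ℕ) : (numFactorizations k).IsMultiplicative := by
  induction k with
  | zero => exact ArithmeticFunction.isMultiplicative_one
  | succ k ih =>
    rw [numFactorizations, pow_succ]
    exact ih.mul ArithmeticFunction.isMultiplicative_zeta

/-- Coefficient form of (1-x)^{-z} (1-x)^{-1} = (1-x)^{-(z+1)}; at prime powers it matches one more
convolution with `zeta`. -/
theorem sum_range_ascPochhammer_div_factorial (z : ℂ) (a : ℕ) :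
    ∑ i ∈ Finset.range (a + 1), (ascPochhammer ℂ i).eval z / (i.factorial : ℂ) =
      (ascPochhammer ℂ a).eval (z + 1) / (a.factorial : ℂ) := by
  induction a with
  | zero => simp
  | succ a ih =>
    have hl : (ascPochhammer ℂ (a + 1)).eval z = z * (ascPochhammer ℂ a).eval (z + 1) := by
      simp [ascPochhammer_succ_left]
    rw [Finset.sum_range_succ, ih, hl, ascPochhammer_succ_eval, Nat.factorial_succ]
    have h1 : ((a : ℂ) + 1) ≠ 0 := by exact_mod_cast Nat.succ_ne_zero a
    have h2 : (a.factorial : ℂ) ≠ 0 := by exact_mod_cast Nat.factorial_ne_zero a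
    push_cast
    field_simp
    ring

theorem numFactorizations_prime_pow (k : ℕ) {p : ℕ} (hp : p.Prime) (a : ℕ) :
    (numFactorizations k (p ^ a) : ℂ) = (ascPochhammer ℂ a).eval (k : ℂ) / (a.factorial : ℂ) := by
  induction k generalizing a with
  | zero =>
    rw [numFactorizations_zero_left]
    rcases eq_or_ne a 0 with rfl | ha
    · simp
    · simp [ha, hp.ne_one]
  | succ k ih =>
    rw [numFactorizations_succ, Nat.sum_divisorsAntidiagonal (f := fun i _ ↦ numFactorizations k i),
      Nat.sum_divisors_prime_pow hp]
    push_cast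
    rw [Finset.sum_congr rfl fun i _ ↦ ih i, sum_range_ascPochhammer_div_factorial]

theorem divisorFn_natCast (k n : ℕ) : divisorFn k n = numFactorizations k n := by
  induction n using Nat.recOnPosPrimePosCoprime with
  | zero => simp [divisorFn_zero_right]
  | one => simp [divisorFn_one_right, (isMultiplicative_numFactorizations k).map_one]
  | prime_pow p n hp hn => rw [divisorFn_prime_pow _ hp, numFactorizations_prime_pow _ hp]
  | coprime a b ha hb hab iha ihb =>
    rw [divisorFn_mul_of_coprime _ hab, iha, ihb,
      (isMultiplicative_numFactorizations k).map_mul_of_coprime hab, Nat.cast_mul]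

theorem norm_divisorFn_le {z : ℂ} {k : ℕ} (hz : ‖z‖ ≤ k) (n : ℕ) :
    ‖divisorFn z n‖ ≤ numFactorizations k n := by
  simpa [divisorFn_natCast] using norm_divisorFn_le_norm_divisorFn_natCast hz n

/-- Every divisor of m n is a divisor of m times a divisor of n, so the divisor-sum recursion for m
n is dominated by the product of the recursions for m and n. -/
theorem numFactorizations_mul_le_mul (k : ℕ) {m n : ℕ} (hm : m ≠ 0) (hn : n ≠ 0) :
    numFactorizations k (m * n) ≤ numFactorizations k m * numFactorizations k n := by
  induction k generalizing m n with
  | zero => simp [numFactorizations_zero_left]; split_ifs <;> simp_all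
  | succ k ih =>
    have hs : ∀ n, numFactorizations (k + 1) n = ∑ d ∈ n.divisors, numFactorizations k d :=
      fun n ↦ by
        rw [numFactorizations_succ,
          Nat.sum_divisorsAntidiagonal (f := fun i _ ↦ numFactorizations k i)]
    rw [hs, hs, hs, Finset.sum_mul_sum, ← Finset.sum_product']
    calc ∑ d ∈ (m * n).divisors, numFactorizations k d
        ≤ ∑ d ∈ (m.divisors ×ˢ n.divisors).image (fun p ↦ p.1 * p.2), numFactorizations k d := by
          refine Finset.sum_le_sum_of_subset fun d hd ↦ ?_
          obtain ⟨a, b, ha, hb, rfl⟩ := exists_dvd_and_dvd_of_dvd_mul (Nat.dvd_of_mem_divisors hd)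
          exact Finset.mem_image.mpr ⟨(a, b), by simp [ha, hb, hm, hn], rfl⟩
      _ ≤ ∑ p ∈ m.divisors ×ˢ n.divisors, numFactorizations k (p.1 * p.2) :=
          Finset.sum_image_le_of_nonneg (fun _ _ ↦ Nat.zero_le _)
      _ ≤ ∑ p ∈ m.divisors ×ˢ n.divisors, numFactorizations k p.1 * numFactorizations k p.2 := by
          refine Finset.sum_le_sum fun p hp ↦ ?_
          rw [Finset.mem_product] at hp
          exact ih (Nat.pos_of_mem_divisors hp.1).ne' (Nat.pos_of_mem_divisors hp.2).ne'

/-- Products of divisor functions are bounded by divisor functions of the product order. -/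
theorem numFactorizations_mul_le (k l n : ℕ) :
    numFactorizations k n * numFactorizations l n ≤ numFactorizations (l * k) n := by
  induction l generalizing n with
  | zero =>
    simp only [numFactorizations_zero_left, zero_mul]
    split_ifs with h
    · simp [h, (isMultiplicative_numFactorizations k).map_one]
    · simp
  | succ l ih =>
    have h : numFactorizations ((l + 1) * k) n =
        ∑ p ∈ n.divisorsAntidiagonal, numFactorizations (l * k) p.1 * numFactorizations k p.2 := by
      rw [add_mul, one_mul, numFactorizations, pow_add, ArithmeticFunction.mul_apply]; rfl
    rw [h, numFactorizations_succ, Finset.mul_sum]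
    refine Finset.sum_le_sum fun p hp ↦ ?_
    obtain ⟨h1, h2⟩ := Nat.ne_zero_of_mem_divisorsAntidiagonal hp
    -- Writing n = p.1 * p.2 lets submultiplicativity split the factor of order k; the induction
    -- hypothesis then merges the two factors at p.1.
    rw [← (Nat.mem_divisorsAntidiagonal.mp hp).1]
    calc _ ≤ numFactorizations k p.1 * numFactorizations k p.2 * numFactorizations l p.1 :=
          Nat.mul_le_mul_right _ (numFactorizations_mul_le_mul k h1 h2)
      _ = numFactorizations k p.1 * numFactorizations l p.1 * numFactorizations k p.2 := by ring
      _ ≤ _ := Nat.mul_le_mul_right _ (ih p.1)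

/-! ### Dirichlet series with extended nonnegative real values -/

open scoped ENNReal

/-- Values in [0,∞] make every rearrangement legitimate. The vanishing on the axes is needed because
pairs with a zero entry lie in no `divisorsAntidiagonal`. -/
theorem ENNReal.tsum_divisorsAntidiagonal (H : ℕ → ℕ → ℝ≥0∞) (h1 : ∀ b, H 0 b = 0)
    (h2 : ∀ a, H a 0 = 0) :
    ∑' n : ℕ, ∑ p ∈ n.divisorsAntidiagonal, H p.1 p.2 = ∑' a : ℕ, ∑' b : ℕ, H a b := by
  rw [← ENNReal.tsum_prod (f := H)]
  have key : ∀ n : ℕ, ∑ p ∈ n.divisorsAntidiagonal, H p.1 p.2 =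
      ∑' x : ℕ × ℕ, if x.1 * x.2 = n then H x.1 x.2 else 0 := by
    intro n
    rw [tsum_eq_sum (s := n.divisorsAntidiagonal)]
    · refine Finset.sum_congr rfl fun p hp ↦ ?_
      rw [if_pos (Nat.mem_divisorsAntidiagonal.mp hp).1]
    · rintro ⟨a, b⟩ hp
      rw [Nat.mem_divisorsAntidiagonal, not_and_or, not_ne_iff] at hp
      split_ifs with h
      · rcases hp with hp | rfl
        · exact absurd h hp
        · rcases mul_eq_zero.mp h with h | h <;> simp_all
      · rfl
  simp_rw [key]
  rw [ENNReal.tsum_comm]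
  refine tsum_congr fun x ↦ ?_
  rw [tsum_eq_single (x.1 * x.2)]
  · simp
  · intro n hn
    rw [if_neg hn.symm]

/-- The function `n ↦ n ^ (-σ)` on positive integers, extended by `0` at `0`. -/
noncomputable def natRpowNeg (σ : ℝ) (n : ℕ) : ℝ≥0∞ :=
  if n = 0 then 0 else ENNReal.ofReal ((n : ℝ) ^ (-σ))

@[simp] theorem natRpowNeg_zero (σ : ℝ) : natRpowNeg σ 0 = 0 := by simp [natRpowNeg]

@[simp] theorem natRpowNeg_one (σ : ℝ) : natRpowNeg σ 1 = 1 := by simp [natRpowNeg]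

theorem natRpowNeg_mul (σ : ℝ) (m n : ℕ) :
    natRpowNeg σ (m * n) = natRpowNeg σ m * natRpowNeg σ n := by
  rcases eq_or_ne m 0 with rfl | hm
  · simp
  rcases eq_or_ne n 0 with rfl | hn
  · simp
  rw [natRpowNeg, natRpowNeg, natRpowNeg, if_neg hm, if_neg hn, if_neg (mul_ne_zero hm hn),
    ← ENNReal.ofReal_mul (by positivity), Nat.cast_mul, Real.mul_rpow (by positivity) (by positivity)]

/-- The zeta function on the real axis. -/
noncomputable def realZeta (σ : ℝ) : ℝ≥0∞ := ∑' n, natRpowNeg σ n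

theorem tsum_numFactorizations (σ : ℝ) (k : ℕ) :
    ∑' n, (numFactorizations k n : ℝ≥0∞) * natRpowNeg σ n = realZeta σ ^ k := by
  induction k with
  | zero =>
    rw [tsum_eq_single 1]
    · simp [numFactorizations_zero_left]
    · intro n hn; simp [numFactorizations_zero_left, hn]
  | succ k ih =>
    rw [pow_succ, ← ih, ← ENNReal.tsum_mul_right]
    simp_rw [realZeta, ← ENNReal.tsum_mul_left]
    rw [← ENNReal.tsum_divisorsAntidiagonal
      (fun a b ↦ (numFactorizations k a : ℝ≥0∞) * natRpowNeg σ a * natRpowNeg σ b)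
      (by simp) (by simp)]
    refine tsum_congr fun n ↦ ?_
    rw [numFactorizations_succ]
    push_cast
    rw [Finset.sum_mul]
    refine Finset.sum_congr rfl fun p hp ↦ ?_
    rw [mul_assoc, ← natRpowNeg_mul, (Nat.mem_divisorsAntidiagonal.mp hp).1]

/-- `ZetaAsymptotics.zeta_limit_aux1` expresses ζ(σ) - 1/(σ-1) as 1 minus a nonnegative quantity. -/
theorem realZeta_le {σ : ℝ} (hσ : 1 < σ) : realZeta σ ≤ ENNReal.ofReal (σ / (σ - 1)) := by
  have h1 := ZetaAsymptotics.zeta_limit_aux1 hσ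
  have h2 : 0 ≤ ZetaAsymptotics.termTSum σ := tsum_nonneg fun n ↦ ZetaAsymptotics.term_nonneg _ _
  have h3 : Summable fun n : ℕ ↦ 1 / ((n : ℝ) + 1) ^ σ := by
    have := (summable_nat_add_iff 1).mpr (Real.summable_one_div_nat_rpow.mpr hσ)
    simpa using this
  rw [realZeta, tsum_eq_zero_add' ENNReal.summable, natRpowNeg_zero, zero_add]
  have h4 : ∀ n : ℕ, natRpowNeg σ (n + 1) = ENNReal.ofReal (1 / ((n : ℝ) + 1) ^ σ) := by
    intro n
    rw [natRpowNeg, if_neg (Nat.succ_ne_zero n), Real.rpow_neg (by positivity)]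
    push_cast
    rw [one_div]
  simp_rw [h4]
  rw [← ENNReal.ofReal_tsum_of_nonneg (fun n ↦ by positivity) h3]
  refine ENNReal.ofReal_le_ofReal ?_
  have h5 : σ / (σ - 1) = 1 + 1 / (σ - 1) := by
    have : σ - 1 ≠ 0 := by linarith
    field_simp; ring
  rw [h5]
  nlinarith

end

section

/-! ### Complex powers of Dirichlet `L`-functions in the half-plane of absolute convergence -/

open scoped ENNReal LSeries.notation

/-- The logarithm of the Euler product of `L(s, χ)`. -/
noncomputable def logEulerProduct {q : ℕ} (χ : DirichletCharacter ℂ q) (s : ℂ) : ℂ :=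
  ∑' p : Nat.Primes, -Complex.log (1 - χ p * (p : ℂ) ^ (-s))

theorem enorm_term_eq (f : ℕ → ℂ) (s : ℂ) (n : ℕ) :
    ‖LSeries.term f s n‖ₑ = ‖f n‖ₑ * natRpowNeg s.re n := by
  rcases eq_or_ne n 0 with rfl | hn
  · simp
  have hn' : 0 < n := Nat.pos_of_ne_zero hn
  rw [LSeries.term_of_ne_zero hn, natRpowNeg, if_neg hn, ← ofReal_norm, ← ofReal_norm,
    ← ENNReal.ofReal_mul (norm_nonneg _), norm_div, Complex.norm_natCast_cpow_of_pos hn',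
    Real.rpow_neg (Nat.cast_nonneg n), div_eq_mul_inv]

theorem realZeta_pow_lt_top {σ : ℝ} (hσ : 1 < σ) (k : ℕ) : realZeta σ ^ k < ⊤ :=
  ENNReal.pow_lt_top ((realZeta_le hσ).trans_lt ENNReal.ofReal_lt_top)

theorem summable_norm_of_tsum_enorm_ne_top {ι E : Type*} [SeminormedAddCommGroup E] {f : ι → E}
    (h : ∑' i, ‖f i‖ₑ ≠ ⊤) : Summable fun i ↦ ‖f i‖ := by
  have := ENNReal.summable_toReal h
  simpa using this

theorem enorm_divisorFn_le {z : ℂ} {k : ℕ} (hz : ‖z‖ ≤ k) (n : ℕ) :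
    ‖divisorFn z n‖ₑ ≤ numFactorizations k n := by
  rw [← ofReal_norm, ← ENNReal.ofReal_natCast]
  exact ENNReal.ofReal_le_ofReal (norm_divisorFn_le hz n)

theorem enorm_character_le_one {q : ℕ} (χ : DirichletCharacter ℂ q) (a : ZMod q) : ‖χ a‖ₑ ≤ 1 := by
  rw [← ofReal_norm, ← ENNReal.ofReal_one]
  exact ENNReal.ofReal_le_ofReal (χ.norm_le_one a)

theorem LSeriesSummable_divisorFn_mul {q : ℕ} (χ : DirichletCharacter ℂ q) (z : ℂ) {s : ℂ}
    (hs : 1 < s.re) : LSeriesSummable (fun n ↦ divisorFn z n * χ n) s := by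
  obtain ⟨k, hk⟩ := exists_nat_ge ‖z‖
  refine (summable_norm_of_tsum_enorm_ne_top (ne_top_of_le_ne_top
    (realZeta_pow_lt_top hs k).ne ?_)).of_norm
  rw [← tsum_numFactorizations]
  refine ENNReal.tsum_le_tsum fun n ↦ ?_
  rw [enorm_term_eq, enorm_mul]
  gcongr
  calc _ ≤ (numFactorizations k n : ℝ≥0∞) * 1 := by
        gcongr
        · exact enorm_divisorFn_le hk n
        · exact enorm_character_le_one χ _
    _ = _ := mul_one _

theorem norm_character_mul_cpow_lt_one {q : ℕ} (χ : DirichletCharacter ℂ q) {s : ℂ} (hs : 0 < s.re)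
    {p : ℕ} (hp : p.Prime) : ‖χ p * (p : ℂ) ^ (-s)‖ < 1 := by
  rw [norm_mul, Complex.norm_natCast_cpow_of_pos hp.pos]
  calc _ ≤ 1 * (p : ℝ) ^ (-s).re := by gcongr; exact χ.norm_le_one _
    _ < 1 := by
      rw [one_mul]
      exact Real.rpow_lt_one_of_one_lt_of_neg (by exact_mod_cast hp.one_lt) (by simpa using hs)

theorem hasSum_binomial_neg (z : ℂ) {x : ℂ} (hx : ‖x‖ < 1) :
    HasSum (fun a : ℕ ↦ (ascPochhammer ℂ a).eval z / (a.factorial : ℂ) * x ^ a)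
      (Complex.exp (z * -Complex.log (1 - x))) := by
  have h := (Complex.one_div_one_sub_cpow_hasFPowerSeriesOnBall_zero z).hasSum
    (y := x) (by simpa [enorm_eq_nnnorm, ← NNReal.coe_lt_coe] using hx)
  have h0 : (1 : ℂ) - x ≠ 0 := by
    intro h; rw [sub_eq_zero] at h; simp [← h] at hx
  rw [zero_add, Complex.cpow_def_of_ne_zero h0, one_div, ← Complex.exp_neg] at h
  rw [show z * -Complex.log (1 - x) = -(Complex.log (1 - x) * z) by ring]
  refine h.congr_fun fun a ↦ ?_
  have h1 : Ring.choose (z + a - 1) a = (ascPochhammer ℂ a).eval z / (a.factorial : ℂ) := by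
    rw [← Ring.multichoose_eq, eq_div_iff (by exact_mod_cast a.factorial_ne_zero), mul_comm,
      ← nsmul_eq_mul, Ring.factorial_nsmul_multichoose_eq_ascPochhammer,
      ← Polynomial.ascPochhammer_smeval_cast ℂ, Polynomial.eval_eq_smeval]
  simp [FormalMultilinearSeries.ofScalars, h1]

theorem summable_log_one_sub_character {q : ℕ} (χ : DirichletCharacter ℂ q) {s : ℂ} (hs : 1 < s.re) :
    Summable fun p : Nat.Primes ↦ -Complex.log (1 - χ p * (p : ℂ) ^ (-s)) := by
  have h := (summable_dirichletSummand χ hs).of_norm.clog_one_sub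
  have h2 := h.neg.comp_injective (Nat.Primes.coe_nat_injective)
  exact h2

/-- Compare Euler products: the factor at p is the binomial series of (1 - χ(p)p^{-s})^{-z}. The
power is formed from `logEulerProduct`, which settles the branch. -/
theorem LSeriesHasSum_divisorFn_mul {q : ℕ} (χ : DirichletCharacter ℂ q) (z : ℂ) {s : ℂ}
    (hs : 1 < s.re) :
    LSeriesHasSum (fun n ↦ divisorFn z n * χ n) s (Complex.exp (z * logEulerProduct χ s)) := by
  have hsum := LSeriesSummable_divisorFn_mul χ z hs
  set f : ℕ → ℂ := LSeries.term (fun n ↦ divisorFn z n * χ n) s with hf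
  have h1 : f 1 = 1 := by simp [hf, LSeries.term_of_ne_zero, divisorFn_one_right]
  have hmul : ∀ {m n : ℕ}, m.Coprime n → f (m * n) = f m * f n := by
    intro m n hmn
    rcases eq_or_ne m 0 with rfl | hm
    · simp [hf]
    rcases eq_or_ne n 0 with rfl | hn
    · simp [hf]
    simp only [hf, LSeries.term_of_ne_zero, hm, hn, mul_ne_zero, ne_eq, not_false_eq_true,
      divisorFn_mul_of_coprime z hmn, Nat.cast_mul, map_mul]
    rw [Complex.natCast_mul_natCast_cpow]
    field_simp
  have h := EulerProduct.eulerProduct_hasProd (f := f) h1 hmul hsum.norm (by simp [hf])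
  have h2 : HasProd (fun p : Nat.Primes ↦
      Complex.exp (z * -Complex.log (1 - χ p * (p : ℂ) ^ (-s))))
      (Complex.exp (z * logEulerProduct χ s)) := by
    exact ((summable_log_one_sub_character χ hs).hasSum.mul_left z).cexp
  have h3 : ∀ p : ℕ, p.Prime → ∑' e : ℕ, f (p ^ e) =
      Complex.exp (z * -Complex.log (1 - χ p * (p : ℂ) ^ (-s))) := by
    intro p hp
    rw [← (hasSum_binomial_neg z
      (norm_character_mul_cpow_lt_one χ (zero_lt_one.trans hs) hp)).tsum_eq]
    refine tsum_congr fun e ↦ ?_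
    rw [hf, LSeries.term_of_ne_zero (pow_ne_zero _ hp.ne_zero), divisorFn_prime_pow z hp]
    push_cast
    rw [map_pow, mul_pow, ← Complex.cpow_nat_mul, ← Complex.natCast_cpow_natCast_mul, mul_div_assoc,
      div_eq_mul_inv (χ p ^ e), ← Complex.cpow_neg, mul_neg]
  have h4 : (fun p : Nat.Primes ↦ ∑' e : ℕ, f ((p : ℕ) ^ e)) = fun p : Nat.Primes ↦
      Complex.exp (z * -Complex.log (1 - χ p * (p : ℂ) ^ (-s))) := funext fun p ↦ h3 p p.2
  rw [h4] at h
  have := h.unique h2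
  rw [← this]
  exact hsum.hasSum

theorem exp_logEulerProduct {q : ℕ} (χ : DirichletCharacter ℂ q) {s : ℂ} (hs : 1 < s.re) :
    Complex.exp (logEulerProduct χ s) = LSeries (fun n ↦ χ n) s :=
  χ.LSeries_eulerProduct_exp_log hs

end

section

/-! ### Growth of Dirichlet `L`-functions to the right of the imaginary axis -/

section CharacterSums

variable {q : ℕ}

theorem sum_range_character_add [NeZero q] {χ : DirichletCharacter ℂ q} (hχ : χ ≠ 1) (n : ℕ) :
    ∑ k ∈ Finset.range q, χ ((n + k : ℕ) : ZMod q) = 0 := by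
  rw [← χ.sum_eq_zero_of_ne_one hχ]
  refine Finset.sum_nbij' (fun k ↦ ((n + k : ℕ) : ZMod q)) (fun a ↦ (a - n).val) (by simp)
    (fun a _ ↦ by simpa using ZMod.val_lt _) (fun k hk ↦ ?_) (fun a _ ↦ by simp) (by simp)
  simp only [Nat.cast_add, add_sub_cancel_left]
  exact ZMod.val_cast_of_lt (Finset.mem_range.mp hk)

/-- Complete periods cancel, leaving fewer than q terms of modulus at most 1. -/
theorem norm_sum_range_character_le [NeZero q] {χ : DirichletCharacter ℂ q} (hχ : χ ≠ 1) (n : ℕ) :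
    ‖∑ k ∈ Finset.range n, χ ((1 + k : ℕ) : ZMod q)‖ ≤ q := by
  induction n using Nat.strong_induction_on with
  | _ n ih =>
    rcases lt_or_ge n q with h | h
    · refine (norm_sum_le_of_le _ fun k _ ↦ χ.norm_le_one _).trans ?_
      simpa using h.le
    · obtain ⟨m, rfl⟩ := Nat.exists_eq_add_of_le' h
      rw [Finset.sum_range_add]
      have := sum_range_character_add hχ (1 + m)
      simp only [add_assoc] at this ⊢
      rw [this, add_zero]
      exact ih m (by have := NeZero.pos q; omega)

theorem norm_sum_Icc_character_le [NeZero q] {χ : DirichletCharacter ℂ q} (hχ : χ ≠ 1) (n : ℕ) :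
    ‖∑ k ∈ Finset.Icc 1 n, χ (k : ZMod q)‖ ≤ q := by
  have : Finset.Icc 1 n = Finset.Ico 1 (n + 1) := by ext; simp
  rw [this, Finset.sum_Ico_eq_sum_range]
  exact norm_sum_range_character_le hχ n

/-- The summatory function of a character, cut off at `1`. -/
noncomputable def characterSum (χ : DirichletCharacter ℂ q) (t : ℝ) : ℂ :=
  (Set.Ioi 1).indicator (fun t : ℝ ↦ ∑ k ∈ Finset.Icc 1 ⌊t⌋₊, χ (k : ZMod q)) t

theorem norm_characterSum_le [NeZero q] {χ : DirichletCharacter ℂ q} (hχ : χ ≠ 1) (t : ℝ) :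
    ‖characterSum χ t‖ ≤ q :=
  (norm_indicator_le_norm_self _ _).trans (norm_sum_Icc_character_le hχ _)

theorem measurable_characterSum (χ : DirichletCharacter ℂ q) : Measurable (characterSum χ) := by
  refine Measurable.indicator ?_ measurableSet_Ioi
  exact (measurable_from_nat (f := fun n ↦ ∑ k ∈ Finset.Icc 1 n, χ (k : ZMod q))).comp
    Nat.measurable_floor

theorem mellin_characterSum (χ : DirichletCharacter ℂ q) (s : ℂ) :
    mellin (characterSum χ) (-s) =
      ∫ t in Set.Ioi (1 : ℝ), (∑ k ∈ Finset.Icc 1 ⌊t⌋₊, χ (k : ZMod q)) * (t : ℂ) ^ (-(s + 1)) := by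
  have h : ∀ t : ℝ, (t : ℂ) ^ (-s - 1) • characterSum χ t = (Set.Ioi 1).indicator
      (fun t : ℝ ↦ (∑ k ∈ Finset.Icc 1 ⌊t⌋₊, χ (k : ZMod q)) * (t : ℂ) ^ (-(s + 1))) t := by
    intro t
    rw [characterSum, Set.indicator, Set.indicator]
    split_ifs
    · rw [smul_eq_mul, mul_comm]; ring_nf
    · simp
  simp_rw [mellin, h]
  rw [MeasureTheory.setIntegral_indicator measurableSet_Ioi]
  congr 2
  ext t
  simp only [Set.mem_inter_iff, Set.mem_Ioi]
  constructor
  · exact fun h ↦ h.2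
  · exact fun h ↦ ⟨zero_lt_one.trans h, h⟩

theorem differentiableAt_mellin_characterSum [NeZero q] {χ : DirichletCharacter ℂ q} (hχ : χ ≠ 1) {s : ℂ}
    (hs : s.re < 0) : DifferentiableAt ℂ (mellin (characterSum χ)) s := by
  refine mellin_differentiableAt_of_isBigO_rpow (a := 0) (b := s.re - 1) ?_ ?_ hs ?_ (by linarith)
  · refine (MeasureTheory.LocallyIntegrable.locallyIntegrableOn ?_ _)
    refine MeasureTheory.LocallyIntegrable.mono (g := characterSum χ) (f := fun _ ↦ (q : ℝ))
      (MeasureTheory.locallyIntegrable_const _) (measurable_characterSum χ).aestronglyMeasurable ?_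
    exact .of_forall fun t ↦ by simpa using norm_characterSum_le hχ t
  · refine Asymptotics.IsBigO.of_bound q (.of_forall fun t ↦ ?_)
    simpa using norm_characterSum_le hχ t
  · refine Asymptotics.IsBigO.of_bound 0 ?_
    filter_upwards [Ioo_mem_nhdsGT (show (0 : ℝ) < 1 by norm_num)] with t ht
    rw [characterSum, Set.indicator_of_notMem (by simpa using ht.2.le)]
    simp

/-- Abel summation gives this for Re s > 1. Since the character sums are bounded, the Mellin
transform is analytic for Re s > 0, and the identity theorem extends the formula. -/
theorem LFunction_eq_mul_mellin [NeZero q] {χ : DirichletCharacter ℂ q} (hχ : χ ≠ 1) {s : ℂ} (hs : 0 < s.re) :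
    χ.LFunction s = s * mellin (characterSum χ) (-s) := by
  have hU : IsOpen {s : ℂ | 0 < s.re} := isOpen_lt continuous_const Complex.continuous_re
  have h1 : AnalyticOnNhd ℂ χ.LFunction {s : ℂ | 0 < s.re} :=
    (DirichletCharacter.differentiable_LFunction hχ).differentiableOn.analyticOnNhd hU
  have h2 : AnalyticOnNhd ℂ (fun s ↦ s * mellin (characterSum χ) (-s)) {s : ℂ | 0 < s.re} := by
    refine DifferentiableOn.analyticOnNhd (fun s hs ↦ ?_) hU
    refine (differentiableAt_id.mul ?_).differentiableWithinAt
    have h := differentiableAt_mellin_characterSum hχ (s := -s) (by simpa using hs)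
    exact h.comp s differentiable_neg.differentiableAt
  have hpre : IsPreconnected {s : ℂ | 0 < s.re} := (convex_halfSpace_re_gt 0).isPreconnected
  refine h1.eqOn_of_preconnected_of_eventuallyEq h2 hpre (z₀ := 2) (by simp) ?_ hs
  have : ∀ᶠ s : ℂ in 𝓝 2, 1 < s.re :=
    (isOpen_lt continuous_const Complex.continuous_re).mem_nhds (by simp)
  filter_upwards [this] with s hs
  rw [mellin_characterSum, χ.LFunction_eq_LSeries hs,
    LSeries_eq_mul_integral _ le_rfl (zero_lt_one.trans hs)
      (DirichletCharacter.LSeriesSummable_of_one_lt_re χ hs)]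
  refine Asymptotics.IsBigO.of_bound q (.of_forall fun n ↦ ?_)
  simpa using norm_sum_Icc_character_le hχ n

theorem norm_LFunction_le [NeZero q] {χ : DirichletCharacter ℂ q} (hχ : χ ≠ 1) {s : ℂ} (hs : 0 < s.re) :
    ‖χ.LFunction s‖ ≤ q * ‖s‖ / s.re := by
  rw [LFunction_eq_mul_mellin hχ hs, mellin_characterSum, norm_mul]
  have hint := integrableOn_Ioi_rpow_of_lt (a := -(s.re + 1)) (c := 1) (by linarith) zero_lt_one
  have hval := integral_Ioi_rpow_of_lt (a := -(s.re + 1)) (c := 1) (by linarith) zero_lt_one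
  have h : ‖∫ t in Set.Ioi (1 : ℝ),
      (∑ k ∈ Finset.Icc 1 ⌊t⌋₊, χ (k : ZMod q)) * (t : ℂ) ^ (-(s + 1))‖ ≤ q / s.re := by
    refine (MeasureTheory.norm_integral_le_of_norm_le (hint.const_mul (q : ℝ)) ?_).trans ?_
    · refine (MeasureTheory.ae_restrict_iff' measurableSet_Ioi).mpr (.of_forall fun t ht ↦ ?_)
      rw [norm_mul, Complex.norm_cpow_eq_rpow_re_of_pos (zero_lt_one.trans ht)]
      simp only [Complex.neg_re, Complex.add_re, Complex.one_re]
      exact mul_le_mul_of_nonneg_right (norm_sum_Icc_character_le hχ _)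
        (Real.rpow_nonneg (zero_le_one.trans ht.le) _)
    · rw [MeasureTheory.integral_const_mul, hval]
      have : -(s.re + 1) + 1 = -s.re := by ring
      rw [this, Real.one_rpow, neg_div_neg_eq, mul_one_div]
  calc _ ≤ ‖s‖ * (q / s.re) := by gcongr
    _ = _ := by ring

end CharacterSums

/-! ### Logarithms of nonvanishing holomorphic functions on discs -/

/-- A primitive of f'/f on the disc. Prescribing the value at the centre allows the branch to be
matched later with the Euler product. -/
theorem exists_differentiableOn_exp_eq {f : ℂ → ℂ} {c : ℂ} {r : ℝ}
    (hf : DifferentiableOn ℂ f (Metric.ball c r)) (h0 : ∀ z ∈ Metric.ball c r, f z ≠ 0) {w : ℂ}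
    (hw : Complex.exp w = f c) :
    ∃ g : ℂ → ℂ, g c = w ∧ DifferentiableOn ℂ g (Metric.ball c r) ∧
      ∀ z ∈ Metric.ball c r, Complex.exp (g z) = f z := by
  have hfd : DifferentiableOn ℂ (fun z ↦ deriv f z / f z) (Metric.ball c r) :=
    (hf.deriv Metric.isOpen_ball).div hf h0
  obtain ⟨g, hgc, hg⟩ := hfd.isExactOn_ball.with_val_at c w
  refine ⟨g, hgc, fun z hz ↦ (hg z hz).differentiableAt.differentiableWithinAt, fun z hz ↦ ?_⟩
  have hr : 0 < r := Metric.pos_of_mem_ball hz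
  have hder : ∀ x ∈ Metric.ball c r, HasDerivAt (fun y ↦ f y * Complex.exp (-g y)) 0 x := by
    intro x hx
    have h1 := ((hf.differentiableAt (Metric.isOpen_ball.mem_nhds hx)).hasDerivAt).mul
      (hg x hx).neg.cexp
    refine h1.congr_deriv ?_
    have := h0 x hx
    field_simp
    ring
  have hconst := Metric.isOpen_ball.is_const_of_deriv_eq_zero (convex_ball c r).isPreconnected
    (fun x hx ↦ (hder x hx).differentiableAt.differentiableWithinAt)
    (fun x hx ↦ (hder x hx).deriv) hz (Metric.mem_ball_self hr)
  simp only [hgc, ← hw, Complex.exp_neg, mul_inv_cancel₀ (Complex.exp_ne_zero w)] at hconst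
  rw [mul_inv_eq_one₀ (Complex.exp_ne_zero _)] at hconst
  exact hconst.symm

end

section

/-! ### Logarithmic derivatives and zeros -/

open Metric

theorem norm_le_of_forall_mem_sphere {f : ℂ → ℂ} (hf : Differentiable ℂ f) {c : ℂ} {r C : ℝ}
    (hC : ∀ z ∈ sphere c r, ‖f z‖ ≤ C) {z : ℂ} (hz : z ∈ closedBall c r) : ‖f z‖ ≤ C := by
  rcases eq_or_ne r 0 with rfl | hr
  · rw [closedBall_zero, Set.mem_singleton_iff] at hz
    exact hC z (by simp [hz])
  refine Complex.norm_le_of_forall_mem_frontier_norm_le isBounded_ball (f := f) (U := ball c r)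
    hf.diffContOnCl ?_ (by rwa [closure_ball c hr])
  rwa [frontier_ball c hr]

/-- Borel–Carathéodory bounds log f - log f(c) by 2M on the circle of radius r/2, and Cauchy's
estimate there gives 4M/r. -/
theorem norm_deriv_div_le_of_ne_zero {f : ℂ → ℂ} {c : ℂ} {r M : ℝ} (hr : 0 < r) (hM : 0 < M)
    (hf : DifferentiableOn ℂ f (ball c r)) (h0 : ∀ z ∈ ball c r, f z ≠ 0)
    (hb : ∀ z ∈ ball c r, ‖f z‖ ≤ Real.exp M * ‖f c‖) : ‖deriv f c / f c‖ ≤ 4 * M / r := by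
  have hc : c ∈ ball c r := mem_ball_self hr
  obtain ⟨g, hgc, hgd, hg⟩ := exists_differentiableOn_exp_eq hf h0 (Complex.exp_log (h0 c hc))
  have hre : ∀ z ∈ ball c r, (g z - g c).re ≤ M := by
    intro z hz
    have h1 : ‖Complex.exp (g z - g c)‖ ≤ Real.exp M := by
      rw [Complex.exp_sub, hg z hz, hg c hc, norm_div]
      exact (div_le_iff₀ (norm_pos_iff.mpr (h0 c hc))).mpr (hb z hz)
    rw [Complex.norm_exp] at h1
    exact Real.exp_le_exp.mp h1
  have hmaps : ∀ z ∈ ball (0 : ℂ) r, c + z ∈ ball c r := fun z hz ↦ by simpa using hz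
  have hbc : ∀ z ∈ sphere c (r / 2), ‖g z - g c‖ ≤ 2 * M := by
    intro z hz
    have hz' : ‖z - c‖ = r / 2 := by simpa [dist_eq_norm] using hz
    have h := Complex.borelCaratheodory_zero (f := fun w ↦ g (c + w) - g c) (z := z - c) hM
      ((hgd.comp (by fun_prop) hmaps).sub_const _) (fun w hw ↦ hre _ (hmaps w hw)) hr
      (by rw [mem_ball_zero_iff, hz']; linarith) (by simp)
    rw [add_sub_cancel, hz'] at h
    refine h.trans_eq ?_
    field_simp
    ring
  have hd : DifferentiableOn ℂ (fun z ↦ g z - g c) (closedBall c (r / 2)) :=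
    (hgd.sub_const _).mono (closedBall_subset_ball (by linarith))
  have h := Complex.norm_deriv_le_of_forall_mem_sphere_norm_le (f := fun z ↦ g z - g c)
    (half_pos hr) (hd.diffContOnCl_ball subset_rfl) hbc
  have hder : deriv f c = f c * deriv g c := by
    have h1 : f =ᶠ[𝓝 c] fun z ↦ Complex.exp (g z) := by
      filter_upwards [isOpen_ball.mem_nhds hc] with z hz using (hg z hz).symm
    rw [h1.deriv_eq, (((hgd.differentiableAt (isOpen_ball.mem_nhds hc)).hasDerivAt).cexp).deriv,
      hg c hc]
  rw [deriv_sub_const] at h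
  rw [hder, mul_div_cancel_left₀ _ (h0 c hc)]
  refine h.trans_eq ?_
  field_simp
  ring

/-- Removing a zero `ρ` close to the centre of a disc from an entire function. -/
theorem exists_remove_zero {f : ℂ → ℂ} (hf : Differentiable ℂ f) {c ρ : ℂ} {r M : ℝ}
    (hc : f c ≠ 0) (hb : ∀ z ∈ sphere c r, ‖f z‖ ≤ Real.exp M * ‖f c‖)
    (hρ : f ρ = 0) (hρc : ρ ∈ closedBall c (r / 3)) :
    ∃ g : ℂ → ℂ, Differentiable ℂ g ∧ g c ≠ 0 ∧
      (∀ z ∈ sphere c r, ‖g z‖ ≤ Real.exp (M - Real.log 2) * ‖g c‖) ∧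
      (∀ z, g z = 0 → f z = 0) ∧ deriv f c / f c = deriv g c / g c + 1 / (c - ρ) := by
  have hne : c ≠ ρ := fun h ↦ hc (h ▸ hρ)
  have hne' : c - ρ ≠ 0 := sub_ne_zero.mpr hne
  have hd : Differentiable ℂ (dslope f ρ) := by
    rw [← differentiableOn_univ] at hf ⊢
    exact (Complex.differentiableOn_dslope univ_mem).mpr hf
  have hval : ∀ z, z ≠ ρ → dslope f ρ z = f z / (z - ρ) := by
    intro z hz
    rw [dslope_of_ne _ hz, slope_def_field, hρ, sub_zero]
  have hgc : dslope f ρ c ≠ 0 := by rw [hval c hne]; exact div_ne_zero hc hne'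
  refine ⟨dslope f ρ, hd, hgc, fun z hz ↦ ?_, fun z hz ↦ ?_, ?_⟩
  · have hzc : ‖z - c‖ = r := by simpa [dist_eq_norm] using hz
    have hρ' : ‖c - ρ‖ ≤ r / 3 := by rw [← dist_eq_norm, dist_comm]; exact hρc
    -- On the sphere |z - ρ| ≥ 2r/3 ≥ 2|c - ρ|, so division by z - ρ gains a factor 2 relative to
    -- the centre: this is the drop of M by log 2.
    have h2 : 2 * ‖c - ρ‖ ≤ ‖z - ρ‖ := by
      have h3 : ‖z - c‖ ≤ ‖z - ρ‖ + ‖c - ρ‖ := by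
        rw [show z - c = (z - ρ) - (c - ρ) by ring]; exact norm_sub_le _ _
      linarith
    have h4 : 0 < ‖c - ρ‖ := norm_pos_iff.mpr hne'
    have hzρ : z ≠ ρ := by
      rintro rfl; rw [sub_self, norm_zero] at h2; linarith
    rw [hval z hzρ, hval c hne, norm_div, norm_div, Real.exp_sub, Real.exp_log two_pos]
    calc ‖f z‖ / ‖z - ρ‖ ≤ (Real.exp M * ‖f c‖) / (2 * ‖c - ρ‖) := by
          gcongr
          exact hb z hz
      _ = _ := by field_simp
  · rcases eq_or_ne z ρ with rfl | h
    · exact hρ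
    · rw [hval z h, div_eq_zero_iff, sub_eq_zero] at hz
      exact hz.resolve_right h
  · have hfe : f = fun z ↦ (z - ρ) * dslope f ρ z := by
      ext z
      have := sub_smul_dslope f ρ z
      rw [hρ, sub_zero, smul_eq_mul] at this
      exact this.symm
    have hderiv : deriv f c = 1 * dslope f ρ c + (c - ρ) * deriv (dslope f ρ) c := by
      conv_lhs => rw [hfe]
      exact (((hasDerivAt_id c).sub_const ρ).mul (hd c).hasDerivAt).deriv
    have hfc : f c = (c - ρ) * dslope f ρ c := congrFun hfe c
    rw [hderiv, hfc]
    field_simp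
    ring

theorem re_one_div_nonneg {w : ℂ} (hw : 0 ≤ w.re) : 0 ≤ (1 / w).re := by
  rw [one_div, Complex.inv_re]
  exact div_nonneg hw (Complex.normSq_nonneg _)

/-- Zeros within r/3 of c are divided out one at a time. Each lowers M by log 2, so the process
stops, and each drops a term Re 1/(c - ρ) that is nonnegative because zeros lie to the left of c.
What remains has no zero within r/3 and falls under `norm_deriv_div_le_of_ne_zero`. -/
theorem neg_re_deriv_div_le {f : ℂ → ℂ} (hf : Differentiable ℂ f) {c : ℂ} {r M : ℝ}
    (hr : 0 < r) (hc : f c ≠ 0) (hb : ∀ z ∈ sphere c r, ‖f z‖ ≤ Real.exp M * ‖f c‖)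
    (hz : ∀ z, f z = 0 → z.re ≤ c.re) : -(deriv f c / f c).re ≤ 12 * (M + 1) / r := by
  obtain ⟨n, hn⟩ : ∃ n : ℕ, M < n * Real.log 2 := by
    obtain ⟨n, hn⟩ := exists_nat_gt (M / Real.log 2)
    exact ⟨n, (div_lt_iff₀ (Real.log_pos one_lt_two)).mp hn⟩
  induction n generalizing f M with
  | zero =>
    -- Here M < 0, which contradicts the maximum principle at the centre.
    have h := norm_le_of_forall_mem_sphere hf hb (mem_closedBall_self hr.le)
    have h1 : Real.exp M < 1 := Real.exp_lt_one_iff.mpr (by simpa using hn)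
    nlinarith [norm_pos_iff.mpr hc]
  | succ n ih =>
    by_cases hex : ∃ ρ ∈ closedBall c (r / 3), f ρ = 0
    · obtain ⟨ρ, hρc, hρ⟩ := hex
      obtain ⟨g, hgd, hgc, hgb, hgz, hgder⟩ := exists_remove_zero hf hc hb hρ hρc
      have h := ih hgd hgc hgb (fun z h ↦ hz z (hgz z h)) (by push_cast at hn; linarith)
      have h1 : 0 ≤ (1 / (c - ρ)).re := re_one_div_nonneg (by simpa using hz ρ hρ)
      have h2 : 12 * (M - Real.log 2 + 1) / r ≤ 12 * (M + 1) / r := by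
        have := Real.log_pos one_lt_two
        gcongr
        linarith
      rw [hgder, Complex.add_re]
      linarith
    · push Not at hex
      have hball : ∀ z ∈ closedBall c r, ‖f z‖ ≤ Real.exp M * ‖f c‖ := fun z hz ↦
        norm_le_of_forall_mem_sphere hf hb hz
      have hM : 0 ≤ M := by
        by_contra! hM
        have h1 : Real.exp M < 1 := Real.exp_lt_one_iff.mpr hM
        nlinarith [norm_pos_iff.mpr hc, hball c (mem_closedBall_self hr.le)]
      -- M may vanish, while the zero-free estimate needs a positive bound; hence M + 1.
      have h := norm_deriv_div_le_of_ne_zero (f := f) (c := c) (r := r / 3) (M := M + 1)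
        (by positivity) (by positivity) hf.differentiableOn
        (fun z hz ↦ hex z (ball_subset_closedBall hz)) fun z hz ↦
          (hball z ((ball_subset_closedBall.trans (closedBall_subset_closedBall (by linarith)))
            hz)).trans (by gcongr; linarith)
      calc -(deriv f c / f c).re ≤ ‖deriv f c / f c‖ :=
            (neg_le_abs _).trans (Complex.abs_re_le_norm _)
        _ ≤ 4 * (M + 1) / (r / 3) := h
        _ = _ := by field_simp; ring

/-- The contribution of one chosen zero is kept; it is the term that repels zeros from the line Re s
= 1. -/
theorem neg_re_deriv_div_le_sub {f : ℂ → ℂ} (hf : Differentiable ℂ f) {c ρ : ℂ} {r M : ℝ}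
    (hr : 0 < r) (hc : f c ≠ 0) (hb : ∀ z ∈ sphere c r, ‖f z‖ ≤ Real.exp M * ‖f c‖)
    (hz : ∀ z, f z = 0 → z.re ≤ c.re) (hρ : f ρ = 0) (hρc : ρ ∈ closedBall c (r / 3)) :
    -(deriv f c / f c).re ≤ 12 * (M + 1) / r - (1 / (c - ρ)).re := by
  obtain ⟨g, hgd, hgc, hgb, hgz, hgder⟩ := exists_remove_zero hf hc hb hρ hρc
  have h := neg_re_deriv_div_le hgd hr hgc hgb fun z h ↦ hz z (hgz z h)
  have h2 : 12 * (M - Real.log 2 + 1) / r ≤ 12 * (M + 1) / r := by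
    have := Real.log_pos one_lt_two
    gcongr
    linarith
  rw [hgder, Complex.add_re]
  linarith

end

section

/-! ### The classical zero-free region for complex characters -/

open Metric
open scoped LSeries.notation

section ZeroFree

variable {q : ℕ}

theorem norm_LSeries_le_of_norm_le_one {f : ℕ → ℂ} (hf : ∀ n, ‖f n‖ ≤ 1) {s : ℂ} (hs : 1 < s.re) :
    ‖LSeries f s‖ ≤ s.re / (s.re - 1) := by
  have h : ‖LSeries f s‖ₑ ≤ ENNReal.ofReal (s.re / (s.re - 1)) := by
    refine (enorm_tsum_le_tsum_enorm).trans (le_trans (ENNReal.tsum_le_tsum fun n ↦ ?_)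
      (realZeta_le hs))
    rw [enorm_term_eq]
    refine mul_le_of_le_one_left zero_le ?_
    rw [← ofReal_norm, ← ENNReal.ofReal_one]
    exact ENNReal.ofReal_le_ofReal (hf n)
  rw [← ofReal_norm] at h
  exact (ENNReal.ofReal_le_ofReal_iff (div_nonneg (by linarith) (by linarith))).mp h

/-- 1/L(s,χ) is the Dirichlet series of χμ, whose coefficients have modulus at most 1. -/
theorem le_norm_LFunction [NeZero q] (χ : DirichletCharacter ℂ q) {s : ℂ} (hs : 1 < s.re) :
    (s.re - 1) / s.re ≤ ‖χ.LFunction s‖ := by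
  have h := DirichletCharacter.LSeries.mul_mu_eq_one χ hs
  have h1 : ‖LSeries (↗χ * ↗ArithmeticFunction.moebius) s‖ ≤ s.re / (s.re - 1) := by
    refine norm_LSeries_le_of_norm_le_one (fun n ↦ ?_) hs
    rw [Pi.mul_apply, norm_mul]
    refine mul_le_one₀ (χ.norm_le_one _) (norm_nonneg _) ?_
    have := ArithmeticFunction.abs_moebius_le_one (n := n)
    rw [Complex.norm_intCast]
    exact_mod_cast this
  rw [χ.LFunction_eq_LSeries hs]
  have h2 := congrArg norm h
  rw [norm_mul, norm_one] at h2
  have h3 : 0 < s.re - 1 := by linarith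
  have h4 : 0 < s.re := by linarith
  rw [div_le_iff₀ h4]
  rw [le_div_iff₀ h3] at h1
  nlinarith [norm_nonneg (LSeries (↗χ) s)]

-- Each term is Λ(n) n^{-σ} times 3 + 4 Re w + Re w² = 2(1 + Re w)² + (1 - |w|²), where w = χ(n)
-- n^{-it}. Only |w| ≤ 1 is used, since χ(n) may vanish.
open ArithmeticFunction in
theorem re_LSeries_vonMangoldt_comb_nonneg (χ : DirichletCharacter ℂ q) {σ : ℝ} (hσ : 1 < σ)
    (t : ℝ) :
    0 ≤ 3 * (LSeries ↗vonMangoldt σ).re + 4 * (LSeries (↗χ * ↗vonMangoldt) (σ + t * Complex.I)).re +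
      (LSeries (↗(χ ^ 2) * ↗vonMangoldt) (σ + (2 * t : ℝ) * Complex.I)).re := by
  have hr : ∀ u : ℝ, 1 < ((σ : ℂ) + u * Complex.I).re := fun u ↦ by simpa using hσ
  have h0 := (LSeriesSummable_vonMangoldt (s := σ) (by simpa using hσ)).hasSum
  have h1 := (DirichletCharacter.LSeriesSummable_twist_vonMangoldt χ (hr t)).hasSum
  have h2 := (DirichletCharacter.LSeriesSummable_twist_vonMangoldt (χ ^ 2) (hr (2 * t))).hasSum
  have h := (((Complex.hasSum_re h0).mul_left 3).add ((Complex.hasSum_re h1).mul_left 4)).add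
    (Complex.hasSum_re h2)
  refine h.nonneg fun n ↦ ?_
  rcases eq_or_ne n 0 with rfl | hn
  · simp
  have hn0 : (n : ℂ) ≠ 0 := by exact_mod_cast hn
  have hpos : 0 < n := Nat.pos_of_ne_zero hn
  set w : ℂ := χ n * (n : ℂ) ^ (-(t * Complex.I)) with hw
  have hwn : ‖w‖ ≤ 1 := by
    rw [hw, norm_mul, Complex.norm_natCast_cpow_of_pos hpos]
    simpa using χ.norm_le_one _
  set x : ℝ := vonMangoldt n * (n : ℝ) ^ (-σ) with hx
  have hx0 : 0 ≤ x := mul_nonneg vonMangoldt_nonneg (by positivity)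
  have hnσ : (n : ℂ) ^ (-(σ : ℂ)) = ((n : ℝ) ^ (-σ) : ℝ) := by
    rw [Complex.ofReal_cpow (by positivity)]; simp
  have e0 : LSeries.term ↗vonMangoldt σ n = x := by
    rw [LSeries.term_of_ne_zero hn, div_eq_mul_inv, ← Complex.cpow_neg, hnσ, hx]; push_cast; rfl
  have e1 : LSeries.term (↗χ * ↗vonMangoldt) (σ + t * Complex.I) n = x * w := by
    rw [LSeries.term_of_ne_zero hn, div_eq_mul_inv, ← Complex.cpow_neg, neg_add,
      Complex.cpow_add _ _ hn0, hnσ, hx, hw, Pi.mul_apply]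
    push_cast; ring
  have e2 : LSeries.term (↗(χ ^ 2) * ↗vonMangoldt) (σ + (2 * t : ℝ) * Complex.I) n = x * w ^ 2 := by
    rw [LSeries.term_of_ne_zero hn, div_eq_mul_inv, ← Complex.cpow_neg, neg_add,
      Complex.cpow_add _ _ hn0, hnσ, hx, hw, Pi.mul_apply, mul_pow, ← Complex.cpow_nat_mul,
      MulChar.pow_apply' _ two_ne_zero]
    push_cast; ring_nf
  rw [e0, e1, e2, Complex.ofReal_re, Complex.re_ofReal_mul, Complex.re_ofReal_mul]
  have hsq : w.re ^ 2 + w.im ^ 2 ≤ 1 := by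
    have h5 : ‖w‖ ^ 2 ≤ 1 := pow_le_one₀ (norm_nonneg _) hwn
    rw [Complex.sq_norm, Complex.normSq_apply] at h5
    nlinarith
  have h6 : (w ^ 2).re = w.re ^ 2 - w.im ^ 2 := by
    rw [pow_two, Complex.mul_re]; ring
  rw [h6]
  nlinarith [mul_nonneg hx0 (sq_nonneg (w.re + 1)), mul_nonneg hx0 (sub_nonneg.mpr hsq)]

theorem exists_re_LSeries_vonMangoldt_le :
    ∃ C ε : ℝ, 0 < ε ∧ ∀ σ : ℝ, 1 < σ → σ < 1 + ε →
      (LSeries ↗ArithmeticFunction.vonMangoldt σ).re ≤ 1 / (σ - 1) + C := by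
  obtain ⟨C, hC⟩ := log_deriv_riemannZeta_add_inv_sub_bounded.bound
  obtain ⟨ε, hε, h⟩ := (mem_nhdsWithin_iff.mp hC)
  refine ⟨C, ε, hε, fun σ h1 h2 ↦ ?_⟩
  have h3 : (σ : ℂ) ∈ ball (1 : ℂ) ε ∩ {1}ᶜ := by
    refine ⟨?_, ?_⟩
    · rw [mem_ball, dist_eq_norm, ← Complex.ofReal_one, ← Complex.ofReal_sub, Complex.norm_real,
        Real.norm_eq_abs, abs_of_pos (by linarith)]
      linarith
    · simpa using fun h : σ = 1 ↦ h1.ne' h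
  have h4 : ‖deriv riemannZeta σ / riemannZeta σ + ((σ : ℂ) - 1)⁻¹‖ ≤ C := by
    simpa using h h3
  rw [ArithmeticFunction.LSeries_vonMangoldt_eq_deriv_riemannZeta_div (by simpa using h1)]
  have h5 : (-deriv riemannZeta σ / riemannZeta σ).re =
      1 / (σ - 1) - (deriv riemannZeta σ / riemannZeta σ + ((σ : ℂ) - 1)⁻¹).re := by
    have : (((σ : ℂ) - 1)⁻¹).re = 1 / (σ - 1) := by
      rw [← Complex.ofReal_one, ← Complex.ofReal_sub, ← Complex.ofReal_inv, Complex.ofReal_re, one_div]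
    rw [Complex.add_re, this, neg_div, Complex.neg_re]
    ring
  rw [h5]
  have h6 := (Complex.abs_re_le_norm (deriv riemannZeta σ / riemannZeta σ + ((σ : ℂ) - 1)⁻¹)).trans h4
  rw [abs_le] at h6
  linarith [h6.1]

theorem LSeries_twist_vonMangoldt_eq_neg_deriv_LFunction_div [NeZero q] (χ : DirichletCharacter ℂ q) {s : ℂ}
    (hs : 1 < s.re) :
    LSeries (↗χ * ↗ArithmeticFunction.vonMangoldt) s =
      -(deriv χ.LFunction s / χ.LFunction s) := by
  rw [DirichletCharacter.LSeries_twist_vonMangoldt_eq χ hs, χ.deriv_LFunction_eq_deriv_LSeries hs,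
    χ.LFunction_eq_LSeries hs, neg_div]

/-- On circles of radius `1 / 2` to the right of the line `Re s = 1`, the `L`-function is bounded in
terms of its value at the centre. -/
theorem norm_LFunction_le_exp_mul [NeZero q] {χ : DirichletCharacter ℂ q} (hχ : χ ≠ 1) {σ t l a T : ℝ}
    (hl : l = Real.log (q * (T + 2))) (ha : 0 < a) (hal : a ≤ l) (hσ : σ = 1 + a / l)
    (ht : |t| ≤ 2 * T) (hT : 0 ≤ T) :
    ∀ z ∈ sphere ((σ : ℂ) + t * Complex.I) (1 / 2),
      ‖χ.LFunction z‖ ≤ Real.exp (2 * l + Real.log (16 / a)) *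
        ‖χ.LFunction ((σ : ℂ) + t * Complex.I)‖ := by
  intro z hz
  have hl0 : 0 < l := ha.trans_le hal
  have hal1 : a / l ≤ 1 := (div_le_one hl0).mpr hal
  have hal0 : 0 < a / l := div_pos ha hl0
  have hq : (0 : ℝ) < q := by exact_mod_cast NeZero.pos q
  have hexp : Real.exp l = q * (T + 2) := by rw [hl, Real.exp_log (by positivity)]
  have hd : ‖z - ((σ : ℂ) + t * Complex.I)‖ = 1 / 2 := by simpa [dist_eq_norm] using hz
  have hre : 1 / 2 ≤ z.re := by
    have := (abs_le.mp ((Complex.abs_re_le_norm _).trans hd.le)).1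
    simp at this
    linarith
  have hzn : ‖z‖ ≤ 2 * (T + 2) := by
    have h1 : ‖z‖ ≤ 1 / 2 + ‖(σ : ℂ) + t * Complex.I‖ := by
      rw [← hd]; exact norm_le_norm_sub_add _ _
    have h2 : ‖(σ : ℂ) + t * Complex.I‖ ≤ |σ| + |t| := by
      refine (norm_add_le _ _).trans ?_
      simp
    rw [abs_of_pos (by linarith : 0 < σ)] at h2
    linarith
  have hup : ‖χ.LFunction z‖ ≤ 4 * Real.exp l := by
    refine (norm_LFunction_le hχ (by linarith)).trans ?_
    rw [div_le_iff₀ (by linarith), hexp]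
    have : (q : ℝ) * ‖z‖ ≤ q * (2 * (T + 2)) := by gcongr
    have h3 : 0 ≤ q * (T + 2) := by positivity
    nlinarith
  have hre2 : ((σ : ℂ) + t * Complex.I).re = σ := by simp
  have hlow := le_norm_LFunction χ (s := (σ : ℂ) + t * Complex.I) (by rw [hre2]; linarith)
  rw [hre2] at hlow
  have hlow2 : a / (2 * l) ≤ ‖χ.LFunction ((σ : ℂ) + t * Complex.I)‖ := by
    refine le_trans ?_ hlow
    rw [hσ, add_sub_cancel_left, le_div_iff₀ (by linarith)]
    calc a / (2 * l) * (1 + a / l) ≤ a / (2 * l) * 2 := by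
          gcongr; linarith
      _ = a / l := by field_simp
  calc ‖χ.LFunction z‖ ≤ 4 * Real.exp l := hup
    _ ≤ Real.exp (2 * l + Real.log (16 / a)) * (a / (2 * l)) := by
      rw [Real.exp_add, Real.exp_log (by positivity), show Real.exp (2 * l) =
        Real.exp l * Real.exp l by rw [two_mul, Real.exp_add]]
      have h4 : l ≤ Real.exp l := by linarith [Real.add_one_le_exp l]
      have h5 : Real.exp l * Real.exp l * (16 / a) * (a / (2 * l)) =
        8 * Real.exp l * (Real.exp l / l) := by field_simp; ring
      rw [h5]
      have h6 : 1 ≤ Real.exp l / l := (one_le_div hl0).mpr h4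
      nlinarith [Real.exp_pos l]
    _ ≤ _ := by gcongr

end ZeroFree

/-- The 3-4-1 inequality at σ = 1 + a/l: a zero at height t too close to Re s = 1 contributes -4/(σ
- Re ρ), which outweighs 3/(σ - 1) and the remaining O(l). The hypothesis χ² ≠ 1 ensures that
L(s,χ²) has no pole near σ + 2it. -/
theorem exists_zeroFree_region : ∃ c₀ : ℝ, 0 < c₀ ∧ c₀ ≤ 1 / 2 ∧ ∃ q₀ : ℕ, ∀ (q : ℕ) [NeZero q], q₀ ≤ q →
    ∀ χ : DirichletCharacter ℂ q, χ ^ 2 ≠ 1 → ∀ c ≤ c₀, ¬ IsExceptional c χ := by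
  obtain ⟨C, ε, hε, hC⟩ := exists_re_LSeries_vonMangoldt_le
  let a : ℝ := 1 / 1000
  let l₀ : ℝ := max (max (C) (2 * a / ε)) (max 1 (10 * (Real.log 16000 + 1)))
  refine ⟨1 / 10000, by norm_num, by norm_num, ⌈Real.exp l₀⌉₊, fun q _ hq χ hχ c hc ↦ ?_⟩
  rintro ⟨ρ, hρre, hρ⟩
  have hχ1 : χ ≠ 1 := by rintro rfl; simp at hχ
  set l := Real.log (q * (|ρ.im| + 2)) with hl
  have hq' : Real.exp l₀ ≤ q := (Nat.ceil_le.mp hq)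
  have hll : l₀ ≤ l := by
    rw [hl, Real.le_log_iff_exp_le (by have := (Real.exp_pos l₀).trans_le hq'; positivity)]
    nlinarith [abs_nonneg ρ.im, Real.exp_pos l₀]
  have hl1 : 1 ≤ l := le_trans (by simp [l₀]) hll
  have hlC : C ≤ l := le_trans (by simp [l₀]) hll
  have hlε : 2 * a / ε ≤ l := le_trans (by simp [l₀]) hll
  have hla : 10 * (Real.log 16000 + 1) ≤ l := le_trans (by simp [l₀]) hll
  have hl0 : 0 < l := by linarith
  have hal : a ≤ l := by simp only [a]; linarith
  have ha : 0 < a := by simp [a]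
  have hal0 : 0 < a / l := div_pos ha hl0
  set σ : ℝ := 1 + a / l with hσ
  have hσ1 : 1 < σ := by linarith
  have hσε : σ < 1 + ε := by
    rw [hσ]
    have : a / l < ε := by
      rw [div_le_iff₀ hε] at hlε
      rw [div_lt_iff₀ hl0]
      nlinarith
    linarith
  have hres : ∀ t : ℝ, 1 < ((σ : ℂ) + t * Complex.I).re := fun t ↦ by simpa using hσ1
  have h341 := re_LSeries_vonMangoldt_comb_nonneg χ hσ1 ρ.im
  have hζ := hC σ hσ1 hσε
  rw [LSeries_twist_vonMangoldt_eq_neg_deriv_LFunction_div χ (hres _),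
    LSeries_twist_vonMangoldt_eq_neg_deriv_LFunction_div (χ ^ 2) (hres _), Complex.neg_re,
    Complex.neg_re] at h341
  have hnz : ∀ (ψ : DirichletCharacter ℂ q), ψ ≠ 1 → ∀ t : ℝ, ∀ z, ψ.LFunction z = 0 →
      z.re ≤ ((σ : ℂ) + t * Complex.I).re := by
    intro ψ hψ t z hz
    by_contra! h
    exact ψ.LFunction_ne_zero_of_one_le_re (.inl hψ) ((hres t).trans h).le hz
  have hne : ∀ (ψ : DirichletCharacter ℂ q), ψ ≠ 1 → ∀ t : ℝ,
      ψ.LFunction ((σ : ℂ) + t * Complex.I) ≠ 0 := fun ψ hψ t ↦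
    ψ.LFunction_ne_zero_of_one_le_re (.inl hψ) (hres t).le
  have hρ1 : ρ.re < 1 := by
    by_contra! h
    exact χ.LFunction_ne_zero_of_one_le_re (.inl hχ1) h hρ
  have hsub : (σ : ℂ) + ρ.im * Complex.I - ρ = ((σ - ρ.re : ℝ) : ℂ) := by
    apply Complex.ext <;> simp
  have hσρ : σ - ρ.re ≤ 11 / 10000 / l := by
    have : c / l ≤ 1 / 10000 / l := by gcongr
    rw [hσ]
    have h2 : (11 / 10000 : ℝ) / l = a / l + 1 / 10000 / l := by
      simp only [a]; rw [← add_div]; norm_num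
    linarith
  have hσρ0 : 0 < σ - ρ.re := by linarith
  have hmem : ρ ∈ closedBall ((σ : ℂ) + ρ.im * Complex.I) (1 / 2 / 3) := by
    rw [mem_closedBall, dist_comm, dist_eq_norm, hsub, Complex.norm_real, Real.norm_eq_abs,
      abs_of_pos hσρ0]
    refine hσρ.trans ?_
    rw [div_le_iff₀ hl0]
    linarith
  have hb1 := neg_re_deriv_div_le_sub (DirichletCharacter.differentiable_LFunction hχ1)
    (r := 1 / 2) (by norm_num) (hne χ hχ1 ρ.im)
    (norm_LFunction_le_exp_mul hχ1 hl ha hal hσ (by linarith [abs_nonneg ρ.im]) (abs_nonneg _))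
    (hnz χ hχ1 _) hρ hmem
  have hb2 := neg_re_deriv_div_le (DirichletCharacter.differentiable_LFunction hχ)
    (r := 1 / 2) (by norm_num) (hne _ hχ (2 * ρ.im))
    (norm_LFunction_le_exp_mul hχ hl ha hal hσ (by rw [abs_mul, abs_two]) (abs_nonneg _))
    (hnz _ hχ _)
  rw [hsub, one_div (((σ - ρ.re : ℝ)) : ℂ), ← Complex.ofReal_inv, Complex.ofReal_re] at hb1
  have hinv : l * (10000 / 11) ≤ (σ - ρ.re)⁻¹ := by
    rw [le_inv_comm₀ (by positivity) hσρ0]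
    refine hσρ.trans_eq ?_
    field_simp
  have hσa : 1 / (σ - 1) = 1000 * l := by
    rw [hσ, add_sub_cancel_left]; simp only [a]; field_simp
  have hlog : Real.log (16 / a) = Real.log 16000 := by simp only [a]; norm_num
  rw [hlog] at hb1 hb2
  rw [hσa] at hζ
  -- By the choice of `l₀`, C ≤ l and 24(2l + log 16000 + 1) ≤ 50.4 l. The 3-4-1 inequality would
  -- then give 0 ≤ (3·1000 + 3 + 5·50.4 - 4·10000/11) l, whose coefficient is negative.
  linarith

end

section

/-! ### The logarithm of a Dirichlet `L`-function without exceptional zeros -/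

open Metric
open scoped LSeries.notation

section LogL

variable {q : ℕ}

/-- Termwise for Re s > 1, then by the identity theorem. It carries the absence of exceptional zeros
from χ to `star χ`. -/
theorem LFunction_star [NeZero q] {χ : DirichletCharacter ℂ q} (hχ : χ ≠ 1) (s : ℂ) :
    (star χ).LFunction s = starRingEnd ℂ (χ.LFunction (starRingEnd ℂ s)) := by
  have hχ' : star χ ≠ 1 := fun h ↦ hχ (by rw [← star_star χ, h, star_one])
  have h1 : AnalyticOnNhd ℂ (star χ).LFunction Set.univ :=
    (DirichletCharacter.differentiable_LFunction hχ').differentiableOn.analyticOnNhd isOpen_univ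
  have h2 : AnalyticOnNhd ℂ (starRingEnd ℂ ∘ χ.LFunction ∘ starRingEnd ℂ) Set.univ := by
    refine DifferentiableOn.analyticOnNhd (fun s _ ↦ ?_) isOpen_univ
    refine DifferentiableAt.differentiableWithinAt ?_
    have := (DirichletCharacter.differentiable_LFunction hχ (starRingEnd ℂ s)).hasDerivAt.conj_conj
    rw [Complex.conj_conj] at this
    exact this.differentiableAt
  refine h1.eqOn_of_preconnected_of_eventuallyEq h2 isPreconnected_univ (z₀ := 2) trivial ?_
    (Set.mem_univ s)
  have : ∀ᶠ s : ℂ in 𝓝 2, 1 < s.re :=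
    (isOpen_lt continuous_const Complex.continuous_re).mem_nhds (by simp)
  filter_upwards [this] with s hs
  rw [(star χ).LFunction_eq_LSeries hs, Function.comp_apply, Function.comp_apply,
    χ.LFunction_eq_LSeries (by simpa using hs), LSeries, LSeries, Complex.conj_tsum]
  refine tsum_congr fun n ↦ ?_
  rcases eq_or_ne n 0 with rfl | hn
  · simp
  rw [LSeries.term_of_ne_zero hn, LSeries.term_of_ne_zero hn, map_div₀, MulChar.star_apply,
    ← Complex.conj_cpow, Complex.conj_natCast]
  · rfl
  · rw [Complex.natCast_arg]; exact Real.pi_ne_zero.symm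

theorem isExceptional_of_star [NeZero q] {χ : DirichletCharacter ℂ q} (hχ : χ ≠ 1) {c : ℝ}
    (h : IsExceptional c (star χ)) : IsExceptional c χ := by
  obtain ⟨s, hs, h0⟩ := h
  refine ⟨starRingEnd ℂ s, by simpa using hs, ?_⟩
  rw [LFunction_star hχ] at h0
  simpa using h0

theorem norm_character_mul_cpow_le (χ : DirichletCharacter ℂ q) (s : ℂ) (p : Nat.Primes) :
    ‖χ (p : ℕ) * ((p : ℕ) : ℂ) ^ (-s)‖ ≤ ((p : ℕ) : ℝ) ^ (-s.re) := by
  rw [norm_mul, Complex.norm_natCast_cpow_of_pos p.2.pos, Complex.neg_re]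
  exact mul_le_of_le_one_left (by positivity) (χ.norm_le_one _)

theorem norm_neg_log_one_sub_le (χ : DirichletCharacter ℂ q) {s : ℂ} {σ : ℝ} (hσ : 1 ≤ σ)
    (hs : σ ≤ s.re) (p : Nat.Primes) :
    ‖-Complex.log (1 - χ (p : ℕ) * ((p : ℕ) : ℂ) ^ (-s))‖ ≤ 3 / 2 * ((p : ℕ) : ℝ) ^ (-σ) := by
  have h2 : (2 : ℝ) ≤ ((p : ℕ) : ℝ) := by exact_mod_cast p.2.two_le
  have h3 : ((p : ℕ) : ℝ) ^ (-s.re) ≤ ((p : ℕ) : ℝ) ^ (-σ) :=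
    Real.rpow_le_rpow_of_exponent_le (by linarith) (by linarith)
  have h1 := (norm_character_mul_cpow_le χ s p).trans h3
  have h4 : ((p : ℕ) : ℝ) ^ (-σ) ≤ 1 / 2 := by
    calc ((p : ℕ) : ℝ) ^ (-σ) ≤ ((p : ℕ) : ℝ) ^ (-1 : ℝ) :=
          Real.rpow_le_rpow_of_exponent_le (by linarith) (by linarith)
      _ = (((p : ℕ) : ℝ))⁻¹ := Real.rpow_neg_one _
      _ ≤ 2⁻¹ := by gcongr
      _ = _ := by norm_num
  rw [norm_neg, sub_eq_add_neg]
  refine (Complex.norm_log_one_add_half_le_self (by rw [norm_neg]; exact h1.trans h4)).trans ?_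
  rw [norm_neg]
  gcongr

theorem summable_primes_rpow_neg {σ : ℝ} (hσ : 1 < σ) :
    Summable fun p : Nat.Primes ↦ ((p : ℕ) : ℝ) ^ (-σ) :=
  Nat.Primes.summable_rpow.mpr (by linarith)

theorem tsum_primes_rpow_neg_two_le : ∑' p : Nat.Primes, ((p : ℕ) : ℝ) ^ (-2 : ℝ) ≤ 2 := by
  have h1 : Summable fun n : ℕ ↦ (n : ℝ) ^ (-2 : ℝ) := Real.summable_nat_rpow.mpr (by norm_num)
  refine (tsum_comp_le_tsum_of_inj h1 (fun n ↦ by positivity)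
    Nat.Primes.coe_nat_injective).trans ?_
  have h2 : ∑' n : ℕ, (n : ℝ) ^ (-2 : ℝ) = Real.pi ^ 2 / 6 := by
    rw [← hasSum_zeta_two.tsum_eq]
    refine tsum_congr fun n ↦ ?_
    rw [Real.rpow_neg (by positivity), one_div, ← Real.rpow_natCast]
    norm_num
  rw [h2]
  nlinarith [Real.pi_lt_d2, Real.pi_pos]

/-- The decay in Re s is retained because the branch of the logarithm is normalised by its limit 0
at +∞. -/
theorem norm_logEulerProduct_le (χ : DirichletCharacter ℂ q) {s : ℂ} (hs : 2 ≤ s.re) :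
    ‖logEulerProduct χ s‖ ≤ 3 * 2 ^ (2 - s.re) := by
  have hsum := (summable_primes_rpow_neg (σ := 2) (by norm_num)).mul_left (3 / 2 * 2 ^ (2 - s.re))
  refine (tsum_of_norm_bounded hsum.hasSum fun p ↦ ?_).trans ?_
  · refine (norm_neg_log_one_sub_le χ (by linarith) le_rfl p).trans ?_
    have hp : (2 : ℝ) ≤ ((p : ℕ) : ℝ) := by exact_mod_cast p.2.two_le
    have h1 : ((p : ℕ) : ℝ) ^ (-s.re) =
        ((p : ℕ) : ℝ) ^ (2 - s.re) * ((p : ℕ) : ℝ) ^ (-2 : ℝ) := by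
      rw [← Real.rpow_add (by linarith)]; ring_nf
    rw [h1, mul_assoc]
    gcongr 3 / 2 * (?_ * _)
    exact Real.rpow_le_rpow_of_nonpos two_pos hp (by linarith)
  · rw [tsum_mul_left]
    calc _ ≤ 3 / 2 * (2 : ℝ) ^ (2 - s.re) * 2 := by
          gcongr
          exact tsum_primes_rpow_neg_two_le
      _ = _ := by ring

theorem continuousOn_logEulerProduct (χ : DirichletCharacter ℂ q) :
    ContinuousOn (logEulerProduct χ) {s | 3 / 2 < s.re} := by
  refine continuousOn_tsum (fun p s hs ↦ ?_)
    ((summable_primes_rpow_neg (σ := 3 / 2) (by norm_num)).mul_left (3 / 2))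
    (fun p s hs ↦ norm_neg_log_one_sub_le χ (by norm_num) (le_of_lt hs) p)
  have hs' : 3 / 2 < s.re := hs
  have hp : ((p : ℕ) : ℂ) ≠ 0 := by exact_mod_cast p.2.ne_zero
  refine ContinuousAt.continuousWithinAt (ContinuousAt.neg (ContinuousAt.clog ?_ ?_))
  · exact continuousAt_const.sub (continuousAt_const.mul
      (continuousAt_neg.const_cpow (.inl hp)))
  · rw [sub_eq_add_neg]
    refine Complex.mem_slitPlane_of_norm_lt_one ?_
    rw [norm_neg]
    exact norm_character_mul_cpow_lt_one χ (by linarith) p.2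

/-- Logarithms of the same number differ by multiples of 2πi, and 6 < 2π. -/
theorem eq_of_exp_eq_of_norm_sub_lt {a b : ℂ} (h : Complex.exp a = Complex.exp b)
    (hab : ‖a - b‖ < 6) : a = b := by
  obtain ⟨n, hn⟩ := Complex.exp_eq_exp_iff_exists_int.mp h
  rcases eq_or_ne n 0 with rfl | h0
  · simpa using hn
  exfalso
  rw [hn, add_sub_cancel_left] at hab
  have h1 : ‖(n : ℂ) * (2 * Real.pi * Complex.I)‖ = |(n : ℝ)| * (2 * Real.pi) := by
    simp [abs_of_pos Real.pi_pos]
  have h2 : (1 : ℝ) ≤ |(n : ℝ)| := by exact_mod_cast Int.one_le_abs h0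
  rw [h1] at hab
  nlinarith [Real.pi_gt_three]

/-- A logarithm of `L(s, χ)` on a disc around `2` containing `1`, normalised by the Euler product. -/
structure IsLogLFunction [NeZero q] (χ : DirichletCharacter ℂ q) (R : ℝ) (G : ℂ → ℂ) : Prop where
  differentiableOn : DifferentiableOn ℂ G (ball 2 R)
  exp_eq : ∀ s ∈ ball (2 : ℂ) R, Complex.exp (G s) = χ.LFunction s
  apply_two : G 2 = logEulerProduct χ 2

theorem IsLogLFunction.eventually_eq [NeZero q] {χ : DirichletCharacter ℂ q} {R : ℝ} {G : ℂ → ℂ}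
    (hG : IsLogLFunction χ R G) (hR : 0 < R) : ∀ᶠ s in 𝓝 2, G s = logEulerProduct χ s := by
  have hmem : ball (2 : ℂ) R ∈ 𝓝 2 := ball_mem_nhds _ hR
  have hU : {s : ℂ | 3 / 2 < s.re} ∈ 𝓝 2 :=
    (isOpen_lt continuous_const Complex.continuous_re).mem_nhds (by norm_num)
  have hc1 : ContinuousAt G 2 := hG.differentiableOn.continuousOn.continuousAt hmem
  have hc2 : ContinuousAt (logEulerProduct χ) 2 := (continuousOn_logEulerProduct χ).continuousAt hU
  have hc := (hc1.sub hc2).norm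
  have h6 : ‖G 2 - logEulerProduct χ 2‖ < 6 := by rw [hG.apply_two]; simp
  filter_upwards [hc.eventually (gt_mem_nhds h6), hmem, hU] with s hs h1 h2
  refine eq_of_exp_eq_of_norm_sub_lt ?_ hs
  have h3 : 1 < s.re := by
    have : 3 / 2 < s.re := h2
    linarith
  rw [hG.exp_eq s h1, exp_logEulerProduct χ h3, χ.LFunction_eq_LSeries h3]

/-- Gluing G on [1,2] to `logEulerProduct` on [2,∞) produces an `IsLogBranch`, and branches are
unique. -/
theorem IsLogLFunction.apply_one [NeZero q] {χ : DirichletCharacter ℂ q} {R : ℝ} {G : ℂ → ℂ}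
    (hG : IsLogLFunction χ R G) (hR : 1 < R) : G 1 = logLOne χ := by
  let h : ℝ → ℂ := fun σ ↦
    G ((min σ 2 : ℝ) : ℂ) + logEulerProduct χ ((max σ 2 : ℝ) : ℂ) - logEulerProduct χ 2
  have hball : ∀ σ : ℝ, 1 ≤ σ → σ ≤ 2 → (σ : ℂ) ∈ ball (2 : ℂ) R := by
    intro σ h1 h2
    have : ((σ : ℂ) - 2) = ((σ - 2 : ℝ) : ℂ) := by push_cast; rfl
    rw [mem_ball, dist_eq_norm, this, Complex.norm_real, Real.norm_eq_abs, abs_of_nonpos (by linarith)]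
    linarith
  have hbr : IsLogBranch χ h := by
    refine ⟨?_, fun σ hσ ↦ ?_, ?_⟩
    · refine ((hG.differentiableOn.continuousOn.comp (f := fun σ : ℝ ↦ ((min σ 2 : ℝ) : ℂ))
        (by fun_prop) fun σ hσ ↦ ?_).add
        ((continuousOn_logEulerProduct χ).comp (f := fun σ : ℝ ↦ ((max σ 2 : ℝ) : ℂ))
        (by fun_prop) fun σ hσ ↦ ?_)).sub continuousOn_const
      · exact hball _ (le_min hσ one_le_two) (min_le_right _ _)
      · have : (2 : ℝ) ≤ max σ 2 := le_max_right _ _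
        change 3 / 2 < (((max σ 2 : ℝ) : ℂ)).re
        rw [Complex.ofReal_re]
        linarith
    · rcases le_total σ 2 with h2 | h2
      · simp only [h, min_eq_left h2, max_eq_right h2]
        rw [Complex.ofReal_ofNat, add_sub_cancel_right]
        exact hG.exp_eq _ (hball σ hσ h2)
      · simp only [h, min_eq_right h2, max_eq_left h2]
        rw [Complex.ofReal_ofNat, hG.apply_two, add_sub_cancel_left]
        have : 1 < (σ : ℂ).re := by rw [Complex.ofReal_re]; linarith
        rw [exp_logEulerProduct χ this, χ.LFunction_eq_LSeries this]
    · have h1 : Tendsto (fun σ : ℝ ↦ logEulerProduct χ (σ : ℂ)) atTop (𝓝 0) := by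
        refine squeeze_zero_norm' (a := fun σ : ℝ ↦ 3 * 2 ^ (2 - σ)) ?_ ?_
        · filter_upwards [eventually_ge_atTop 2] with σ hσ
          simpa using norm_logEulerProduct_le χ (s := σ) (by simpa using hσ)
        · have h2 : Tendsto (fun σ : ℝ ↦ (2 : ℝ) ^ (2 - σ)) atTop (𝓝 0) := by
            refine (tendsto_rpow_atBot_of_base_gt_one 2 one_lt_two).comp ?_
            exact tendsto_atBot_add_const_left _ 2 tendsto_neg_atTop_atBot
          simpa using h2.const_mul 3
      refine h1.congr' ?_
      filter_upwards [eventually_ge_atTop 2] with σ hσ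
      simp only [h, min_eq_right hσ, max_eq_left hσ]
      rw [Complex.ofReal_ofNat, hG.apply_two, add_sub_cancel_left]
  rw [hbr.logLOne_eq]
  simp only [h]
  rw [min_eq_left one_le_two, max_eq_right one_le_two, Complex.ofReal_one, Complex.ofReal_ofNat,
    add_sub_cancel_right]

theorem one_le_log_four_mul [NeZero q] : 1 ≤ Real.log (4 * q) := by
  have hq : (1 : ℝ) ≤ q := by exact_mod_cast NeZero.pos q
  rw [Real.le_log_iff_exp_le (by linarith)]
  linarith [Real.exp_one_lt_d9]

/-- On the disc |Im s| ≤ 2, so q(|Im s| + 2) ≤ 4q and non-exceptionality excludes zeros. With l =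
log(4q), Re(G - G 2) ≤ 5l and |s - 2| ≤ 2 at distance at least c/(2l) from the boundary,
Borel–Carathéodory gives 40 l²/c; the value G 2 accounts for another 3 l²/c. -/
theorem exists_isLogLFunction [NeZero q] {χ : DirichletCharacter ℂ q} (hχ : χ ≠ 1) {c : ℝ}
    (hc0 : 0 < c) (hc : c ≤ 1 / 2) (hex : ¬ IsExceptional c χ) :
    ∃ G : ℂ → ℂ, IsLogLFunction χ (1 + c / Real.log (4 * q)) G ∧
      ∀ s ∈ closedBall (2 : ℂ) (1 + c / (2 * Real.log (4 * q))),
        ‖G s‖ ≤ 43 * Real.log (4 * q) ^ 2 / c := by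
  have hl := one_le_log_four_mul (q := q)
  have hq : (1 : ℝ) ≤ q := by exact_mod_cast NeZero.pos q
  set l := Real.log (4 * q) with hldef
  have hl0 : 0 < l := by linarith
  have hcl : c / l ≤ 1 / 2 := (div_le_of_le_mul₀ hl0.le (by norm_num) (by linarith))
  have hcl0 : 0 < c / l := div_pos hc0 hl0
  have hre : ∀ s ∈ ball (2 : ℂ) (1 + c / l), 1 - c / l < s.re ∧ |s.im| ≤ 2 ∧ ‖s‖ ≤ 4 := by
    intro s hs
    have hd : ‖s - 2‖ < 1 + c / l := by simpa [dist_eq_norm] using hs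
    have h1 := (abs_lt.mp ((Complex.abs_re_le_norm _).trans_lt hd)).1
    have h2 := (Complex.abs_im_le_norm _).trans hd.le
    simp only [Complex.sub_re, Complex.re_ofNat, Complex.sub_im, Complex.im_ofNat, sub_zero] at h1 h2
    have h3 : ‖s‖ ≤ ‖s - 2‖ + ‖(2 : ℂ)‖ := norm_le_norm_sub_add _ _
    rw [Complex.norm_ofNat] at h3
    exact ⟨by linarith, by linarith, by linarith⟩
  have hne : ∀ s ∈ ball (2 : ℂ) (1 + c / l), χ.LFunction s ≠ 0 := by
    intro s hs h0
    obtain ⟨h1, h2, -⟩ := hre s hs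
    refine hex ⟨s, ?_, h0⟩
    have h3 : 0 < Real.log (q * (|s.im| + 2)) := Real.log_pos (by nlinarith [abs_nonneg s.im])
    have h4 : Real.log (q * (|s.im| + 2)) ≤ l := by
      refine Real.log_le_log (by positivity) ?_
      nlinarith
    have h5 : c / l ≤ c / Real.log (q * (|s.im| + 2)) := by gcongr
    linarith
  have h2 : Complex.exp (logEulerProduct χ 2) = χ.LFunction 2 := by
    rw [exp_logEulerProduct χ (by simp), χ.LFunction_eq_LSeries (by simp)]
  obtain ⟨G, hG2, hGd, hGe⟩ := exists_differentiableOn_exp_eq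
    (DirichletCharacter.differentiable_LFunction hχ).differentiableOn hne h2
  refine ⟨G, ⟨hGd, hGe, hG2⟩, fun s hs ↦ ?_⟩
  have hG2n : ‖G 2‖ ≤ 3 := by
    rw [hG2]
    simpa using norm_logEulerProduct_le χ (s := 2) (by simp)
  have hGre : ∀ s ∈ ball (2 : ℂ) (1 + c / l), (G s - G 2).re ≤ 5 * l := by
    intro s hs
    obtain ⟨h3, -, h4⟩ := hre s hs
    have h5 : ‖χ.LFunction s‖ ≤ Real.exp (2 * l) := by
      refine (norm_LFunction_le hχ (by linarith)).trans ?_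
      rw [div_le_iff₀ (by linarith), two_mul, Real.exp_add, hldef, Real.exp_log (by linarith)]
      have h7 : (q : ℝ) * ‖s‖ ≤ q * 4 := by gcongr
      nlinarith
    rw [← hGe s hs, Complex.norm_exp, Real.exp_le_exp] at h5
    have h6 := (abs_le.mp ((Complex.abs_re_le_norm _).trans hG2n)).1
    rw [Complex.sub_re]
    linarith
  have hsn : ‖s - 2‖ ≤ 1 + c / (2 * l) := by simpa [dist_eq_norm] using hs
  have hc2 : c / (2 * l) = c / l / 2 := by field_simp
  have hmaps : ∀ z ∈ ball (0 : ℂ) (1 + c / l), 2 + z ∈ ball (2 : ℂ) (1 + c / l) :=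
    fun z hz ↦ by simpa using hz
  have hlt : ‖s - 2‖ < 1 + c / l := by rw [hc2] at hsn; linarith
  have h := Complex.borelCaratheodory_zero (f := fun w ↦ G (2 + w) - G 2) (z := s - 2)
    (M := 5 * l) (by linarith)
    ((hGd.comp (by fun_prop) hmaps).sub_const _) (fun w hw ↦ hGre _ (hmaps w hw)) (by linarith)
    (by rwa [mem_ball_zero_iff]) (by simp)
  rw [add_sub_cancel] at h
  have h8 : 2 * (5 * l) * ‖s - 2‖ / (1 + c / l - ‖s - 2‖) ≤ 40 * l ^ 2 / c := by
    rw [div_le_div_iff₀ (by linarith) hc0]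
    have h9 : c ≤ 2 * l * (1 + c / l - ‖s - 2‖) := by
      have : 2 * l * (c / l / 2) = c := by field_simp
      rw [hc2] at hsn
      nlinarith
    have h10 : ‖s - 2‖ ≤ 2 := by linarith
    nlinarith [mul_le_mul_of_nonneg_right h10 (mul_nonneg hl0.le hc0.le),
      mul_le_mul_of_nonneg_left h9 (mul_nonneg hl0.le (zero_le_two (α := ℝ)))]
  have h11 : 3 ≤ 3 * l ^ 2 / c := by
    rw [le_div_iff₀ hc0]; nlinarith
  calc ‖G s‖ ≤ ‖G s - G 2‖ + ‖G 2‖ := norm_le_norm_sub_add _ _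
    _ ≤ 40 * l ^ 2 / c + 3 * l ^ 2 / c := add_le_add (h.trans h8) (hG2n.trans h11)
    _ = _ := by ring

end LogL

end

section

/-! ### Truncated Taylor expansion of `L(s, χ) ^ z` at `s = 2` -/

open Metric
open scoped LSeries.notation

/-- The probability that a Poisson variable with mean `log n` is less than `K`. -/
noncomputable def poissonWeight (K n : ℕ) : ℝ :=
  (∑ j ∈ Finset.range K, Real.log n ^ j / (j.factorial : ℝ)) / n

theorem poissonWeight_nonneg (K n : ℕ) : 0 ≤ poissonWeight K n := by
  have : 0 ≤ Real.log n := Real.log_natCast_nonneg n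
  unfold poissonWeight
  positivity

/-- Rankin's trick with μ = 1 + 1/K and x = log n: the partial sum is at most μ^K e^{x/μ}, where μ^K
≤ e and x/μ - x = -x/(K+1). -/
theorem poissonWeight_le {K n : ℕ} (hK : K ≠ 0) (hn : n ≠ 0) :
    poissonWeight K n ≤ 3 * (n : ℝ) ^ (-(1 / ((K : ℝ) + 1))) := by
  have hx : 0 ≤ Real.log n := Real.log_natCast_nonneg n
  have hn0 : (0 : ℝ) < n := by exact_mod_cast Nat.pos_of_ne_zero hn
  have hK0 : (0 : ℝ) < K := by exact_mod_cast Nat.pos_of_ne_zero hK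
  set x := Real.log n with hxdef
  set μ : ℝ := 1 + 1 / K with hμ
  have hμ1 : 1 ≤ μ := by simp [hμ]
  have hμ0 : 0 < μ := by linarith
  have h1 : ∑ j ∈ Finset.range K, x ^ j / (j.factorial : ℝ) ≤ μ ^ K * Real.exp (x / μ) := by
    calc ∑ j ∈ Finset.range K, x ^ j / (j.factorial : ℝ)
        ≤ ∑ j ∈ Finset.range K, μ ^ K * ((x / μ) ^ j / (j.factorial : ℝ)) := by
          refine Finset.sum_le_sum fun j hj ↦ ?_
          rw [div_pow, ← mul_div_assoc]
          gcongr
          rw [mul_div_assoc', le_div_iff₀ (by positivity), mul_comm]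
          gcongr
          exact (Finset.mem_range.mp hj).le
      _ = μ ^ K * ∑ j ∈ Finset.range K, (x / μ) ^ j / (j.factorial : ℝ) := by rw [Finset.mul_sum]
      _ ≤ _ := by
          gcongr
          exact Real.sum_le_exp_of_nonneg (by positivity) K
  have h2 : μ ^ K ≤ 3 := by
    calc μ ^ K ≤ Real.exp (1 / K) ^ K := by
          gcongr
          rw [hμ, add_comm]
          exact Real.add_one_le_exp _
      _ = Real.exp 1 := by rw [← Real.exp_nat_mul]; field_simp
      _ ≤ 3 := by linarith [Real.exp_one_lt_d9]
  have h3 : Real.exp (x / μ) / n = (n : ℝ) ^ (-(1 / ((K : ℝ) + 1))) := by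
    have h4 : Real.exp x = n := Real.exp_log hn0
    rw [Real.rpow_def_of_pos hn0, ← hxdef, ← h4, ← Real.exp_sub, hμ]
    congr 1
    field_simp
    ring
  rw [poissonWeight, ← h3, ← mul_div_assoc]
  gcongr
  exact h1.trans (by gcongr)

theorem poissonWeight_le_one (K n : ℕ) : poissonWeight K n ≤ 1 := by
  rcases eq_or_ne n 0 with rfl | hn
  · simp [poissonWeight]
  have hn0 : (0 : ℝ) < n := by exact_mod_cast Nat.pos_of_ne_zero hn
  rw [poissonWeight, div_le_one hn0]
  calc _ ≤ Real.exp (Real.log n) := Real.sum_le_exp_of_nonneg (Real.log_natCast_nonneg n) K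
    _ = n := Real.exp_log hn0

/-- Rankin's trick on the tail j ≥ K of the exponential series, with ratio 5/4. -/
theorem one_sub_poissonWeight_le (K : ℕ) {n : ℕ} (hn : n ≠ 0) :
    1 - poissonWeight K n ≤ (4 / 5) ^ K * (n : ℝ) ^ (1 / 4 : ℝ) := by
  have hx : 0 ≤ Real.log n := Real.log_natCast_nonneg n
  have hn0 : (0 : ℝ) < n := by exact_mod_cast Nat.pos_of_ne_zero hn
  set x := Real.log n with hxdef
  have hexp : ∀ y : ℝ, HasSum (fun j : ℕ ↦ y ^ j / (j.factorial : ℝ)) (Real.exp y) := fun y ↦ by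
    rw [Real.exp_eq_exp_ℝ]; exact NormedSpace.expSeries_div_hasSum_exp y
  have hs1 := (hasSum_nat_add_iff' K).mpr (hexp x)
  have hs2 := ((hasSum_nat_add_iff' K).mpr (hexp (5 / 4 * x))).mul_left ((4 / 5 : ℝ) ^ K)
  have h1 : Real.exp x - ∑ j ∈ Finset.range K, x ^ j / (j.factorial : ℝ) ≤
      (4 / 5) ^ K * Real.exp (5 / 4 * x) := by
    refine (hasSum_le (fun j ↦ ?_) hs1 hs2).trans ?_
    · rw [mul_pow, mul_div_assoc, ← mul_assoc]
      refine le_mul_of_one_le_left (by positivity) ?_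
      rw [pow_add (5 / 4 : ℝ), mul_comm ((5 / 4 : ℝ) ^ j), ← mul_assoc, ← mul_pow]
      norm_num
      exact one_le_pow₀ (by norm_num)
    · gcongr
      rw [sub_le_self_iff]
      positivity
  have h3 : Real.exp x = n := Real.exp_log hn0
  have h2 : Real.exp (5 / 4 * x) = n * (n : ℝ) ^ (1 / 4 : ℝ) := by
    rw [Real.rpow_def_of_pos hn0, ← hxdef, ← h3, ← Real.exp_add]
    congr 1; ring
  rw [h2, h3] at h1
  rw [poissonWeight, ← hxdef, sub_le_comm]
  rw [show (1 : ℝ) - (4 / 5) ^ K * (n : ℝ) ^ (1 / 4 : ℝ) =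
    (n - (4 / 5) ^ K * (n * (n : ℝ) ^ (1 / 4 : ℝ))) / n by field_simp]
  gcongr
  linarith

theorem norm_sub_sum_taylor_le {F : ℂ → ℂ} {r R B : ℝ} (hr : 1 < r) (hrR : r < R)
    (hF : DifferentiableOn ℂ F (ball 2 R)) (hB : ∀ z ∈ closedBall (2 : ℂ) r, ‖F z‖ ≤ B) (K : ℕ) :
    ‖F 1 - ∑ j ∈ Finset.range K, (-1) ^ j * iteratedDeriv j F 2 / (j.factorial : ℂ)‖ ≤
      B * r⁻¹ ^ K * (1 - r⁻¹)⁻¹ := by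
  have h1 : (1 : ℂ) ∈ ball (2 : ℂ) R := by
    rw [mem_ball, dist_eq_norm]; norm_num; linarith
  have hs := Complex.hasSum_taylorSeries_on_ball hF h1
  have hs' : HasSum (fun j : ℕ ↦ (-1) ^ j * iteratedDeriv j F 2 / (j.factorial : ℂ)) (F 1) := by
    refine hs.congr_fun fun j ↦ ?_
    norm_num [smul_eq_mul]
    ring
  have hr0 : 0 < r := by linarith
  have hri : r⁻¹ < 1 := inv_lt_one_of_one_lt₀ hr
  have hb : ∀ j : ℕ, ‖(-1) ^ j * iteratedDeriv j F 2 / (j.factorial : ℂ)‖ ≤ B * r⁻¹ ^ j := by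
    intro j
    have h := Complex.norm_iteratedDeriv_le_of_forall_mem_sphere_norm_le j hr0
      ((hF.mono (closedBall_subset_ball hrR)).diffContOnCl_ball subset_rfl)
      (fun z hz ↦ hB z (sphere_subset_closedBall hz))
    have hj : (0 : ℝ) < j.factorial := by exact_mod_cast j.factorial_pos
    rw [norm_div, norm_mul, norm_pow, norm_neg, norm_one, one_pow, one_mul, Complex.norm_natCast,
      div_le_iff₀ hj]
    refine h.trans_eq ?_
    rw [inv_pow]; field_simp
  have ht := (hasSum_nat_add_iff' K).mpr hs'
  rw [← ht.tsum_eq]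
  have hg : HasSum (fun j : ℕ ↦ B * r⁻¹ ^ K * r⁻¹ ^ j) (B * r⁻¹ ^ K * (1 - r⁻¹)⁻¹) :=
    (hasSum_geometric_of_lt_one (by positivity) hri).mul_left _
  refine tsum_of_norm_bounded hg fun j ↦ (hb (j + K)).trans_eq ?_
  rw [pow_add]; ring

theorem iterate_logMul_apply (f : ℕ → ℂ) (j n : ℕ) :
    (LSeries.logMul^[j] f) n = Complex.log n ^ j * f n := by
  induction j with
  | zero => simp
  | succ j ih => rw [Function.iterate_succ_apply', LSeries.logMul, ih, pow_succ]; ring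

/-- The sign (1 - 2)^j cancels the sign in the j-th derivative of n^{-s}, so n^{-2} is multiplied by
the partial exponential sum of log n, which is n times the Poisson weight. -/
theorem sum_taylor_LSeries_eq {b : ℕ → ℂ} (hb : LSeries.abscissaOfAbsConv b < (2 : ℂ).re) (K : ℕ) :
    ∑ j ∈ Finset.range K, (-1) ^ j * iteratedDeriv j (LSeries b) 2 / (j.factorial : ℂ) =
      ∑' n : ℕ, b n * poissonWeight K n / n := by
  have h1 : ∀ j, (-1) ^ j * iteratedDeriv j (LSeries b) 2 / (j.factorial : ℂ) =
      ∑' n : ℕ, LSeries.term (LSeries.logMul^[j] b) 2 n / (j.factorial : ℂ) := by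
    intro j
    rw [LSeries_iteratedDeriv j hb, ← mul_assoc, ← mul_pow, neg_one_mul, neg_neg, one_pow, one_mul,
      LSeries, tsum_div_const]
  simp_rw [h1]
  rw [← Summable.tsum_finsetSum]
  · refine tsum_congr fun n ↦ ?_
    rcases eq_or_ne n 0 with rfl | hn
    · simp
    have hn0 : (n : ℂ) ≠ 0 := by exact_mod_cast hn
    simp_rw [LSeries.term_of_ne_zero hn, iterate_logMul_apply]
    rw [poissonWeight]
    push_cast
    rw [Finset.sum_div, Finset.mul_sum, Finset.sum_div]
    refine Finset.sum_congr rfl fun j _ ↦ ?_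
    have : (n : ℂ) ^ (2 : ℂ) = (n : ℂ) ^ 2 := by norm_cast
    rw [this]
    field_simp
  · intro j _
    refine Summable.div_const ?_ _
    refine LSeriesSummable_of_abscissaOfAbsConv_lt_re ?_
    rwa [LSeries.absicssaOfAbsConv_logPowMul]

/-- The coefficients of the Dirichlet series of `L(s, χ) ^ z₁ * L(s, star χ) ^ z₂`. -/
noncomputable def momentCoeff {q : ℕ} (χ : DirichletCharacter ℂ q) (z₁ z₂ : ℂ) : ℕ → ℂ :=
  (fun n ↦ divisorFn z₁ n * χ n) ⍟ (fun n ↦ divisorFn z₂ n * (star χ) n)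

theorem LSeriesHasSum_momentCoeff {q : ℕ} (χ : DirichletCharacter ℂ q) (z₁ z₂ : ℂ) {s : ℂ}
    (hs : 1 < s.re) : LSeriesHasSum (momentCoeff χ z₁ z₂) s
      (Complex.exp (z₁ * logEulerProduct χ s + z₂ * logEulerProduct (star χ) s)) := by
  rw [Complex.exp_add]
  exact (LSeriesHasSum_divisorFn_mul χ z₁ hs).convolution (LSeriesHasSum_divisorFn_mul _ z₂ hs)

theorem abscissaOfAbsConv_momentCoeff_lt {q : ℕ} (χ : DirichletCharacter ℂ q) (z₁ z₂ : ℂ) :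
    LSeries.abscissaOfAbsConv (momentCoeff χ z₁ z₂) < (2 : ℂ).re := by
  refine lt_of_le_of_lt (LSeriesSummable.abscissaOfAbsConv_le
    (LSeriesHasSum_momentCoeff χ z₁ z₂ (s := ((3 / 2 : ℝ) : ℂ)) ?_).LSeriesSummable) ?_
  · rw [Complex.ofReal_re]; norm_num
  · rw [Complex.ofReal_re, Complex.re_ofNat]
    exact EReal.coe_lt_coe_iff.mpr (by norm_num)

/-- Near 2 the function exp(z₁G₁ + z₂G₂) is the Dirichlet series, and at 1 it is the product of
powers. It is holomorphic past radius r > 1 about 2, so truncating the Taylor series costs a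
geometric factor r^{-K}. -/
theorem norm_LOnePow_mul_sub_le {q : ℕ} [NeZero q] {χ : DirichletCharacter ℂ q} (hχ : χ ≠ 1) {c : ℝ}
    (hc0 : 0 < c) (hc : c ≤ 1 / 2) (hex : ¬ IsExceptional c χ) (z₁ z₂ : ℂ) (K : ℕ) {r : ℝ}
    (hr : r = 1 + c / (2 * Real.log (4 * q))) :
    ‖LOnePow χ z₁ * LOnePow (star χ) z₂ - ∑' n : ℕ, momentCoeff χ z₁ z₂ n * poissonWeight K n / n‖ ≤
      Real.exp ((‖z₁‖ + ‖z₂‖) * (43 * Real.log (4 * q) ^ 2 / c)) * r⁻¹ ^ K * (1 - r⁻¹)⁻¹ := by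
  have hl := one_le_log_four_mul (q := q)
  have hχ' : star χ ≠ 1 := fun h ↦ hχ (by rw [← star_star χ, h, star_one])
  obtain ⟨G₁, hG₁, hb₁⟩ := exists_isLogLFunction hχ hc0 hc hex
  obtain ⟨G₂, hG₂, hb₂⟩ := exists_isLogLFunction hχ' hc0 hc (mt (isExceptional_of_star hχ) hex)
  set l := Real.log (4 * q) with hldef
  have hl0 : 0 < l := by linarith
  have hR : 1 < 1 + c / l := by have := div_pos hc0 hl0; linarith
  have hr1 : 1 < r := by have := div_pos hc0 (mul_pos two_pos hl0); linarith
  have hrR : r < 1 + c / l := by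
    rw [hr]; gcongr; linarith
  set F : ℂ → ℂ := fun s ↦ Complex.exp (z₁ * G₁ s + z₂ * G₂ s) with hF
  have hFd : DifferentiableOn ℂ F (ball 2 (1 + c / l)) :=
    ((hG₁.differentiableOn.const_mul z₁).add (hG₂.differentiableOn.const_mul z₂)).cexp
  have hFb : ∀ s ∈ closedBall (2 : ℂ) r,
      ‖F s‖ ≤ Real.exp ((‖z₁‖ + ‖z₂‖) * (43 * l ^ 2 / c)) := by
    intro s hs
    rw [hF, Complex.norm_exp, Real.exp_le_exp, add_mul]
    refine (Complex.re_le_norm _).trans ((norm_add_le _ _).trans ?_)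
    rw [norm_mul, norm_mul]
    rw [hr] at hs
    gcongr
    · exact hb₁ s hs
    · exact hb₂ s hs
  have h := norm_sub_sum_taylor_le hr1 hrR hFd hFb K
  have hev : F =ᶠ[𝓝 2] LSeries (momentCoeff χ z₁ z₂) := by
    have h1 : ∀ᶠ s : ℂ in 𝓝 2, 1 < s.re :=
      (isOpen_lt continuous_const Complex.continuous_re).mem_nhds (by simp)
    filter_upwards [hG₁.eventually_eq (by linarith), hG₂.eventually_eq (by linarith), h1]
      with s h1 h2 h3
    rw [(LSeriesHasSum_momentCoeff χ z₁ z₂ h3).LSeries_eq, hF]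
    simp only [h1, h2]
  have hsum : ∑ j ∈ Finset.range K, (-1) ^ j * iteratedDeriv j F 2 / (j.factorial : ℂ) =
      ∑' n : ℕ, momentCoeff χ z₁ z₂ n * poissonWeight K n / n := by
    rw [← sum_taylor_LSeries_eq (abscissaOfAbsConv_momentCoeff_lt χ z₁ z₂)]
    exact Finset.sum_congr rfl fun j _ ↦ by rw [hev.iteratedDeriv_eq]
  have hF1 : F 1 = LOnePow χ z₁ * LOnePow (star χ) z₂ := by
    rw [LOnePow, LOnePow, ← Complex.exp_add, hF, ← hG₁.apply_one hR, ← hG₂.apply_one hR]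
  rwa [hsum, hF1] at h

end

section

/-! ### Averaging over characters -/

open scoped ENNReal

theorem HasSum.divisorsAntidiagonal {H : ℕ × ℕ → ℂ} {a : ℂ} (hH : HasSum H a)
    (h1 : ∀ v, H (0, v) = 0) (h2 : ∀ u, H (u, 0) = 0) :
    HasSum (fun n : ℕ ↦ ∑ p ∈ n.divisorsAntidiagonal, H p) a := by
  refine (hH.tsum_fiberwise (fun p ↦ p.1 * p.2)).congr_fun fun n ↦ ?_
  rcases eq_or_ne n 0 with rfl | hn
  · rw [Nat.divisorsAntidiagonal_zero, Finset.sum_empty]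
    refine (tsum_congr fun p ↦ ?_).trans tsum_zero |>.symm
    obtain ⟨⟨u, v⟩, hp⟩ := p
    rcases mul_eq_zero.mp (Set.mem_preimage.mp hp) with h | h
    · change u = 0 at h
      subst h; exact h1 v
    · change v = 0 at h
      subst h; exact h2 u
  · have hset : (fun p : ℕ × ℕ ↦ p.1 * p.2) ⁻¹' {n} = (n.divisorsAntidiagonal : Set (ℕ × ℕ)) := by
      ext p; simp [hn]
    rw [hset]
    exact (Finset.tsum_subtype' _ _).symm

section Average

variable {q : ℕ}

/-- The weighted Dirichlet series coefficient attached to a pair of positive integers. -/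
noncomputable def pairCoeff (K : ℕ) (z₁ z₂ : ℂ) (p : ℕ × ℕ) : ℂ :=
  divisorFn z₁ p.1 * divisorFn z₂ p.2 * poissonWeight K (p.1 * p.2) / ((p.1 * p.2 : ℕ) : ℂ)

/-- The majorant of `pairCoeff`. -/
noncomputable def pairMajorant (k : ℕ) (σ : ℝ) (u v : ℕ) : ℝ≥0∞ :=
  (numFactorizations k u * natRpowNeg σ u) * (numFactorizations k v * natRpowNeg σ v)

theorem tsum_pairMajorant (k : ℕ) (σ : ℝ) :
    ∑' u, ∑' v, pairMajorant k σ u v = realZeta σ ^ (2 * k) := by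
  simp_rw [pairMajorant, ENNReal.tsum_mul_left, ENNReal.tsum_mul_right, tsum_numFactorizations]
  rw [← pow_add, two_mul]

theorem enorm_poissonWeight_div_le {K : ℕ} (hK : K ≠ 0) (n : ℕ) :
    ‖((poissonWeight K n : ℂ)) / (n : ℂ)‖ₑ ≤ 3 * natRpowNeg (1 + 1 / ((K : ℝ) + 1)) n := by
  rcases eq_or_ne n 0 with rfl | hn
  · simp
  have hn0 : (0 : ℝ) < n := by exact_mod_cast Nat.pos_of_ne_zero hn
  rw [natRpowNeg, if_neg hn, ← ofReal_norm, norm_div, Complex.norm_real, Complex.norm_natCast,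
    Real.norm_of_nonneg (poissonWeight_nonneg K n), show (3 : ℝ≥0∞) = ENNReal.ofReal 3 by simp,
    ← ENNReal.ofReal_mul (by norm_num)]
  refine ENNReal.ofReal_le_ofReal ?_
  rw [neg_add, Real.rpow_add hn0, Real.rpow_neg_one, mul_comm (n : ℝ)⁻¹, ← mul_assoc, div_eq_mul_inv]
  gcongr
  exact poissonWeight_le hK hn

theorem enorm_pairCoeff_le {K : ℕ} (hK : K ≠ 0) {z₁ z₂ : ℂ} {k : ℕ} (h₁ : ‖z₁‖ ≤ k) (h₂ : ‖z₂‖ ≤ k)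
    (p : ℕ × ℕ) :
    ‖pairCoeff K z₁ z₂ p‖ₑ ≤ 3 * pairMajorant k (1 + 1 / ((K : ℝ) + 1)) p.1 p.2 := by
  rw [pairCoeff, mul_div_assoc, enorm_mul, enorm_mul]
  calc _ ≤ (numFactorizations k p.1 : ℝ≥0∞) * numFactorizations k p.2 *
        (3 * natRpowNeg (1 + 1 / ((K : ℝ) + 1)) (p.1 * p.2)) := by
        gcongr
        · exact enorm_divisorFn_le h₁ _
        · exact enorm_divisorFn_le h₂ _
        · exact enorm_poissonWeight_div_le hK _
    _ = _ := by rw [natRpowNeg_mul, pairMajorant]; ring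

theorem tsum_enorm_pairCoeff_mul_le {K : ℕ} (hK : K ≠ 0) {z₁ z₂ : ℂ} {k : ℕ} (h₁ : ‖z₁‖ ≤ k)
    (h₂ : ‖z₂‖ ≤ k) (g : ℕ × ℕ → ℂ) (hg : ∀ p, ‖g p‖ₑ ≤ 1) :
    ∑' p, ‖pairCoeff K z₁ z₂ p * g p‖ₑ ≤ 3 * realZeta (1 + 1 / ((K : ℝ) + 1)) ^ (2 * k) := by
  rw [← tsum_pairMajorant, ← ENNReal.tsum_prod (f := pairMajorant _ _), ← ENNReal.tsum_mul_left]
  refine ENNReal.tsum_le_tsum fun p ↦ ?_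
  rw [enorm_mul]
  exact (mul_le_of_le_one_right zero_le (hg p)).trans (enorm_pairCoeff_le hK h₁ h₂ p)

theorem realZeta_one_add_le (K : ℕ) :
    realZeta (1 + 1 / ((K : ℝ) + 1)) ≤ ENNReal.ofReal ((K : ℝ) + 2) := by
  have hK : (0 : ℝ) < 1 / ((K : ℝ) + 1) := by positivity
  refine (realZeta_le (by linarith)).trans (ENNReal.ofReal_le_ofReal (le_of_eq ?_))
  rw [add_sub_cancel_left]
  field_simp
  ring

theorem realZeta_pow_le (K k : ℕ) :
    realZeta (1 + 1 / ((K : ℝ) + 1)) ^ k ≤ ENNReal.ofReal (((K : ℝ) + 2) ^ k) := by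
  rw [ENNReal.ofReal_pow (by positivity)]
  exact pow_le_pow_left' (realZeta_one_add_le K) k

theorem three_mul_realZeta_pow_le (K k : ℕ) :
    3 * realZeta (1 + 1 / ((K : ℝ) + 1)) ^ (2 * k) ≤ ENNReal.ofReal (3 * ((K : ℝ) + 2) ^ (2 * k)) := by
  rw [ENNReal.ofReal_mul (by norm_num)]
  gcongr
  · simp
  · exact realZeta_pow_le K (2 * k)

theorem summable_pairCoeff_mul {K : ℕ} (hK : K ≠ 0) (z₁ z₂ : ℂ) (g : ℕ × ℕ → ℂ)
    (hg : ∀ p, ‖g p‖ₑ ≤ 1) : Summable fun p ↦ pairCoeff K z₁ z₂ p * g p := by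
  obtain ⟨k, hk⟩ := exists_nat_ge (max ‖z₁‖ ‖z₂‖)
  refine (summable_norm_of_tsum_enorm_ne_top (ne_top_of_le_ne_top ENNReal.ofReal_ne_top
    ((tsum_enorm_pairCoeff_mul_le hK ((le_max_left _ _).trans hk) ((le_max_right _ _).trans hk) g
      hg).trans (three_mul_realZeta_pow_le K k)))).of_norm

theorem norm_tsum_pairCoeff_mul_le {K : ℕ} (hK : K ≠ 0) {z₁ z₂ : ℂ} {k : ℕ} (h₁ : ‖z₁‖ ≤ k)
    (h₂ : ‖z₂‖ ≤ k) (g : ℕ × ℕ → ℂ) (hg : ∀ p, ‖g p‖ₑ ≤ 1) :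
    ‖∑' p, pairCoeff K z₁ z₂ p * g p‖ ≤ 3 * ((K : ℝ) + 2) ^ (2 * k) := by
  have h : ‖∑' p, pairCoeff K z₁ z₂ p * g p‖ₑ ≤ ENNReal.ofReal (3 * ((K : ℝ) + 2) ^ (2 * k)) :=
    enorm_tsum_le_tsum_enorm.trans ((tsum_enorm_pairCoeff_mul_le hK h₁ h₂ g hg).trans
      (three_mul_realZeta_pow_le K k))
  rw [← ofReal_norm] at h
  exact (ENNReal.ofReal_le_ofReal_iff (by positivity)).mp h

theorem enorm_character_mul_star_le (χ : DirichletCharacter ℂ q) (a b : ZMod q) :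
    ‖χ a * (star χ) b‖ₑ ≤ 1 := by
  rw [enorm_mul]
  exact mul_le_one' (enorm_character_le_one χ a) (enorm_character_le_one (star χ) b)

theorem tsum_momentCoeff_eq {K : ℕ} (hK : K ≠ 0) (χ : DirichletCharacter ℂ q) (z₁ z₂ : ℂ) :
    ∑' n : ℕ, momentCoeff χ z₁ z₂ n * poissonWeight K n / n =
      ∑' p : ℕ × ℕ, pairCoeff K z₁ z₂ p * (χ p.1 * (star χ) p.2) := by
  have hs := (summable_pairCoeff_mul hK z₁ z₂ (fun p ↦ χ p.1 * (star χ) p.2)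
    fun p ↦ enorm_character_mul_star_le χ _ _).hasSum
  rw [← (hs.divisorsAntidiagonal (by simp [pairCoeff]) (by simp [pairCoeff])).tsum_eq]
  refine tsum_congr fun n ↦ ?_
  rw [momentCoeff, LSeries.convolution_def, Finset.sum_mul, Finset.sum_div]
  refine Finset.sum_congr rfl fun p hp ↦ ?_
  rw [pairCoeff, (Nat.mem_divisorsAntidiagonal.mp hp).1]
  ring

theorem sum_character_mul_star [NeZero q] (a b : ℕ) :
    ∑ χ : DirichletCharacter ℂ q, χ a * (star χ) b =
      (q.totient : ℂ) * if b.Coprime q ∧ (b : ZMod q) = a then 1 else 0 := by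
  by_cases hb : b.Coprime q
  · have hu : IsUnit (b : ZMod q) := (ZMod.isUnit_iff_coprime b q).mpr hb
    have h := DirichletCharacter.sum_char_inv_mul_char_eq ℂ hu (a : ZMod q)
    rw [if_congr (and_iff_right hb) rfl rfl, mul_ite, mul_one, mul_zero, ← h]
    refine Finset.sum_congr rfl fun χ _ ↦ ?_
    rw [MulChar.star_eq_inv, MulChar.inv_apply, mul_comm]
    obtain ⟨u, hu⟩ := hu
    rw [← hu, Ring.inverse_unit, ZMod.inv_coe_unit]
  · rw [if_neg (fun h ↦ hb h.1), mul_zero]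
    exact Finset.sum_eq_zero fun χ _ ↦ by
      rw [(star χ).map_nonunit (mt (ZMod.isUnit_iff_coprime b q).mp hb), mul_zero]

/-- The off-diagonal pairs of congruent integers coprime to the modulus. -/
noncomputable def offDiagonal (q k : ℕ) (σ : ℝ) : ℝ≥0∞ :=
  ∑' u : ℕ, ∑' v : ℕ, if u ≠ v ∧ v.Coprime q ∧ (v : ZMod q) = u then
    pairMajorant k σ u v else 0

theorem sum_tsum_pairCoeff [NeZero q] {K : ℕ} (hK : K ≠ 0) (z₁ z₂ : ℂ) :
    1 / (q.totient : ℂ) * ∑ χ : DirichletCharacter ℂ q,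
        ∑' p : ℕ × ℕ, pairCoeff K z₁ z₂ p * (χ p.1 * (star χ) p.2) =
      ∑' p : ℕ × ℕ, pairCoeff K z₁ z₂ p *
        if p.2.Coprime q ∧ (p.2 : ZMod q) = p.1 then 1 else 0 := by
  rw [← Summable.tsum_finsetSum fun χ _ ↦ summable_pairCoeff_mul hK z₁ z₂ _
    fun p ↦ enorm_character_mul_star_le χ _ _]
  simp_rw [← Finset.mul_sum, sum_character_mul_star, mul_left_comm _ (q.totient : ℂ)]
  rw [tsum_mul_left, ← mul_assoc, one_div_mul_cancel, one_mul]
  exact_mod_cast (Nat.totient_pos.mpr (NeZero.pos q)).ne'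

/-- The terms of the main term. -/
noncomputable def diagonalTerm (q : ℕ) (z₁ z₂ : ℂ) (n : ℕ) : ℂ :=
  if n.Coprime q then divisorFn z₁ n * divisorFn z₂ n / (n : ℂ) ^ 2 else 0

theorem enorm_divisorFn_mul_le {z₁ z₂ : ℂ} {k : ℕ} (h₁ : ‖z₁‖ ≤ k) (h₂ : ‖z₂‖ ≤ k) (n : ℕ) :
    ‖divisorFn z₁ n * divisorFn z₂ n‖ₑ ≤ numFactorizations (k * k) n := by
  rw [enorm_mul]
  calc _ ≤ (numFactorizations k n : ℝ≥0∞) * numFactorizations k n :=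
        mul_le_mul' (enorm_divisorFn_le h₁ n) (enorm_divisorFn_le h₂ n)
    _ ≤ _ := by exact_mod_cast numFactorizations_mul_le k k n

theorem summable_diagonalTerm (q : ℕ) (z₁ z₂ : ℂ) : Summable (diagonalTerm q z₁ z₂) := by
  obtain ⟨k, hk⟩ := exists_nat_ge (max ‖z₁‖ ‖z₂‖)
  refine (summable_norm_of_tsum_enorm_ne_top (ne_top_of_le_ne_top
    (realZeta_pow_lt_top (σ := 2) one_lt_two (k * k)).ne ?_)).of_norm
  rw [← tsum_numFactorizations]
  refine ENNReal.tsum_le_tsum fun n ↦ ?_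
  rw [diagonalTerm]
  split_ifs with h
  · rw [div_eq_mul_inv, enorm_mul]
    refine mul_le_mul' (enorm_divisorFn_mul_le ((le_max_left _ _).trans hk)
      ((le_max_right _ _).trans hk) n) ?_
    rw [natRpowNeg]
    split_ifs with hn
    · simp [hn]
    · rw [← ofReal_norm]
      refine ENNReal.ofReal_le_ofReal (le_of_eq ?_)
      rw [Real.rpow_neg (by positivity), norm_inv, norm_pow, Complex.norm_natCast]
      norm_cast
  · simp

/-- At n² the weight misses 1 by at most (4/5)^K n^{1/2}. Since the product of the two divisor
functions is at most d_{k²}, the sum is at most (4/5)^K ζ(3/2)^{k²}, and ζ(3/2) ≤ 3. -/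
theorem norm_tsum_diagonal_sub_le (q : ℕ) {z₁ z₂ : ℂ} {k : ℕ} (h₁ : ‖z₁‖ ≤ k) (h₂ : ‖z₂‖ ≤ k)
    (K : ℕ) :
    ‖∑' n : ℕ, diagonalTerm q z₁ z₂ n * (poissonWeight K (n * n) - 1 : ℂ)‖ ≤
      (4 / 5) ^ K * 3 ^ (k * k) := by
  have hz : realZeta (3 / 2) ≤ 3 := by
    refine (realZeta_le (by norm_num)).trans ?_
    norm_num
  have h : ‖∑' n : ℕ, diagonalTerm q z₁ z₂ n * (poissonWeight K (n * n) - 1 : ℂ)‖ₑ ≤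
      ENNReal.ofReal ((4 / 5) ^ K * 3 ^ (k * k)) := by
    refine enorm_tsum_le_tsum_enorm.trans ?_
    calc _ ≤ ∑' n : ℕ, ENNReal.ofReal ((4 / 5) ^ K) *
          (numFactorizations (k * k) n * natRpowNeg (3 / 2) n) := by
          refine ENNReal.tsum_le_tsum fun n ↦ ?_
          rcases eq_or_ne n 0 with rfl | hn
          · simp [diagonalTerm, divisorFn_zero_right]
          rw [diagonalTerm]
          split_ifs with hc
          swap
          · simp
          have hn0 : (0 : ℝ) < n := by exact_mod_cast Nat.pos_of_ne_zero hn
          rw [mul_comm_div, enorm_mul, mul_left_comm]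
          refine mul_le_mul' (enorm_divisorFn_mul_le h₁ h₂ n) ?_
          rw [natRpowNeg, if_neg hn, ← ENNReal.ofReal_mul (by positivity), ← ofReal_norm]
          refine ENNReal.ofReal_le_ofReal ?_
          have hw := one_sub_poissonWeight_le K (mul_ne_zero hn hn)
          have hw1 := poissonWeight_le_one K (n * n)
          have e1 : ‖(poissonWeight K (n * n) - 1 : ℂ)‖ = 1 - poissonWeight K (n * n) := by
            rw [← Complex.ofReal_one, ← Complex.ofReal_sub, Complex.norm_real, Real.norm_eq_abs,
              abs_of_nonpos (by linarith), neg_sub]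
          have e2 : (((n * n : ℕ) : ℝ)) ^ (1 / 4 : ℝ) = (n : ℝ) ^ (1 / 2 : ℝ) := by
            rw [Nat.cast_mul, Real.mul_rpow (by positivity) (by positivity), ← Real.rpow_add hn0]
            norm_num
          have e3 : (n : ℝ) ^ (-(3 / 2) : ℝ) = (n : ℝ) ^ (1 / 2 : ℝ) / (n : ℝ) ^ 2 := by
            rw [← Real.rpow_natCast (n : ℝ) 2, ← Real.rpow_sub hn0]
            norm_num
          rw [norm_div, e1, norm_pow, Complex.norm_natCast, e3, ← mul_div_assoc, ← e2]
          gcongr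
      _ = ENNReal.ofReal ((4 / 5) ^ K) * realZeta (3 / 2) ^ (k * k) := by
          rw [ENNReal.tsum_mul_left, tsum_numFactorizations]
      _ ≤ _ := by
          rw [ENNReal.ofReal_mul (by positivity), ENNReal.ofReal_pow (p := 3) (by norm_num)]
          gcongr
          simpa using hz
  rw [← ofReal_norm] at h
  exact (ENNReal.ofReal_le_ofReal_iff (by positivity)).mp h

theorem norm_tsum_congruent_sub_le {K : ℕ} (hK : K ≠ 0) {z₁ z₂ : ℂ} {k : ℕ} (h₁ : ‖z₁‖ ≤ k)
    (h₂ : ‖z₂‖ ≤ k) {δ : ℝ} (hδ : 0 ≤ δ)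
    (hoff : offDiagonal q k (1 + 1 / ((K : ℝ) + 1)) ≤ ENNReal.ofReal δ) :
    ‖(∑' p : ℕ × ℕ, pairCoeff K z₁ z₂ p *
        if p.2.Coprime q ∧ (p.2 : ZMod q) = p.1 then 1 else 0) -
      ∑' n : ℕ, diagonalTerm q z₁ z₂ n‖ ≤ 3 * δ + (4 / 5) ^ K * 3 ^ (k * k) := by
  have hi : ∀ (P : Prop) [Decidable P], ‖(if P then 1 else 0 : ℂ)‖ₑ ≤ 1 := by
    intro P _; split_ifs <;> simp
  have hsplit : ∀ p : ℕ × ℕ, pairCoeff K z₁ z₂ p *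
      (if p.2.Coprime q ∧ (p.2 : ZMod q) = p.1 then 1 else 0) =
      pairCoeff K z₁ z₂ p * (if p.1 ≠ p.2 ∧ p.2.Coprime q ∧ (p.2 : ZMod q) = p.1
        then 1 else 0) +
      pairCoeff K z₁ z₂ p * (if p.1 = p.2 ∧ p.2.Coprime q then 1 else 0) := by
    intro p
    by_cases h : p.1 = p.2
    · simp [h]
    · simp [h]
  have hs1 := summable_pairCoeff_mul hK z₁ z₂ (fun p ↦ if p.1 ≠ p.2 ∧ p.2.Coprime q ∧
    (p.2 : ZMod q) = p.1 then 1 else 0) fun p ↦ hi _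
  have hs2 := summable_pairCoeff_mul hK z₁ z₂ (fun p ↦ if p.1 = p.2 ∧ p.2.Coprime q
    then 1 else 0) fun p ↦ hi _
  have hdiag : ∀ n : ℕ, pairCoeff K z₁ z₂ (n, n) * (if n = n ∧ n.Coprime q then 1 else 0) =
      diagonalTerm q z₁ z₂ n * poissonWeight K (n * n) := by
    intro n
    simp only [true_and, pairCoeff, diagonalTerm]
    split_ifs
    · push_cast; ring
    · simp
  have hinj : Function.Injective fun n : ℕ ↦ (n, n) := fun a b h ↦ (Prod.ext_iff.mp h).1
  have hsupp : Function.support (fun p : ℕ × ℕ ↦ pairCoeff K z₁ z₂ p *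
      (if p.1 = p.2 ∧ p.2.Coprime q then 1 else 0)) ⊆ Set.range fun n : ℕ ↦ (n, n) := by
    intro p hp
    by_cases h : p.1 = p.2
    · exact ⟨p.1, Prod.ext rfl h⟩
    · simp [h] at hp
  have hd : ∑' p : ℕ × ℕ, pairCoeff K z₁ z₂ p *
      (if p.1 = p.2 ∧ p.2.Coprime q then 1 else 0) =
      ∑' n : ℕ, diagonalTerm q z₁ z₂ n * poissonWeight K (n * n) := by
    rw [← hinj.tsum_eq hsupp]
    exact tsum_congr hdiag
  have hs3 : Summable fun n : ℕ ↦ diagonalTerm q z₁ z₂ n * (poissonWeight K (n * n) : ℂ) := by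
    have := hs2.comp_injective hinj
    exact this.congr fun n ↦ (hdiag n)
  simp_rw [hsplit]
  rw [hs1.tsum_add hs2, hd, add_sub_assoc, ← hs3.tsum_sub (summable_diagonalTerm q z₁ z₂)]
  refine (norm_add_le _ _).trans (add_le_add ?_ ?_)
  · have h : ‖∑' p : ℕ × ℕ, pairCoeff K z₁ z₂ p * (if p.1 ≠ p.2 ∧ p.2.Coprime q ∧
        (p.2 : ZMod q) = p.1 then 1 else 0)‖ₑ ≤ ENNReal.ofReal (3 * δ) := by
      refine enorm_tsum_le_tsum_enorm.trans ?_
      rw [ENNReal.ofReal_mul (by norm_num)]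
      refine le_trans ?_ (mul_le_mul_right hoff _)
      rw [offDiagonal, ← ENNReal.tsum_prod (f := fun u v : ℕ ↦ if u ≠ v ∧ v.Coprime q ∧
        (v : ZMod q) = u then pairMajorant k (1 + 1 / ((K : ℝ) + 1)) u v else 0),
        ← ENNReal.tsum_mul_left]
      refine ENNReal.tsum_le_tsum fun p ↦ ?_
      split_ifs
      · simpa using enorm_pairCoeff_le hK h₁ h₂ p
      · simp
    rw [← ofReal_norm] at h
    exact (ENNReal.ofReal_le_ofReal_iff (by positivity)).mp h
  · simp_rw [← mul_sub_one]
    exact norm_tsum_diagonal_sub_le q h₁ h₂ K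

/-- On A each f χ is replaced by its model sum at cost τ. The at most B missing characters are then
added back with the trivial bound, so that orthogonality applies to the full group. -/
theorem norm_average_sub_le [NeZero q] {K : ℕ} (hK : K ≠ 0) {z₁ z₂ : ℂ} {k : ℕ} (h₁ : ‖z₁‖ ≤ k)
    (h₂ : ‖z₂‖ ≤ k) {δ τ : ℝ} (hδ : 0 ≤ δ) (hτ : 0 ≤ τ)
    (hoff : offDiagonal q k (1 + 1 / ((K : ℝ) + 1)) ≤ ENNReal.ofReal δ)
    {A : Finset (DirichletCharacter ℂ q)} {B : ℕ} (hA : (Finset.univ \ A).card ≤ B)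
    {f : DirichletCharacter ℂ q → ℂ}
    (hf : ∀ χ ∈ A, ‖f χ - ∑' n : ℕ, momentCoeff χ z₁ z₂ n * poissonWeight K n / n‖ ≤ τ) :
    ‖1 / (q.totient : ℂ) * ∑ χ ∈ A, f χ - ∑' n : ℕ, diagonalTerm q z₁ z₂ n‖ ≤
      τ + B / q.totient * (3 * ((K : ℝ) + 2) ^ (2 * k)) + (3 * δ + (4 / 5) ^ K * 3 ^ (k * k)) := by
  classical
  set M : DirichletCharacter ℂ q → ℂ := fun χ ↦
    ∑' p : ℕ × ℕ, pairCoeff K z₁ z₂ p * (χ p.1 * (star χ) p.2) with hM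
  have hφ : 0 < (q.totient : ℝ) := by exact_mod_cast Nat.totient_pos.mpr (NeZero.pos q)
  have hcard : (A.card : ℝ) ≤ q.totient := by
    rw [← DirichletCharacter.card_eq_totient_of_hasEnoughRootsOfUnity ℂ q, Nat.card_eq_fintype_card]
    exact_mod_cast A.card_le_univ
  have hsum : ∑ χ, M χ = ∑ χ ∈ A, M χ + ∑ χ ∈ Finset.univ \ A, M χ := by
    rw [add_comm, Finset.sum_sdiff (Finset.subset_univ A)]
  have hdec : 1 / (q.totient : ℂ) * ∑ χ ∈ A, f χ - ∑' n : ℕ, diagonalTerm q z₁ z₂ n =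
      1 / (q.totient : ℂ) * ∑ χ ∈ A, (f χ - M χ) -
        1 / (q.totient : ℂ) * ∑ χ ∈ Finset.univ \ A, M χ +
      (1 / (q.totient : ℂ) * ∑ χ, M χ - ∑' n : ℕ, diagonalTerm q z₁ z₂ n) := by
    rw [hsum, Finset.sum_sub_distrib]; ring
  rw [hdec]
  have hnφ : ‖1 / (q.totient : ℂ)‖ = 1 / (q.totient : ℝ) := by simp
  refine (norm_add_le _ _).trans (add_le_add ((norm_sub_le _ _).trans (add_le_add ?_ ?_)) ?_)
  · rw [norm_mul, hnφ, one_div_mul_eq_div, div_le_iff₀ hφ]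
    refine (norm_sum_le_of_le A (f := fun χ ↦ f χ - M χ) (n := fun _ ↦ τ) fun χ hχ ↦ ?_).trans ?_
    · rw [hM]
      simp only
      rw [← tsum_momentCoeff_eq hK]
      exact hf χ hχ
    · rw [Finset.sum_const, nsmul_eq_mul, mul_comm]
      gcongr
  · rw [norm_mul, hnφ, div_mul_eq_mul_div, div_mul_eq_mul_div, one_mul]
    gcongr
    refine (norm_sum_le_of_le _ fun χ _ ↦ norm_tsum_pairCoeff_mul_le hK h₁ h₂ _ fun p ↦
      enorm_character_mul_star_le χ _ _).trans ?_
    rw [Finset.sum_const, nsmul_eq_mul]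
    gcongr
  · rw [sum_tsum_pairCoeff hK]
    exact norm_tsum_congruent_sub_le hK h₁ h₂ hδ hoff

end Average

end

section

/-! ### Divisor sums in residue classes -/

open scoped ENNReal

theorem natRpowNeg_anti {σ : ℝ} (hσ : 0 ≤ σ) {m n : ℕ} (hm : m ≠ 0) (hmn : m ≤ n) :
    natRpowNeg σ n ≤ natRpowNeg σ m := by
  have hm0 : (0 : ℝ) < m := by exact_mod_cast Nat.pos_of_ne_zero hm
  rw [natRpowNeg, natRpowNeg, if_neg hm, if_neg (by omega)]
  exact ENNReal.ofReal_le_ofReal (Real.rpow_le_rpow_of_nonpos hm0 (by exact_mod_cast hmn)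
    (by linarith))

theorem natRpowNeg_le_inv {σ : ℝ} (hσ : 1 ≤ σ) {n : ℕ} : natRpowNeg σ n ≤ (n : ℝ≥0∞)⁻¹ := by
  rcases eq_or_ne n 0 with rfl | hn
  · simp
  have hn0 : (0 : ℝ) < n := by exact_mod_cast Nat.pos_of_ne_zero hn
  have hn1 : (1 : ℝ) ≤ n := by exact_mod_cast Nat.pos_of_ne_zero hn
  rw [natRpowNeg, if_neg hn, ← ENNReal.ofReal_natCast, ← ENNReal.ofReal_inv_of_pos hn0,
    ← Real.rpow_neg_one]
  exact ENNReal.ofReal_le_ofReal (Real.rpow_le_rpow_of_exponent_le hn1 (by linarith))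

theorem one_le_realZeta (σ : ℝ) : 1 ≤ realZeta σ := by
  rw [realZeta, ← natRpowNeg_one σ]
  exact ENNReal.le_tsum 1

theorem numFactorizations_le_succ (k n : ℕ) : numFactorizations k n ≤ numFactorizations (k + 1) n := by
  rcases eq_or_ne n 0 with rfl | hn
  · simp
  rw [numFactorizations_succ]
  exact Finset.single_le_sum (f := fun p : ℕ × ℕ ↦ numFactorizations k p.1)
    (a := (n, 1)) (fun _ _ ↦ Nat.zero_le _) (Nat.mem_divisorsAntidiagonal.mpr ⟨mul_one n, hn⟩)

/-- The least admissible b₀ contributes at most 1/B; the others are b₀ + jq ≥ jq with j ≥ 1 and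
contribute at most ζ(σ)/q. -/
theorem tsum_natRpowNeg_class_le {q : ℕ} [NeZero q] {σ : ℝ} (hσ : 1 ≤ σ) {B : ℕ} (hB : B ≠ 0)
    (r : ZMod q) :
    ∑' b : ℕ, (if B ≤ b ∧ (b : ZMod q) = r then natRpowNeg σ b else 0) ≤
      (B : ℝ≥0∞)⁻¹ + realZeta σ * (q : ℝ≥0∞)⁻¹ := by
  classical
  by_cases hex : ∃ b : ℕ, B ≤ b ∧ (b : ZMod q) = r
  swap
  · rw [ENNReal.tsum_eq_zero.mpr fun b ↦ if_neg fun h ↦ hex ⟨b, h⟩]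
    exact zero_le
  have hq : 0 < q := NeZero.pos q
  obtain ⟨hB₀, hr⟩ := Nat.find_spec hex
  set b₀ := Nat.find hex with hb₀
  have hinj : Function.Injective fun j : ℕ ↦ b₀ + j * q := fun i j h ↦ by
    simpa [hq.ne'] using h
  have hsupp : Function.support (fun b : ℕ ↦ if B ≤ b ∧ (b : ZMod q) = r then natRpowNeg σ b else 0)
      ⊆ Set.range fun j : ℕ ↦ b₀ + j * q := by
    intro b hb
    have hbc : B ≤ b ∧ (b : ZMod q) = r := by
      by_contra h
      exact hb (if_neg h)
    have hle : b₀ ≤ b := Nat.find_min' hex hbc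
    have hd : q ∣ b - b₀ := by
      rw [← Nat.modEq_iff_dvd' hle, ← ZMod.natCast_eq_natCast_iff, hr, hbc.2]
    obtain ⟨j, hj⟩ := hd
    refine ⟨j, ?_⟩
    simp only
    rw [mul_comm j q, ← hj]
    omega
  rw [← hinj.tsum_eq hsupp, tsum_eq_zero_add' ENNReal.summable]
  refine add_le_add ?_ ?_
  · rw [zero_mul, add_zero, if_pos ⟨hB₀, hr⟩]
    exact (natRpowNeg_anti (by linarith) hB hB₀).trans (natRpowNeg_le_inv hσ)
  · calc _ ≤ ∑' j : ℕ, natRpowNeg σ (j + 1) * (q : ℝ≥0∞)⁻¹ := by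
          refine ENNReal.tsum_le_tsum fun j ↦ ?_
          refine le_trans (b := natRpowNeg σ ((j + 1) * q)) ?_ ?_
          · split_ifs
            · exact natRpowNeg_anti (by linarith) (by positivity) (by omega)
            · exact zero_le
          · rw [natRpowNeg_mul]
            gcongr
            exact natRpowNeg_le_inv hσ
      _ ≤ _ := by
          rw [ENNReal.tsum_mul_right]
          gcongr
          exact ENNReal.tsum_comp_le_tsum_of_injective (add_left_injective 1) _

/-- The tail of the Dirichlet series of `numFactorizations k` in a residue class. -/
noncomputable def classTail {q : ℕ} (k : ℕ) (σ : ℝ) (y : ℕ) (r : ZMod q) : ℝ≥0∞ :=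
  ∑' m : ℕ, if y ≤ m ∧ (m : ZMod q) = r then numFactorizations k m * natRpowNeg σ m else 0

/-- Below q a residue class has at most one representative. -/
theorem tsum_class_lt_modulus_le {q : ℕ} (y : ℕ) (r : ZMod q) {f : ℕ → ℝ≥0∞} {M : ℝ≥0∞}
    (hM : ∀ m, y ≤ m → m < q → f m ≤ M) :
    ∑' m : ℕ, (if (y ≤ m ∧ m < q) ∧ (m : ZMod q) = r then f m else 0) ≤ M := by
  by_cases hex : ∃ m : ℕ, (y ≤ m ∧ m < q) ∧ (m : ZMod q) = r
  · obtain ⟨m₀, h₀⟩ := hex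
    rw [tsum_eq_single m₀, if_pos h₀]
    · exact hM m₀ h₀.1.1 h₀.1.2
    · intro m hm
      refine if_neg fun h ↦ hm ?_
      have := (ZMod.natCast_eq_natCast_iff' m m₀ q).mp (h.2.trans h₀.2.symm)
      rwa [Nat.mod_eq_of_lt h.1.2, Nat.mod_eq_of_lt h₀.1.2] at this
  · rw [ENNReal.tsum_eq_zero.mpr fun b ↦ if_neg fun h ↦ hex ⟨b, h⟩]
    exact zero_le

section Recursion

variable {q : ℕ} [NeZero q] {σ : ℝ} {y B : ℕ}

/-- A single m < q in the class costs M. If m = ab ≥ q ≥ yB, then a ≥ y or b ≥ B. In the first case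
fix b: as r is a unit, a runs through one unit class, giving T, and summing over b gives Tζ(σ). In
the second case fix a: b ≥ B runs through one class, and summing d_k(a) a^{-σ} gives ζ(σ)^k. -/
theorem classTail_succ_le (hσ : 1 ≤ σ) (hB : B ≠ 0) (hyB : y * B ≤ q) (k : ℕ)
    {T M : ℝ≥0∞}
    (hT : ∀ r : ZMod q, IsUnit r → classTail k σ y r ≤ T)
    (hM : ∀ m, y ≤ m → m < q → numFactorizations (k + 1) m * natRpowNeg σ m ≤ M)
    {r : ZMod q} (hr : IsUnit r) :
    classTail (k + 1) σ y r ≤ T * realZeta σ + M +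
      realZeta σ ^ k * ((B : ℝ≥0∞)⁻¹ + realZeta σ * (q : ℝ≥0∞)⁻¹) := by
  have hq : q ≠ 0 := NeZero.ne q
  set F : ℕ → ℝ≥0∞ := fun m ↦
    if (y ≤ m ∧ m < q) ∧ (m : ZMod q) = r then numFactorizations (k + 1) m * natRpowNeg σ m else 0
  set H₁ : ℕ → ℕ → ℝ≥0∞ := fun a b ↦ if y ≤ a ∧ (a : ZMod q) * b = r then
    numFactorizations k a * natRpowNeg σ a * natRpowNeg σ b else 0 with hH₁
  set H₂ : ℕ → ℕ → ℝ≥0∞ := fun a b ↦ if B ≤ b ∧ (a : ZMod q) * b = r then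
    numFactorizations k a * natRpowNeg σ a * natRpowNeg σ b else 0 with hH₂
  have hsplit : ∀ m : ℕ, (if y ≤ m ∧ (m : ZMod q) = r then
      (numFactorizations (k + 1) m : ℝ≥0∞) * natRpowNeg σ m else 0) ≤
      F m + ∑ p ∈ m.divisorsAntidiagonal, (H₁ p.1 p.2 + H₂ p.1 p.2) := by
    intro m
    split_ifs with h
    swap
    · exact zero_le
    rcases lt_or_ge m q with hm | hm
    · refine le_trans (le_of_eq ?_) le_self_add
      exact (if_pos ⟨⟨h.1, hm⟩, h.2⟩).symm
    · refine le_trans ?_ le_add_self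
      rw [numFactorizations_succ, Nat.cast_sum, Finset.sum_mul]
      refine Finset.sum_le_sum fun p hp ↦ ?_
      have hpm := (Nat.mem_divisorsAntidiagonal.mp hp).1
      have hpr : (p.1 : ZMod q) * p.2 = r := by rw [← h.2, ← hpm, Nat.cast_mul]
      have e : (numFactorizations k p.1 : ℝ≥0∞) * natRpowNeg σ m =
          numFactorizations k p.1 * natRpowNeg σ p.1 * natRpowNeg σ p.2 := by
        rw [← hpm, natRpowNeg_mul, mul_assoc]
      rcases le_or_gt y p.1 with hy1 | hy1
      · refine le_trans (le_of_eq ?_) le_self_add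
        rw [e]; exact (if_pos ⟨hy1, hpr⟩).symm
      · refine le_trans (le_of_eq ?_) le_add_self
        rw [e]; refine (if_pos ⟨?_, hpr⟩).symm
        by_contra! hb
        have := Nat.mul_lt_mul_of_lt_of_le hy1 hb.le (Nat.pos_of_ne_zero hB)
        omega
  have h1 : ∑' a, ∑' b, H₁ a b ≤ T * realZeta σ := by
    rw [ENNReal.tsum_comm, realZeta, ← ENNReal.tsum_mul_left]
    refine ENNReal.tsum_le_tsum fun b ↦ ?_
    by_cases hex : ∃ a : ℕ, (a : ZMod q) * b = r
    · obtain ⟨a₀, ha₀⟩ := hex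
      have hu := hr
      rw [← ha₀] at hu
      refine le_trans ?_ (mul_le_mul_left (hT a₀ (isUnit_of_mul_isUnit_left hu)) _)
      rw [classTail, ← ENNReal.tsum_mul_right]
      refine ENNReal.tsum_le_tsum fun a ↦ ?_
      simp only [hH₁]
      split_ifs with h h' h'
      · exact le_rfl
      · exact absurd ⟨h.1, (isUnit_of_mul_isUnit_right hu).mul_right_cancel (h.2.trans ha₀.symm)⟩ h'
      · exact zero_le
      · exact zero_le
    · rw [ENNReal.tsum_eq_zero.mpr fun a ↦ if_neg fun h ↦ hex ⟨a, h.2⟩]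
      exact zero_le
  have h2 : ∑' a, ∑' b, H₂ a b ≤
      realZeta σ ^ k * ((B : ℝ≥0∞)⁻¹ + realZeta σ * (q : ℝ≥0∞)⁻¹) := by
    rw [← tsum_numFactorizations, ← ENNReal.tsum_mul_right]
    refine ENNReal.tsum_le_tsum fun a ↦ ?_
    by_cases hex : ∃ b : ℕ, (a : ZMod q) * b = r
    · obtain ⟨b₀, hb₀⟩ := hex
      have hu := hr
      rw [← hb₀] at hu
      refine le_trans ?_ (mul_le_mul_right (tsum_natRpowNeg_class_le hσ hB (b₀ : ZMod q)) _)
      rw [← ENNReal.tsum_mul_left]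
      refine ENNReal.tsum_le_tsum fun b ↦ ?_
      simp only [hH₂]
      split_ifs with h h' h'
      · exact le_rfl
      · exact absurd ⟨h.1, (isUnit_of_mul_isUnit_left hu).mul_left_cancel (h.2.trans hb₀.symm)⟩ h'
      · exact zero_le
      · exact zero_le
    · rw [ENNReal.tsum_eq_zero.mpr fun b ↦ if_neg fun h ↦ hex ⟨b, h.2⟩]
      exact zero_le
  calc classTail (k + 1) σ y r
      ≤ ∑' m, (F m + ∑ p ∈ m.divisorsAntidiagonal, (H₁ p.1 p.2 + H₂ p.1 p.2)) :=
        ENNReal.tsum_le_tsum hsplit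
    _ = ∑' m, F m + (∑' a, ∑' b, H₁ a b + ∑' a, ∑' b, H₂ a b) := by
        rw [ENNReal.tsum_add, ENNReal.tsum_divisorsAntidiagonal (fun a b ↦ H₁ a b + H₂ a b)
          (fun b ↦ by simp [hH₁, hH₂]) (fun a ↦ by simp [hH₁, hH₂])]
        simp_rw [ENNReal.tsum_add]
    _ ≤ M + (T * realZeta σ +
        realZeta σ ^ k * ((B : ℝ≥0∞)⁻¹ + realZeta σ * (q : ℝ≥0∞)⁻¹)) := by
        gcongr
        exact tsum_class_lt_modulus_le y r hM
    _ = _ := by ring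

/-- For k = 0 the tail is empty because y > 1. Each step of the recursion multiplies by ζ(σ) and
adds one error term, hence k ζ(σ)^k. -/
theorem classTail_le (hσ : 1 ≤ σ) (hB : B ≠ 0) (hy : 1 < y) (hyB : y * B ≤ q) (k : ℕ) {M : ℝ≥0∞}
    (hM : ∀ m, y ≤ m → m < q → numFactorizations k m * natRpowNeg σ m ≤ M)
    {r : ZMod q} (hr : IsUnit r) :
    classTail k σ y r ≤ k * realZeta σ ^ k *
      (M + ((B : ℝ≥0∞)⁻¹ + realZeta σ * (q : ℝ≥0∞)⁻¹)) := by
  induction k generalizing r with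
  | zero =>
    rw [classTail, ENNReal.tsum_eq_zero.mpr]
    · exact zero_le
    · intro m
      rw [numFactorizations_zero_left]
      split_ifs with h h1
      · omega
      · simp
      · rfl
  | succ k ih =>
    set E := M + ((B : ℝ≥0∞)⁻¹ + realZeta σ * (q : ℝ≥0∞)⁻¹) with hE
    have hz := one_le_realZeta σ
    refine (classTail_succ_le hσ hB hyB k (fun r hr ↦ ih (fun m h1 h2 ↦ ?_) hr) hM
      hr).trans ?_
    · refine le_trans ?_ (hM m h1 h2)
      gcongr
      exact numFactorizations_le_succ k m
    · rw [add_assoc]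
      calc _ ≤ k * realZeta σ ^ k * E * realZeta σ + (realZeta σ ^ (k + 1) * M +
            realZeta σ ^ (k + 1) * ((B : ℝ≥0∞)⁻¹ + realZeta σ * (q : ℝ≥0∞)⁻¹)) := by
            gcongr
            · exact le_mul_of_one_le_left' (one_le_pow₀ hz)
            · exact k.le_succ
        _ = _ := by rw [← mul_add, ← hE]; push_cast; ring

/-- Distinct congruent integers differ by at least q, so the larger is at least q ≥ y and lies in
the tail of the class of the smaller; symmetry gives the factor 2. -/
theorem offDiagonal_le (hσ : 1 ≤ σ) (hB : B ≠ 0) (hy : 1 < y) (hyB : y * B ≤ q) (k : ℕ) {M : ℝ≥0∞}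
    (hM : ∀ m, y ≤ m → m < q → numFactorizations k m * natRpowNeg σ m ≤ M) :
    offDiagonal q k σ ≤ 2 * (k * realZeta σ ^ (2 * k) *
      (M + ((B : ℝ≥0∞)⁻¹ + realZeta σ * (q : ℝ≥0∞)⁻¹))) := by
  set E := M + ((B : ℝ≥0∞)⁻¹ + realZeta σ * (q : ℝ≥0∞)⁻¹) with hE
  have hyq : y ≤ q := (Nat.le_mul_of_pos_right y (Nat.pos_of_ne_zero hB)).trans hyB
  set P : ℕ → ℕ → ℝ≥0∞ := fun u v ↦ if IsUnit (u : ZMod q) ∧ y ≤ v ∧ (v : ZMod q) = u then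
    pairMajorant k σ u v else 0 with hP
  have hbound : ∑' u, ∑' v, P u v ≤ k * realZeta σ ^ (2 * k) * E := by
    have e : (k : ℝ≥0∞) * realZeta σ ^ (2 * k) * E = realZeta σ ^ k * (k * realZeta σ ^ k * E) := by
      rw [two_mul, pow_add]; ring
    rw [e, ← tsum_numFactorizations, ← ENNReal.tsum_mul_right, tsum_numFactorizations]
    refine ENNReal.tsum_le_tsum fun u ↦ ?_
    by_cases hu : IsUnit (u : ZMod q)
    · refine le_trans ?_ (mul_le_mul_right (classTail_le hσ hB hy hyB k hM hu) _)
      rw [classTail, ← ENNReal.tsum_mul_left]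
      refine ENNReal.tsum_le_tsum fun v ↦ ?_
      simp only [hP, hu, true_and, pairMajorant, mul_ite, mul_zero, le_refl]
    · rw [ENNReal.tsum_eq_zero.mpr fun b ↦ if_neg fun h ↦ hu h.1]
      exact zero_le
  have hlt : ∀ u v : ℕ, u < v → (v : ZMod q) = u → y ≤ v := by
    intro u v huv h
    have hd := (Nat.modEq_iff_dvd' huv.le).mp ((ZMod.natCast_eq_natCast_iff _ _ _).mp h.symm)
    have := Nat.le_of_dvd (by omega) hd
    omega
  calc offDiagonal q k σ ≤ ∑' u, ∑' v, (P u v + P v u) := by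
        refine ENNReal.tsum_le_tsum fun u ↦ ENNReal.tsum_le_tsum fun v ↦ ?_
        split_ifs with h
        swap
        · exact zero_le
        obtain ⟨hne, hc, he⟩ := h
        have hv : IsUnit (v : ZMod q) := (ZMod.isUnit_iff_coprime v q).mpr hc
        have hu : IsUnit (u : ZMod q) := he ▸ hv
        rcases lt_or_gt_of_ne hne with h | h
        · refine le_trans (le_of_eq ?_) le_self_add
          exact (if_pos ⟨hu, hlt u v h he, he⟩).symm
        · refine le_trans (le_of_eq ?_) le_add_self
          refine Eq.trans ?_ (if_pos ⟨hv, hlt v u h he.symm, he.symm⟩).symm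
          rw [pairMajorant, pairMajorant, mul_comm]
    _ = ∑' u, ∑' v, P u v + ∑' u, ∑' v, P v u := by simp_rw [ENNReal.tsum_add]
    _ = 2 * ∑' u, ∑' v, P u v := by rw [ENNReal.tsum_comm (f := fun u v ↦ P v u), two_mul]
    _ ≤ _ := by gcongr

end Recursion

end

section

/-! ### Pointwise bounds for divisor functions -/

theorem numFactorizations_prime_pow_succ (k : ℕ) {p : ℕ} (hp : p.Prime) (a : ℕ) :
    numFactorizations (k + 1) (p ^ a) = ∑ j ∈ Finset.range (a + 1), numFactorizations k (p ^ j) := by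
  rw [numFactorizations_succ, Nat.sum_divisorsAntidiagonal (f := fun d _ ↦ numFactorizations k d),
    Nat.sum_divisors_prime_pow hp]

theorem numFactorizations_prime_pow_mul_pow_le (k : ℕ) {p : ℕ} (hp : p.Prime) (a : ℕ) {x : ℝ}
    (hx0 : 0 ≤ x) (hx : x ^ 2 ≤ 1 / 2) :
    (numFactorizations k (p ^ a) : ℝ) * x ^ a ≤ Real.exp (2 * k * x) := by
  induction k generalizing a with
  | zero =>
    rw [numFactorizations_zero_left]
    have hx1 : x ≤ 1 := by nlinarith
    split_ifs
    · simpa using pow_le_one₀ hx0 hx1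
    · simp
  | succ k ih =>
    have hx1 : x < 1 := by nlinarith
    have hgeom : ∑ j ∈ Finset.range (a + 1), x ^ (a - j) ≤ (1 - x)⁻¹ := by
      have h := Finset.sum_range_reflect (fun j ↦ x ^ j) (a + 1)
      rw [Nat.add_sub_cancel] at h
      rw [h, geom_sum_eq hx1.ne, ← neg_div_neg_eq, inv_eq_one_div, neg_sub, neg_sub]
      have := pow_nonneg hx0 (a + 1)
      gcongr
      linarith
    have hexp : (1 - x)⁻¹ ≤ Real.exp (2 * x) := by
      rw [inv_le_iff_one_le_mul₀ (by linarith)]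
      have h := Real.quadratic_le_exp_of_nonneg (x := 2 * x) (by linarith)
      -- (1 - x)(1 + 2x + 2x²) = 1 + x(1 - 2x²), which is at least 1 precisely because x² ≤ 1/2.
      nlinarith [mul_nonneg hx0 (sub_nonneg.mpr hx)]
    rw [numFactorizations_prime_pow_succ k hp, Nat.cast_sum, Finset.sum_mul]
    calc _ ≤ ∑ j ∈ Finset.range (a + 1), Real.exp (2 * k * x) * x ^ (a - j) := by
          refine Finset.sum_le_sum fun j hj ↦ ?_
          rw [← Nat.add_sub_of_le (Nat.lt_succ_iff.mp (Finset.mem_range.mp hj)), pow_add,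
            Nat.add_sub_cancel_left, ← mul_assoc]
          gcongr
          exact ih j
      _ ≤ Real.exp (2 * k * x) * Real.exp (2 * x) := by
          rw [← Finset.mul_sum]
          gcongr
          exact hgeom.trans hexp
      _ = _ := by rw [← Real.exp_add]; push_cast; ring_nf

/-- Multiplicativity reduces this to prime powers with x = p^{-τ}; τ ≥ 1/2 ensures x² ≤ 1/p ≤ 1/2.
-/
theorem numFactorizations_mul_rpow_neg_le (k : ℕ) {τ : ℝ} (hτ : 1 / 2 ≤ τ) {n : ℕ} (hn : n ≠ 0) :
    (numFactorizations k n : ℝ) * (n : ℝ) ^ (-τ) ≤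
      Real.exp (2 * k * ∑ p ∈ n.primeFactors, (p : ℝ) ^ (-τ)) := by
  induction n using Nat.recOnPosPrimePosCoprime with
  | zero => exact absurd rfl hn
  | one => simp [(isMultiplicative_numFactorizations k).map_one]
  | prime_pow p a hp ha =>
    have hp0 : (0 : ℝ) < p := by exact_mod_cast hp.pos
    rw [Nat.primeFactors_prime_pow ha.ne' hp, Finset.sum_singleton, Nat.cast_pow,
      ← Real.rpow_natCast, ← Real.rpow_mul hp0.le, mul_comm (a : ℝ), Real.rpow_mul hp0.le,
      Real.rpow_natCast]
    refine numFactorizations_prime_pow_mul_pow_le k hp a (by positivity) ?_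
    rw [← Real.rpow_natCast, ← Real.rpow_mul hp0.le]
    calc (p : ℝ) ^ (-τ * (2 : ℕ)) ≤ (p : ℝ) ^ (-1 : ℝ) := by
          apply Real.rpow_le_rpow_of_exponent_le
          · exact_mod_cast hp.one_le
          · push_cast; linarith
      _ ≤ 1 / 2 := by
          rw [Real.rpow_neg_one, ← one_div]
          gcongr
          exact_mod_cast hp.two_le
  | coprime a b ha hb hab iha ihb =>
    rw [(isMultiplicative_numFactorizations k).map_mul_of_coprime hab, hab.primeFactors_mul,
      Finset.sum_union hab.disjoint_primeFactors, Nat.cast_mul, Nat.cast_mul,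
      Real.mul_rpow (by positivity) (by positivity), mul_add, Real.exp_add, mul_mul_mul_comm]
    have := iha (by omega)
    have := ihb (by omega)
    gcongr

theorem two_pow_card_primeFactors_le {n : ℕ} (hn : n ≠ 0) : 2 ^ n.primeFactors.card ≤ n :=
  (Finset.pow_card_le_prod (s := n.primeFactors) (f := id) (n := 2)
    fun _ hp ↦ (Nat.prime_of_mem_primeFactors hp).two_le).trans
    (Nat.le_of_dvd (Nat.pos_of_ne_zero hn) n.prod_primeFactors_dvd)

/-- For p ≤ N use p^{-τ} ≤ N^{1-τ}/p and the harmonic sum; the at most N primes beyond N contribute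
N^{-τ} each. -/
theorem sum_primeFactors_rpow_neg_le {n N : ℕ} (hN : N ≠ 0) (hcard : n.primeFactors.card ≤ N)
    {τ : ℝ} (hτ0 : 0 ≤ τ) (hτ : τ ≤ 1) :
    ∑ p ∈ n.primeFactors, (p : ℝ) ^ (-τ) ≤ (N : ℝ) ^ (1 - τ) * (Real.log N + 2) := by
  have hN0 : (0 : ℝ) < N := by exact_mod_cast Nat.pos_of_ne_zero hN
  have hsum : ∑ i ∈ Finset.Icc 1 N, (i : ℝ)⁻¹ ≤ 1 + Real.log N := by
    have := harmonic_le_one_add_log N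
    rw [harmonic_eq_sum_Icc] at this
    push_cast at this
    exact this
  have h : ∀ p ∈ n.primeFactors, (p : ℝ) ^ (-τ) ≤
      (if p ∈ Finset.Icc 1 N then (N : ℝ) ^ (1 - τ) * (p : ℝ)⁻¹ else 0) + (N : ℝ) ^ (-τ) := by
    intro p hp
    have hp1 := (Nat.prime_of_mem_primeFactors hp).one_le
    have hp0 : (0 : ℝ) < p := by exact_mod_cast hp1
    split_ifs with h
    · have e : (p : ℝ) ^ (-τ) = (p : ℝ) ^ (1 - τ) * (p : ℝ)⁻¹ := by
        rw [← Real.rpow_neg_one, ← Real.rpow_add hp0]; ring_nf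
      rw [e]
      have : (p : ℝ) ≤ N := by exact_mod_cast (Finset.mem_Icc.mp h).2
      refine le_add_of_le_of_nonneg ?_ (by positivity)
      gcongr
    · rw [zero_add]
      have : (N : ℝ) ≤ p := by
        rw [Finset.mem_Icc, not_and, not_le] at h
        exact_mod_cast (h hp1).le
      exact Real.rpow_le_rpow_of_nonpos hN0 this (by linarith)
  refine (Finset.sum_le_sum h).trans ?_
  rw [Finset.sum_add_distrib, Finset.sum_const, nsmul_eq_mul, ← Finset.sum_filter,
    ← Finset.mul_sum]
  have h1 : ∑ p ∈ n.primeFactors with p ∈ Finset.Icc 1 N, (p : ℝ)⁻¹ ≤ 1 + Real.log N := by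
    refine le_trans (Finset.sum_le_sum_of_subset_of_nonneg (fun p hp ↦ (Finset.mem_filter.mp hp).2)
      fun _ _ _ ↦ by positivity) hsum
  have h2 : (n.primeFactors.card : ℝ) * (N : ℝ) ^ (-τ) ≤ (N : ℝ) ^ (1 - τ) := by
    have e : (N : ℝ) ^ (1 - τ) = N * (N : ℝ) ^ (-τ) := by
      rw [sub_eq_add_neg, Real.rpow_add hN0, Real.rpow_one]
    rw [e]
    gcongr
  have h3 := mul_le_mul_of_nonneg_left h1 (by positivity : 0 ≤ (N : ℝ) ^ (1 - τ))
  linarith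

theorem numFactorizations_div_le (k : ℕ) {τ : ℝ} (hτ : 1 / 2 ≤ τ) (hτ1 : τ ≤ 1) {n N : ℕ}
    (hn : n ≠ 0) (hN : N ≠ 0) (hnN : n < 2 ^ (N + 1)) :
    (numFactorizations k n : ℝ) / n ≤
      (n : ℝ) ^ (-(1 - τ)) * Real.exp (2 * k * ((N : ℝ) ^ (1 - τ) * (Real.log N + 2))) := by
  have hn0 : (0 : ℝ) < n := by exact_mod_cast Nat.pos_of_ne_zero hn
  have hcard : n.primeFactors.card ≤ N := by
    have := (two_pow_card_primeFactors_le hn).trans_lt hnN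
    exact Nat.lt_succ_iff.mp ((Nat.pow_lt_pow_iff_right one_lt_two).mp this)
  have e : (numFactorizations k n : ℝ) / n =
      (n : ℝ) ^ (-(1 - τ)) * (numFactorizations k n * (n : ℝ) ^ (-τ)) := by
    rw [mul_left_comm, ← Real.rpow_add hn0, div_eq_mul_inv, ← Real.rpow_neg_one]
    ring_nf
  rw [e]
  gcongr
  refine (numFactorizations_mul_rpow_neg_le k hτ hn).trans ?_
  gcongr
  exact sum_primeFactors_rpow_neg_le hN hcard (by linarith) hτ1

/-! ### Characters of order at most two -/

/-- The unit group is cyclic, so a character is determined by its value at a generator, which must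
be ±1. -/
theorem card_character_sq_eq_one_le (q : ℕ) [Fact q.Prime] [NeZero q] :
    (Finset.univ.filter fun χ : DirichletCharacter ℂ q ↦ χ ^ 2 = 1).card ≤ 2 := by
  obtain ⟨g, hg⟩ := IsCyclic.exists_generator (α := (ZMod q)ˣ)
  have hinj : Set.InjOn (fun χ : DirichletCharacter ℂ q ↦ χ g)
      (Finset.univ.filter fun χ : DirichletCharacter ℂ q ↦ χ ^ 2 = 1) := by
    intro χ _ ψ _ h
    refine MulChar.ext fun u ↦ ?_
    obtain ⟨n, rfl⟩ := Subgroup.mem_zpowers_iff.mp (hg u)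
    have h' : χ.toUnitHom g = ψ.toUnitHom g := by
      ext; simpa [MulChar.coe_toUnitHom] using h
    rw [← MulChar.coe_toUnitHom, ← MulChar.coe_toUnitHom, map_zpow, map_zpow, h']
  rw [← Finset.card_image_of_injOn hinj]
  refine (Finset.card_le_card (t := {1, -1}) ?_).trans Finset.card_le_two
  intro w hw
  obtain ⟨χ, hχ, rfl⟩ := Finset.mem_image.mp hw
  have h2 : χ g ^ 2 = 1 := by
    rw [← MulChar.pow_apply' χ two_ne_zero, (Finset.mem_filter.mp hχ).2, MulChar.one_apply_coe]
  have h3 : χ g = 1 ∨ χ g = -1 := mul_self_eq_one_iff.mp ((sq _).symm.trans h2)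
  simpa using h3

end

section

/-! ### Choice of parameters -/

open scoped ENNReal

section Parameters

variable {x l : ℝ}

/-- Throughout this part x = log q, l = log log q, the order is k = ⌈x/(50 l²)⌉ and the truncation
is K = ⌈x^5⌉. -/
theorem ceil_pow_add_two_le (hx : 1000 ≤ x) (hl : Real.exp l = x) :
    ((⌈x ^ 5⌉₊ : ℕ) : ℝ) + 2 ≤ Real.exp (6 * l) := by
  have h1 := Nat.ceil_lt_add_one (a := x ^ 5) (by positivity)
  have h2 : Real.exp (6 * l) = x ^ 6 := by
    rw [← hl, ← Real.exp_nat_mul]; norm_num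
  have h3 : (1 : ℝ) ≤ x ^ 5 := one_le_pow₀ (by linarith)
  rw [h2]
  nlinarith

theorem ceil_mul_le (hl : 1000 ≤ l) (hlx : 10000 * l ^ 2 ≤ x) :
    (⌈x / (50 * l ^ 2)⌉₊ : ℝ) * l ≤ 201 / 10000 * (x / l) := by
  have h1 := (Nat.ceil_lt_add_one (a := x / (50 * l ^ 2))
    (div_nonneg (by nlinarith) (by positivity))).le
  have hl0 : 0 < l := by linarith
  have h2 : 10000 * l ≤ x / l := by
    rw [le_div_iff₀ hl0]; linarith
  have h3 : x / (50 * l ^ 2) * l = 1 / 50 * (x / l) := by field_simp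
  nlinarith [mul_le_mul_of_nonneg_right h1 hl0.le]

/-- The trivial bound costs exp(12kl) and kl ≤ 0.0201 x/l, so the exponent stays below (1/4) x/l.
The constant 50 in the range of z₁, z₂ enters through this bound on kl. -/
theorem pow_ceil_le (hx : 1000 ≤ x) (hl : Real.exp l = x) (hl1 : 1000 ≤ l)
    (hlx : 10000 * l ^ 2 ≤ x) :
    (((⌈x ^ 5⌉₊ : ℕ) : ℝ) + 2) ^ (2 * ⌈x / (50 * l ^ 2)⌉₊) ≤ Real.exp (1 / 4 * (x / l)) := by
  have h1 := ceil_pow_add_two_le hx hl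
  have h2 := ceil_mul_le hl1 hlx
  have h3 : 0 ≤ x / l := div_nonneg (by linarith) (by linarith)
  calc _ ≤ Real.exp (6 * l) ^ (2 * ⌈x / (50 * l ^ 2)⌉₊) := by gcongr
    _ = Real.exp (12 * (⌈x / (50 * l ^ 2)⌉₊ * l)) := by
      rw [← Real.exp_nat_mul]; push_cast; ring_nf
    _ ≤ _ := by
      apply Real.exp_le_exp.mpr
      nlinarith

theorem numFactorizations_ceil_div_le (hx : 1000 ≤ x) (hl : Real.exp l = x) (hl1 : 1000 ≤ l)
    (hlx : 10000 * l ^ 2 ≤ x) {n : ℕ} (hn1 : Real.exp (7 / 10 * x) ≤ n) (hn2 : n < Real.exp x) :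
    (numFactorizations ⌈x / (50 * l ^ 2)⌉₊ n : ℝ) / n ≤ Real.exp (-(x / l)) := by
  have hl0 : 0 < l := by linarith
  have hk := ceil_mul_le hl1 hlx
  set k := ⌈x / (50 * l ^ 2)⌉₊
  set ρ := x / l with hρ
  have hρ0 : 0 ≤ ρ := div_nonneg (by linarith) (by linarith)
  set N := ⌈2 * x⌉₊ with hN
  have hN1 : 2 * x ≤ N := Nat.le_ceil _
  have hN2 : (N : ℝ) ≤ 3 * x := by
    have := Nat.ceil_lt_add_one (a := 2 * x) (by linarith)
    linarith
  have hN0 : (0 : ℝ) < N := by linarith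
  have hn0 : (0 : ℝ) < n := (Real.exp_pos _).trans_le hn1
  have hlogN : Real.log N ≤ l + 2 := by
    rw [Real.log_le_iff_le_exp hN0, Real.exp_add, hl]
    have := Real.add_one_le_exp (2 : ℝ)
    nlinarith
  have hnN : n < 2 ^ (N + 1) := by
    have h : (n : ℝ) < (2 : ℝ) ^ (N + 1) := by
      refine hn2.trans_le ?_
      rw [← Real.exp_log (two_pos : (0 : ℝ) < 2), ← Real.exp_nat_mul]
      apply Real.exp_le_exp.mpr
      have := Real.log_two_gt_d9
      push_cast
      nlinarith
    exact_mod_cast h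
  have hu : 2 / (l + 2) ≤ 1 / 2 := by
    rw [div_le_div_iff₀ (by linarith) (by norm_num)]; linarith
  have hu0 : 0 ≤ 2 / (l + 2) := by positivity
  -- This τ makes N^{1-τ} bounded by e², as log N ≤ l + 2, while n^{-(1-τ)} still saves about
  -- exp(-1.4 x/l) for n ≥ q^{7/10}.
  have h := numFactorizations_div_le k (τ := 1 - 2 / (l + 2)) (by linarith) (by linarith)
    (n := n) (N := N) (by exact_mod_cast hn0.ne') (by exact_mod_cast hN0.ne') hnN
  rw [sub_sub_cancel] at h
  have hNu : (N : ℝ) ^ (2 / (l + 2)) ≤ 7.4 := by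
    rw [Real.rpow_def_of_pos hN0]
    calc Real.exp (Real.log N * (2 / (l + 2))) ≤ Real.exp ((2 : ℕ) * 1) := by
          apply Real.exp_le_exp.mpr
          rw [mul_div_assoc', div_le_iff₀ (by linarith)]
          push_cast
          linarith
      _ ≤ 7.4 := by
          rw [Real.exp_nat_mul]
          have := Real.exp_one_lt_d9
          have := Real.exp_pos 1
          nlinarith
  have hnu : (n : ℝ) ^ (-(2 / (l + 2))) ≤ Real.exp (-(1.39 * ρ)) := by
    rw [Real.rpow_def_of_pos hn0]
    apply Real.exp_le_exp.mpr
    have h1 : 7 / 10 * x ≤ Real.log n := (Real.le_log_iff_exp_le hn0).mpr hn1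
    have h2 : 1.39 * ρ ≤ 7 / 10 * x * (2 / (l + 2)) := by
      rw [hρ, mul_div_assoc', mul_div_assoc', div_le_div_iff₀ hl0 (by linarith)]
      nlinarith
    nlinarith
  refine h.trans ?_
  calc _ ≤ Real.exp (-(1.39 * ρ)) * Real.exp (2 * k * (7.4 * (1.004 * l))) := by
        gcongr
        linarith
    _ ≤ Real.exp (-ρ) := by
        rw [← Real.exp_add]
        apply Real.exp_le_exp.mpr
        -- 2 · 7.4 · 1.004 · 0.0201 < 0.39, so at least exp(-x/l) of the saving survives.
        nlinarith

theorem offDiagonal_ceil_le {q : ℕ} [NeZero q] (hq : Real.exp x = q) (hx : 1000 ≤ x)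
    (hl : Real.exp l = x) (hl1 : 1000 ≤ l) (hlx : 10000 * l ^ 2 ≤ x) :
    offDiagonal q ⌈x / (50 * l ^ 2)⌉₊ (1 + 1 / ((⌈x ^ 5⌉₊ : ℝ) + 1)) ≤
      ENNReal.ofReal (8 * Real.exp (-(x / (2 * l)))) := by
  have hl0 : 0 < l := by linarith
  have hkl := ceil_mul_le hl1 hlx
  have hpow := pow_ceil_le hx hl hl1 hlx
  have hKl := ceil_pow_add_two_le hx hl
  have hnum : ∀ n : ℕ, Real.exp (7 / 10 * x) ≤ n → n < Real.exp x →
    (numFactorizations ⌈x / (50 * l ^ 2)⌉₊ n : ℝ) / n ≤ Real.exp (-(x / l)) :=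
    fun n ↦ numFactorizations_ceil_div_le hx hl hl1 hlx
  have hσ : 1 ≤ 1 + 1 / ((⌈x ^ 5⌉₊ : ℝ) + 1) := le_add_of_nonneg_right (by positivity)
  have hz1 := realZeta_one_add_le ⌈x ^ 5⌉₊
  have hz2 := realZeta_pow_le ⌈x ^ 5⌉₊ (2 * ⌈x / (50 * l ^ 2)⌉₊)
  set k := ⌈x / (50 * l ^ 2)⌉₊
  set K := ⌈x ^ 5⌉₊
  set σ := 1 + 1 / ((K : ℝ) + 1)
  set ρ := x / l with hρ
  have hρl : 10000 * l ≤ ρ := by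
    rw [hρ, le_div_iff₀ hl0]; linarith
  have hxρ : 1000 * ρ ≤ x := by
    rw [hρ, mul_div_assoc', div_le_iff₀ hl0]; nlinarith
  have hx2 : x / (2 * l) = 1 / 2 * ρ := by rw [hρ]; field_simp
  -- B ≈ q^{1/4} makes 1/B negligible and leaves y = q / B above q^{7/10}, where the pointwise
  -- divisor bound applies.
  set B := ⌊Real.exp (1 / 4 * x)⌋₊ with hBdef
  have hB1 : (B : ℝ) ≤ Real.exp (1 / 4 * x) := Nat.floor_le (Real.exp_pos _).le
  have hexp4 : 2 ≤ Real.exp (1 / 4 * x) := by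
    have := Real.add_one_le_exp (1 / 4 * x); linarith
  have hB2 : Real.exp (1 / 4 * x) / 2 ≤ B := by
    have := Nat.lt_floor_add_one (Real.exp (1 / 4 * x)); linarith
  have hB0 : (0 : ℝ) < B := by linarith
  have hBne : B ≠ 0 := by exact_mod_cast hB0.ne'
  have hy : Real.exp (7 / 10 * x) ≤ ((q / B : ℕ) : ℝ) := by
    have h1 : (q : ℝ) / B < ((q / B : ℕ) : ℝ) + 1 := by
      rw [← Nat.floor_div_eq_div (K := ℝ)]; exact Nat.lt_floor_add_one _
    have h2 : Real.exp (3 / 4 * x) ≤ (q : ℝ) / B := by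
      rw [le_div_iff₀ hB0, ← hq]
      calc _ ≤ Real.exp (3 / 4 * x) * Real.exp (1 / 4 * x) := by gcongr
        _ = _ := by rw [← Real.exp_add]; ring_nf
    have h3 : Real.exp (3 / 4 * x) = Real.exp (7 / 10 * x) * Real.exp (1 / 20 * x) := by
      rw [← Real.exp_add]; ring_nf
    have h4 := Real.add_one_le_exp (1 / 20 * x)
    have h5 := Real.add_one_le_exp (7 / 10 * x)
    nlinarith
  have hy1 : 1 < q / B := by
    have h5 := Real.add_one_le_exp (7 / 10 * x)
    have : (1 : ℝ) < ((q / B : ℕ) : ℝ) := by linarith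
    exact_mod_cast this
  have hM : ∀ m, q / B ≤ m → m < q → (numFactorizations k m : ℝ≥0∞) * natRpowNeg σ m ≤
      ENNReal.ofReal (Real.exp (-ρ)) := by
    intro m hm1 hm2
    have hm1' : ((q / B : ℕ) : ℝ) ≤ m := by exact_mod_cast hm1
    have hm2' : (m : ℝ) < Real.exp x := by rw [hq]; exact_mod_cast hm2
    have hm0 : (0 : ℝ) < m := (Real.exp_pos _).trans_le (hy.trans hm1')
    calc _ ≤ (numFactorizations k m : ℝ≥0∞) * (m : ℝ≥0∞)⁻¹ := by
          gcongr
          exact natRpowNeg_le_inv hσ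
      _ = ENNReal.ofReal ((numFactorizations k m : ℝ) / m) := by
          rw [div_eq_mul_inv, ENNReal.ofReal_mul (by positivity), ENNReal.ofReal_natCast,
            ENNReal.ofReal_inv_of_pos hm0, ENNReal.ofReal_natCast]
      _ ≤ _ := ENNReal.ofReal_le_ofReal (hnum m (hy.trans hm1') hm2')
  have hBinv : (B : ℝ≥0∞)⁻¹ ≤ ENNReal.ofReal (2 * Real.exp (-ρ)) := by
    rw [← ENNReal.ofReal_natCast, ← ENNReal.ofReal_inv_of_pos hB0]
    apply ENNReal.ofReal_le_ofReal
    rw [inv_le_iff_one_le_mul₀ hB0]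
    calc (1 : ℝ) ≤ 2 * Real.exp (-ρ) * (Real.exp (1 / 4 * x) / 2) := by
          rw [mul_div_assoc', mul_assoc, ← Real.exp_add, mul_div_cancel_left₀ _ two_ne_zero]
          exact Real.one_le_exp (by linarith)
      _ ≤ _ := by gcongr
  have hqinv : realZeta σ * (q : ℝ≥0∞)⁻¹ ≤ ENNReal.ofReal (Real.exp (-ρ)) := by
    have hq0 : (0 : ℝ) < q := by rw [← hq]; exact Real.exp_pos _
    rw [← ENNReal.ofReal_natCast, ← ENNReal.ofReal_inv_of_pos hq0]
    refine (mul_le_mul_left hz1 _).trans ?_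
    rw [← ENNReal.ofReal_mul (by positivity)]
    apply ENNReal.ofReal_le_ofReal
    rw [← hq, ← Real.exp_neg]
    calc _ ≤ Real.exp (6 * l) * Real.exp (-x) := by gcongr
      _ ≤ _ := by
        rw [← Real.exp_add]
        apply Real.exp_le_exp.mpr
        linarith
  have hk : (k : ℝ) ≤ Real.exp (1 / 10 * ρ) := by
    have h1 := Real.add_one_le_exp (1 / 10 * ρ)
    have h2 : (k : ℝ) ≤ k * l := le_mul_of_one_le_right (by positivity) (by linarith)
    linarith
  refine (offDiagonal_le hσ hBne hy1 (Nat.div_mul_le_self q B) k hM).trans ?_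
  calc _ ≤ ENNReal.ofReal 2 * (ENNReal.ofReal k * ENNReal.ofReal (((K : ℝ) + 2) ^ (2 * k)) *
        (ENNReal.ofReal (Real.exp (-ρ)) + (ENNReal.ofReal (2 * Real.exp (-ρ)) +
          ENNReal.ofReal (Real.exp (-ρ))))) := by
        rw [ENNReal.ofReal_natCast]
        gcongr
        simp
    _ = ENNReal.ofReal (2 * (k * ((K : ℝ) + 2) ^ (2 * k) * (4 * Real.exp (-ρ)))) := by
        rw [← ENNReal.ofReal_add (by positivity) (by positivity),
          ← ENNReal.ofReal_add (by positivity) (by positivity),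
          ← ENNReal.ofReal_mul (by positivity), ← ENNReal.ofReal_mul (by positivity),
          ← ENNReal.ofReal_mul (by positivity)]
        ring_nf
    _ ≤ _ := by
        apply ENNReal.ofReal_le_ofReal
        -- The factor k, the trivial bound and the saving combine to the exponent 1/10 + 1/4 - 1,
        -- below the required -1/2.
        calc _ ≤ 2 * (Real.exp (1 / 10 * ρ) * Real.exp (1 / 4 * ρ) * (4 * Real.exp (-ρ))) := by
              gcongr
          _ = 8 * Real.exp (1 / 10 * ρ + 1 / 4 * ρ + -ρ) := by
              rw [Real.exp_add, Real.exp_add]; ring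
          _ ≤ _ := by
              rw [hx2]
              gcongr
              linarith

/-- The size of F costs at most exp(344 x³/c), whereas r^{-K} with r - 1 ≥ c/(4x) and K ≥ x^5 saves
exp(c x⁴/8), which wins once x c² is large. The fifth power in K is chosen for this. -/
theorem taylor_error_le {c : ℝ} (hc0 : 0 < c) (hc : c ≤ 1 / 2) (hx : 3000 / c ^ 2 ≤ x) {ℓ : ℝ}
    (hℓ1 : x ≤ ℓ) (hℓ2 : ℓ ≤ 2 * x) {a : ℝ} (ha : a ≤ 2 * x) {K : ℕ} (hK : x ^ 5 ≤ K) :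
    Real.exp (a * (43 * ℓ ^ 2 / c)) * (1 + c / (2 * ℓ))⁻¹ ^ K * (1 - (1 + c / (2 * ℓ))⁻¹)⁻¹ ≤
      Real.exp (-x) := by
  have hx' : 3000 ≤ x * c ^ 2 := (div_le_iff₀ (by positivity)).mp hx
  have hx0 : 0 < x := pos_of_mul_pos_left (by linarith) (by positivity : 0 ≤ c ^ 2)
  have hxc : 6000 ≤ x * c := by nlinarith
  have hx1 : 12000 ≤ x := by nlinarith
  have hℓ0 : 0 < ℓ := by linarith
  set h := c / (2 * ℓ) with hh
  have hh0 : 0 < h := by positivity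
  have hh1 : h ≤ 1 / 4 := by
    rw [hh, div_le_iff₀ (by positivity)]; nlinarith
  have hh2 : c / (4 * x) ≤ h := by
    rw [hh, div_le_div_iff₀ (by positivity) (by positivity)]; nlinarith
  have e1 : (1 + h)⁻¹ ≤ Real.exp (-(h / 2)) := by
    rw [Real.exp_neg]
    gcongr
    have h1 := Real.add_one_le_exp (-(h / 2))
    have h2 : Real.exp (h / 2) * Real.exp (-(h / 2)) = 1 := by rw [← Real.exp_add]; simp
    have h3 := Real.exp_pos (h / 2)
    have h4 : Real.exp (h / 2) * (1 - h / 2) ≤ 1 := by nlinarith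
    nlinarith
  have e2 : (1 + h)⁻¹ ^ K ≤ Real.exp (-(c * x ^ 4 / 8)) := by
    calc _ ≤ Real.exp (-(h / 2)) ^ K := by gcongr
      _ = Real.exp (-(K * h / 2)) := by rw [← Real.exp_nat_mul]; ring_nf
      _ ≤ _ := by
        apply Real.exp_le_exp.mpr
        have : x ^ 5 * (c / (4 * x)) ≤ K * h := by gcongr
        have e : x ^ 5 * (c / (4 * x)) = c * x ^ 4 / 4 := by field_simp
        linarith
  have e3 : (1 - (1 + h)⁻¹)⁻¹ ≤ Real.exp x := by
    have e : (1 - (1 + h)⁻¹)⁻¹ = 1 / h + 1 := by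
      have : 1 + h ≠ 0 := by positivity
      have : 1 - (1 + h)⁻¹ = h / (1 + h) := by field_simp; ring
      rw [this, inv_div]; field_simp
    have h1 : 1 / h ≤ x ^ 2 := by
      rw [div_le_iff₀ hh0]
      calc (1 : ℝ) ≤ x * c / 4 := by linarith
        _ = x ^ 2 * (c / (4 * x)) := by field_simp
        _ ≤ _ := by gcongr
    have h2 := Real.pow_div_factorial_le_exp x hx0.le 3
    have h3 : ((Nat.factorial 3 : ℕ) : ℝ) = 6 := by norm_num [Nat.factorial]
    rw [h3] at h2
    rw [e]
    nlinarith [sq_nonneg x]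
  have e4 : a * (43 * ℓ ^ 2 / c) ≤ 344 * x ^ 3 / c := by
    calc _ ≤ 2 * x * (43 * (2 * x) ^ 2 / c) := by gcongr
      _ = _ := by ring
  have e5 : 344 * x ^ 3 / c + 2 * x ≤ c * x ^ 4 / 8 := by
    have h1 : 344 * x ^ 3 / c ≤ c * x ^ 4 / 8 - c * x ^ 4 / 200 := by
      rw [div_le_iff₀ hc0]
      have : x ^ 3 * 3000 ≤ x ^ 3 * (x * c ^ 2) := by gcongr
      linarith [pow_pos hx0 3]
    have h2 : 2 * x ≤ c * x ^ 4 / 200 := by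
      have : 6000 * x ≤ x * c * x ^ 3 := by
        gcongr
        nlinarith [pow_pos hx0 2]
      nlinarith
    linarith
  calc _ ≤ Real.exp (344 * x ^ 3 / c) * Real.exp (-(c * x ^ 4 / 8)) * Real.exp x := by
        gcongr
        rw [inv_nonneg, sub_nonneg]
        exact inv_le_one_of_one_le₀ (by linarith)
    _ ≤ _ := by
        rw [← Real.exp_add, ← Real.exp_add]
        apply Real.exp_le_exp.mpr
        linarith

/-- The exponent k² ≤ x² is negligible beside K ≥ x^5. -/
theorem four_fifths_pow_mul_le (hx : 1000 ≤ x) {k K : ℕ} (hk : (k : ℝ) ≤ x) (hK : x ^ 5 ≤ K) :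
    (4 / 5 : ℝ) ^ K * 3 ^ (k * k) ≤ Real.exp (-x) := by
  have h1 : (4 / 5 : ℝ) ≤ Real.exp (-(1 / 5)) := by
    have := Real.add_one_le_exp (-(1 / 5) : ℝ); linarith
  have h2 : (3 : ℝ) ≤ Real.exp 2 := by
    have := Real.add_one_le_exp (2 : ℝ); linarith
  calc _ ≤ Real.exp (-(1 / 5)) ^ K * Real.exp 2 ^ (k * k) := by gcongr
    _ = Real.exp (-(1 / 5) * K + 2 * (k * k)) := by
      rw [← Real.exp_nat_mul, ← Real.exp_nat_mul, ← Real.exp_add]; push_cast; ring_nf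
    _ ≤ _ := by
      apply Real.exp_le_exp.mpr
      have h3 : (k : ℝ) * k ≤ x * x := by gcongr
      have h4 : x * x * 1000 ≤ x ^ 5 := by
        have : (1000 : ℝ) ≤ x ^ 3 := by nlinarith [sq_nonneg x, pow_le_pow_left₀ (by norm_num) hx 2]
        nlinarith [mul_pos (by linarith : 0 < x) (by linarith : 0 < x)]
      nlinarith

end Parameters

end

/-! ### The moment asymptotics -/

theorem card_compl_goodCharacters_le {q : ℕ} [Fact q.Prime] {c : ℝ}
    (h : ∀ χ : DirichletCharacter ℂ q, χ ^ 2 ≠ 1 → ¬ IsExceptional c χ) :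
    (Finset.univ \ goodCharacters c q).card ≤ 2 := by
  classical
  refine (Finset.card_le_card fun χ hχ ↦ ?_).trans (card_character_sq_eq_one_le q)
  rw [goodCharacters, Finset.mem_sdiff, Finset.mem_filter] at hχ
  rw [Finset.mem_filter]
  refine ⟨Finset.mem_univ _, by_contra fun h2 ↦ hχ.2 ⟨Finset.mem_univ _, ?_, h χ h2⟩⟩
  rintro rfl
  exact h2 (one_pow 2)

theorem norm_average_goodCharacters_sub_le {q : ℕ} [Fact q.Prime] {c x l : ℝ} (hc0 : 0 < c)
    (hc : c ≤ 1 / 2) (hexc : ∀ χ : DirichletCharacter ℂ q, χ ^ 2 ≠ 1 → ¬ IsExceptional c χ)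
    (hxq : Real.log q = x) (hlx : Real.log x = l) (hx : 3000 / c ^ 2 ≤ x) (hl : 1000 ≤ l)
    (hl2 : 10000 * l ^ 2 ≤ x) {z₁ z₂ : ℂ} (h₁ : ‖z₁‖ ≤ x / (50 * l ^ 2))
    (h₂ : ‖z₂‖ ≤ x / (50 * l ^ 2)) :
    ‖1 / (q.totient : ℂ) * ∑ χ ∈ goodCharacters c q, LOnePow χ z₁ * LOnePow (star χ) z₂ -
        ∑' n : ℕ, diagonalTerm q z₁ z₂ n‖ ≤ 50 * Real.exp (-(x / (2 * l))) := by
  classical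
  have hq2 := (Fact.out : q.Prime).two_le
  have hq0 : (0 : ℝ) < q := by exact_mod_cast (by omega : 0 < q)
  have hx1 : 1000 ≤ x := by nlinarith
  have hexpq : Real.exp x = q := by rw [← hxq, Real.exp_log hq0]
  have hexpx : Real.exp l = x := by rw [← hlx, Real.exp_log (by linarith)]
  have hl0 : 0 < l := by linarith
  have hpow := pow_ceil_le hx1 hexpx hl hl2
  have hoff := offDiagonal_ceil_le hexpq hx1 hexpx hl hl2
  have hk1 := Nat.le_ceil (x / (50 * l ^ 2))
  have hK1 := Nat.le_ceil (x ^ 5)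
  have hkx : (⌈x / (50 * l ^ 2)⌉₊ : ℝ) ≤ x := by
    have h1 := Nat.ceil_lt_add_one (a := x / (50 * l ^ 2)) (by positivity)
    have h2 : x / (50 * l ^ 2) ≤ x / 2 := by gcongr; nlinarith
    linarith
  set k := ⌈x / (50 * l ^ 2)⌉₊
  set K := ⌈x ^ 5⌉₊
  have hzx : x / (50 * l ^ 2) ≤ x := hk1.trans hkx
  have hK0 : K ≠ 0 := by
    have : (0 : ℝ) < K := lt_of_lt_of_le (by positivity) hK1
    exact_mod_cast this.ne'
  have hlog4 : Real.log 4 ≤ x := (Real.log_le_sub_one_of_pos (by norm_num)).trans (by linarith)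
  have hlog4' : 0 ≤ Real.log 4 := Real.log_nonneg (by norm_num)
  have hℓ : Real.log (4 * q) = Real.log 4 + x := by
    rw [Real.log_mul (by norm_num) hq0.ne', hxq]
  have hT : Real.exp (-x) ≤ Real.exp (-(x / (2 * l))) := by
    apply Real.exp_le_exp.mpr
    rw [neg_le_neg_iff]
    exact div_le_self (by linarith) (by linarith)
  have hmain := norm_average_sub_le hK0 (h₁.trans hk1) (h₂.trans hk1)
    (δ := 8 * Real.exp (-(x / (2 * l)))) (τ := Real.exp (-x)) (by positivity) (by positivity) hoff
    (A := goodCharacters c q) (card_compl_goodCharacters_le hexc)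
    (f := fun χ ↦ LOnePow χ z₁ * LOnePow (star χ) z₂) ?_
  · refine hmain.trans ?_
    have hlast := four_fifths_pow_mul_le hx1 hkx hK1
    have hmid : (2 : ℕ) / (q.totient : ℝ) * (3 * ((K : ℝ) + 2) ^ (2 * k)) ≤
        12 * Real.exp (-(x / (2 * l))) := by
      have hφ : (q : ℝ) / 2 ≤ q.totient := by
        rw [Nat.totient_prime Fact.out, Nat.cast_sub (by omega)]
        have : (2 : ℝ) ≤ q := by exact_mod_cast hq2
        push_cast
        linarith
      calc _ ≤ 2 / (Real.exp x / 2) * (3 * Real.exp (1 / 4 * (x / l))) := by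
            rw [hexpq]
            gcongr
            norm_num
        _ = 12 * Real.exp (1 / 4 * (x / l) + -x) := by
            rw [Real.exp_add, Real.exp_neg]
            field_simp
            norm_num
        _ ≤ _ := by
            gcongr
            have h1 : x / l ≤ x / 1000 := by gcongr
            have h2 : x / (2 * l) = 1 / 2 * (x / l) := by field_simp
            linarith
    -- The four errors have coefficients 1, 12, 3·8 and 1, in total 38 ≤ 50.
    linarith [Real.exp_pos (-(x / (2 * l)))]
  · intro χ hχ
    rw [goodCharacters, Finset.mem_filter] at hχ
    refine (norm_LOnePow_mul_sub_le hχ.2.1 hc0 hc hχ.2.2 z₁ z₂ K rfl).trans ?_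
    exact taylor_error_le hc0 hc hx (by linarith) (by linarith) (by linarith) hK1

theorem theorem9p2 :
    ∃ c₀ : ℝ, 0 < c₀ ∧ ∀ c : ℝ, 0 < c → c ≤ c₀ →
      ∃ (C : ℝ) (q₀ : ℕ), ∀ (q : ℕ) [Fact q.Prime], q₀ ≤ q → ∀ z₁ z₂ : ℂ,
        ‖z₁‖ ≤ Real.log q / (50 * Real.log (Real.log q) ^ 2) →
        ‖z₂‖ ≤ Real.log q / (50 * Real.log (Real.log q) ^ 2) →
        Summable (fun n : ℕ ↦
          if n.Coprime q then divisorFn z₁ n * divisorFn z₂ n / (n : ℂ) ^ 2 else 0) ∧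
        ‖1 / (Nat.totient q : ℂ) *
              ∑ χ ∈ goodCharacters c q, LOnePow χ z₁ * LOnePow (star χ) z₂ -
            ∑' n : ℕ,
              if n.Coprime q then divisorFn z₁ n * divisorFn z₂ n / (n : ℂ) ^ 2 else 0‖ ≤
          C * Real.exp (-(Real.log q / (2 * Real.log (Real.log q)))) := by
  obtain ⟨c₀, hc₀, hc₀', q₁, hzf⟩ := exists_zeroFree_region
  refine ⟨c₀, hc₀, fun c hc hcc ↦ ?_⟩
  have hlog : Tendsto (fun q : ℕ ↦ Real.log q) atTop atTop :=
    Real.tendsto_log_atTop.comp tendsto_natCast_atTop_atTop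
  have hsq : ∀ᶠ x : ℝ in atTop, 10000 * Real.log x ^ 2 ≤ x := by
    have h2 := (Real.isLittleO_pow_log_id_atTop (n := 2)).bound (c := 1 / 10000) (by norm_num)
    filter_upwards [h2, eventually_ge_atTop 0] with x hx hx0
    rw [id, Real.norm_of_nonneg (sq_nonneg _), Real.norm_of_nonneg hx0] at hx
    linarith
  obtain ⟨q₂, hq₂⟩ := eventually_atTop.mp
    ((hlog.eventually_ge_atTop (3000 / c ^ 2)).and
      (((Real.tendsto_log_atTop.comp hlog).eventually_ge_atTop 1000).and (hlog.eventually hsq)))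
  refine ⟨50, max q₁ q₂, fun q _ hq z₁ z₂ h₁ h₂ ↦ ⟨summable_diagonalTerm q z₁ z₂, ?_⟩⟩
  obtain ⟨hx, hl, hl2⟩ := hq₂ q ((le_max_right _ _).trans hq)
  exact norm_average_goodCharacters_sub_le hc (hcc.trans hc₀')
    (fun χ hχ ↦ hzf q ((le_max_left _ _).trans hq) χ hχ c hcc) rfl rfl hx hl hl2 h₁ h₂
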